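/- Let $N=\{1,\dots,n\}$, let $f:2^N\to\mathbb{R}_{\ge 0}$ be submodular, and let $F(x)=\sum_{S\subseteq N} f(S)\prod_{i\in S}x_i\prod_{j\notin S}(1-x_j)$ be its multilinear extension. Let $P\subseteq[0,1]^N$ be a nonempty polytope that is down-monotone, i.e. $x\in P$, $y\in[0,1]^N$ and $y\le x$ imply $y\in P$. An algorithm has access to $f$ through a value oracle and to $P$ through a linear optimization oracle (for each $c\in\mathbb{R}^N$ it returns a point of $P$ that maximizes $c\cdot x$; that is, $P$ is solvable). Running time counts elementary steps of a uniform randomized program with exact real arithmetic (each arithmetic operation, comparison, assignment and coin toss of prescribed bias costs $O(1)$, each oracle call $n+1$). (a) There is a randomized algorithm that, for all $n$, $f$ and $P$ as above, always runs in time polynomial in $n$, always returns a point $y\in P$, and with probability at least $1-e^{-n}$ achieves $F(y)\ge 0.25\cdot\max\{F(x):x\in P\}$. (b) There is a randomized algorithm that, for all $n$, $f$ and $P$ as above, always runs in time polynomial in $n$, always returns a point $y\in P$, and with probability at least $1-e^{-n}$ achieves $F(y)\ge 0.309\cdot F(x)$ for every $x\in P\cap\{0,1\}^N$. For $R\subseteq\mathbb{R}^N$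 and $\varepsilon\ge 0$ call $x\in R$ an $\varepsilon$-local optimum of $F$ in $R$ if $(y-x)\cdot\nabla F(x)\le\varepsilon$ for all $y\in R$. (c) (Two rounds of local search.) For every $\varepsilon\ge0$, if $x$ is an $\varepsilon$-local optimum of $F$ in $P$ and $z$ is an $\varepsilon$-local optimum of $F$ in $\{y\in P: y\le \mathbf{1}-x\}$, then $\max\{F(x),F(z)\}\ge \frac14\max\{F(w):w\in P\}-\frac{\varepsilon}{2}$. (d) (Restricted local search.) Let $t=\frac{3-\sqrt5}{2}$. For every $\varepsilon\ge 0$ and $0<\eta\le t$, if $x$ is an $\varepsilon$-local optimum of $F$ in $P\cap[0,t]^N$, then $F(x)\ge\left(\frac{\sqrt5-1}{4}-\frac{\eta}{2}\right)F(w)-\frac{\varepsilon}{2\eta}$ for every $w\in P\cap\{0,1\}^N$. In particular, for $\varepsilon=0$, $F(x)\ge\frac{\sqrt5-1}{4}F(w)\ge 0.309\,F(w)$. -/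

import Mathlib

open scoped BigOperators NNReal ENNReal

noncomputable section

namespace MultilinearRelaxation

/-! ### Submodular functions, multilinear extension, polytopes -/

/-- `f` is nonnegative. -/
def Nonneg {n : ℕ} (f : Finset (Fin n) → ℝ) : Prop := ∀ S, 0 ≤ f S

/-- `f` is submodular. -/
def Submodular {n : ℕ} (f : Finset (Fin n) → ℝ) : Prop :=
  ∀ A B, f (A ∪ B) + f (A ∩ B) ≤ f A + f B

/-- The multilinear extension `F(x) = ∑_S f(S) ∏_{i ∈ S} x_i ∏_{j ∉ S} (1 - x_j)`. -/
def multilinearExt {n : ℕ} (f : Finset (Fin n) → ℝ) (x : Fin n → ℝ) : ℝ :=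
  ∑ S : Finset (Fin n), f S * ((∏ i ∈ S, x i) * ∏ j ∈ Sᶜ, (1 - x j))

/-- A polytope: the convex hull of a finite set of points. -/
def IsPolytope {n : ℕ} (P : Set (Fin n → ℝ)) : Prop :=
  ∃ V : Finset (Fin n → ℝ), P = convexHull ℝ (V : Set (Fin n → ℝ))

/-- `P ⊆ [0,1]^N`, and with `x` it contains every `y ∈ [0,1]^N` with `y ≤ x`. -/
def DownMonotone {n : ℕ} (P : Set (Fin n → ℝ)) : Prop :=
  P ⊆ Set.Icc 0 1 ∧ ∀ x ∈ P, ∀ y ∈ Set.Icc (0 : Fin n → ℝ) 1, y ≤ x → y ∈ P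

/-- `opt` is a linear optimization oracle for `P`: for every objective vector `c` it returns a
point of `P` that maximizes `c · x` over `P` (ties are broken arbitrarily). -/
def IsLinOptOracle {n : ℕ} (P : Set (Fin n → ℝ)) (opt : (Fin n → ℝ) → Fin n → ℝ) : Prop :=
  ∀ c, opt c ∈ P ∧ ∀ x ∈ P, ∑ i, c i * x i ≤ ∑ i, c i * opt c i

/-- An integer point. -/
def IsIntegral {n : ℕ} (x : Fin n → ℝ) : Prop := ∀ i, x i = 0 ∨ x i = 1

/-- `x` is a local optimum of `F` in `R` up to `ε`, in the first-order sense: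
`x ∈ R` and `(y - x) · ∇F(x) ≤ ε` for all `y ∈ R`. -/
def IsLocalOpt {n : ℕ} (f : Finset (Fin n) → ℝ) (R : Set (Fin n → ℝ)) (ε : ℝ)
    (x : Fin n → ℝ) : Prop :=
  x ∈ R ∧ ∀ y ∈ R, fderiv ℝ (multilinearExt f) x (y - x) ≤ ε

/-! ### Randomized programs with oracles

A machine with natural-number registers (for counters and indices), arrays of real numbers, exact
real arithmetic at unit cost, coin tosses, a value oracle for `f` and a linear optimization oracle
for `P`. A program is a finite text that does not depend on the input, and the only constants in
it are natural numbers. All loops are bounded, so every program halts; every elementary operation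
is charged. -/

/-- Natural-number expressions. -/
inductive NatExp where
  | const (k : ℕ)
  | var (v : ℕ)
  | add (a b : NatExp)
  | sub (a b : NatExp)

/-- Real expressions; `cell a i` is the `i`-th entry of array number `a`. -/
inductive RealExp where
  | const (k : ℕ)
  | cell (a : ℕ) (i : NatExp)
  | add (a b : RealExp)
  | sub (a b : RealExp)
  | mul (a b : RealExp)
  | div (a b : RealExp)

/-- Tests. -/
inductive Cond where
  | natLt (a b : NatExp)
  | realLt (a b : RealExp)

/-- Programs. -/
inductive Prog where
  /-- do nothing -/
  | skip
  /-- assign to register `v` -/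
  | setNat (v : ℕ) (e : NatExp)
  /-- assign to the `i`-th entry of array `a` -/
  | setReal (a : ℕ) (i : NatExp) (e : RealExp)
  /-- toss a coin: register `v` becomes 1 with probability `e` (cut off to `[0,1]`), else 0 -/
  | flip (v : ℕ) (e : RealExp)
  /-- value oracle: entry 0 of array `b` becomes `f S`, where `S` is the set of the `i` such that
  the `i`-th entry of array `a` is nonzero -/
  | value (a b : ℕ)
  /-- linear optimization oracle: the first `n` entries of array `b` become the answer to the
  objective vector held by the first `n` entries of array `a` -/
  | linopt (a b : ℕ)
  /-- one program after the other -/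
  | seq (p q : Prog)
  /-- branch -/
  | ite (c : Cond) (p q : Prog)
  /-- execute the body as many times as the value that `e` has on entry -/
  | loop (e : NatExp) (p : Prog)

/-- A state of the machine: the registers, the arrays, and the number of steps made so far. -/
structure State where
  nat : ℕ → ℕ
  real : ℕ → ℕ → ℝ
  steps : ℕ

/-- Value of a natural-number expression (subtraction is truncated). -/
def NatExp.eval (s : State) : NatExp → ℕ
  | .const k => k
  | .var v => s.nat v
  | .add a b => a.eval s + b.eval s
  | .sub a b => a.eval s - b.eval s

/-- Number of steps to evaluate a natural-number expression. -/
def NatExp.cost : NatExp → ℕ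
  | .const _ => 1
  | .var _ => 1
  | .add a b => a.cost + b.cost + 1
  | .sub a b => a.cost + b.cost + 1

/-- Value of a real expression (the machine answers 0 to a division by 0). -/
def RealExp.eval (s : State) : RealExp → ℝ
  | .const k => (k : ℝ)
  | .cell a i => s.real a (i.eval s)
  | .add a b => a.eval s + b.eval s
  | .sub a b => a.eval s - b.eval s
  | .mul a b => a.eval s * b.eval s
  | .div a b => a.eval s / b.eval s

/-- Number of steps to evaluate a real expression. -/
def RealExp.cost : RealExp → ℕ
  | .const _ => 1
  | .cell _ i => i.cost + 1
  | .add a b => a.cost + b.cost + 1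
  | .sub a b => a.cost + b.cost + 1
  | .mul a b => a.cost + b.cost + 1
  | .div a b => a.cost + b.cost + 1

/-- Truth of a test. -/
def Cond.holds (s : State) : Cond → Prop
  | .natLt a b => a.eval s < b.eval s
  | .realLt a b => a.eval s < b.eval s

/-- Number of steps to evaluate a test. -/
def Cond.cost : Cond → ℕ
  | .natLt a b => a.cost + b.cost + 1
  | .realLt a b => a.cost + b.cost + 1

/-- Charge `k` steps. -/
def State.tick (s : State) (k : ℕ) : State := { s with steps := s.steps + k }

/-- Assign to a register. -/
def State.writeNat (s : State) (v k : ℕ) : State := { s with nat := Function.update s.nat v k }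

/-- Assign to an array entry. -/
def State.writeReal (s : State) (a i : ℕ) (r : ℝ) : State :=
  { s with real := Function.update s.real a (Function.update (s.real a) i r) }

/-- The first `n` entries of array `a`. -/
def State.readVec (s : State) (n a : ℕ) : Fin n → ℝ := fun i => s.real a i

/-- Overwrite the first `n` entries of array `a`. -/
def State.writeVec (s : State) {n : ℕ} (a : ℕ) (x : Fin n → ℝ) : State :=
  { s with
    real := Function.update s.real a fun j => if h : j < n then x ⟨j, h⟩ else s.real a j }

/-- A coin that shows `true` with probability `p`, cut off to `[0,1]`. -/
def coin (p : ℝ) : PMF Bool :=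
  PMF.ofFintype (fun b => if b then min 1 (ENNReal.ofReal p) else 1 - min 1 (ENNReal.ofReal p))
    (by simp [add_tsub_cancel_of_le])

open Classical in
/-- Execution of a program with the value oracle `f` and the linear optimization oracle `opt`:
the distribution of the final state. -/
def Prog.exec {n : ℕ} (f : Finset (Fin n) → ℝ) (opt : (Fin n → ℝ) → Fin n → ℝ) :
    Prog → State → PMF State
  | .skip, s => PMF.pure (s.tick 1)
  | .setNat v e, s => PMF.pure ((s.writeNat v (e.eval s)).tick (e.cost + 1))
  | .setReal a i e, s =>
      PMF.pure ((s.writeReal a (i.eval s) (e.eval s)).tick (i.cost + e.cost + 1))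
  | .flip v e, s =>
      (coin (e.eval s)).bind fun b =>
        PMF.pure ((s.writeNat v (if b then 1 else 0)).tick (e.cost + 1))
  | .value a b, s =>
      PMF.pure ((s.writeReal b 0 (f (Finset.univ.filter fun i => s.readVec n a i ≠ 0))).tick
        (n + 1))
  | .linopt a b, s => PMF.pure ((s.writeVec b (opt (s.readVec n a))).tick (n + 1))
  | .seq p q, s => (p.exec f opt s).bind fun s' => q.exec f opt s'
  | .ite c p q, s =>
      if c.holds s then p.exec f opt (s.tick c.cost) else q.exec f opt (s.tick c.cost)
  | .loop e p, s =>
      Nat.rec (motive := fun _ => PMF State) (PMF.pure (s.tick (e.cost + 1)))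
        (fun _ d => d.bind fun s' => p.exec f opt (s'.tick 1)) (e.eval s)

/-- At the start, register 0 holds `n` and everything else is 0. -/
def initState (n : ℕ) : State where
  nat := fun v => if v = 0 then n else 0
  real := fun _ _ => 0
  steps := 0

/-- The distribution of the final state of a program on an instance. -/
def Prog.run {n : ℕ} (A : Prog) (f : Finset (Fin n) → ℝ) (opt : (Fin n → ℝ) → Fin n → ℝ) :
    PMF State :=
  A.exec f opt (initState n)

/-- The output point: the first `n` entries of array 0. -/
def State.output (s : State) (n : ℕ) : Fin n → ℝ := s.readVec n 0

/-- `A` is a randomized polynomial-time algorithm which, on every instance (a nonnegative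
submodular `f` given by a value oracle, and a down-monotone polytope `P` given by a linear
optimization oracle), always makes at most polynomially many steps and returns a point `y ∈ P`,
and which with probability at least `1 - exp (-n)` satisfies `F(y) ≥ α F(x)` for all `x ∈ P` that
have the property `C`, i.e. `F(y) ≥ α · max {F(x) : x ∈ P, C x}`. -/
def IsPolyTimeApprox (α : ℝ) (C : ∀ {n : ℕ}, (Fin n → ℝ) → Prop) (A : Prog) : Prop :=
  ∃ p : Polynomial ℕ, ∀ (n : ℕ) (f : Finset (Fin n) → ℝ) (P : Set (Fin n → ℝ))
    (opt : (Fin n → ℝ) → Fin n → ℝ),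
    Nonneg f → Submodular f → IsPolytope P → DownMonotone P → IsLinOptOracle P opt →
    (∀ s ∈ (A.run f opt).support, s.steps ≤ p.eval n ∧ s.output n ∈ P) ∧
    ENNReal.ofReal (1 - Real.exp (-(n : ℝ))) ≤
      (A.run f opt).toOuterMeasure
        {s | ∀ x ∈ P, C x → α * multilinearExt f x ≤ multilinearExt f (s.output n)}

end MultilinearRelaxation

end

noncomputable section

namespace MultilinearRelaxation

/-! ### The multilinear extension -/

section Multilinear

variable {n : ℕ}

/-! Two facts about the multilinear extension F of a submodular f carry everything: F is affine in
each coordinate, and its partial derivatives decrease in every coordinate (`partialDeriv_antitone`).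
Hence F is concave along nonnegative directions (`multilinearExt_concave`), and F(c) + F(d) ≤ F(a) +
F(b) whenever c ≤ a, b ≤ d and c + d = a + b (`multilinearExt_diminishing`).

Parts (c) and (d): at an ε-local optimum x, the derivative towards y gives F(x ⊔ y) + F(x ⊓ y) ≤ 2
F(x) + ε (`sup_add_inf_le_of_fderiv_le`). The two-round bound applies this at both optima and
recovers F(w) by two uses of diminishing returns. The restricted bound applies it to a shrunken copy
of w towards which one can move inside the box; the value of t, a root of (1 - t)² = t, balances the
resulting terms.

Parts (a) and (b): one program serves both, and it is not local search but the measured continuous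
greedy process. The obstacle is sampling: f({i}) can exceed the optimum by any factor if x_i is tiny
throughout P. So i is called common if some point of P has x_i ≥ 1/(50n), and rare otherwise. On
sets of common elements f is at most 51n² times the best common value (`Classified.value_le`);
polynomially many samples then estimate all marginals, by an exponential supermartingale
(`failProb_sampleProg`), and the greedy process reaches about 1/e of that best value
(`failProb_greedyProg`). A random set of rare elements has expected size at most 1/50, so there F is
linear up to a factor 49/50, and one oracle call solves the linear problem
(`Classified.multilinearExt_ge`). The program returns the better of the two points.

Every F(x) is at most its common part plus its rare part, and 1/(1/0.36 + 1/0.98) > 0.26 leaves room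
for the sampling error above 0.25. An integral point of P uses only common elements, so against such
points the ratio is 0.36 minus the error, which exceeds 0.309.

The running time is read off the program text: all loop bounds depend on registers that the loops
never write (`sure_steps_le`). -/

/-- The probability that independent rounding of `x` yields the set `S`. -/
def weight (x : Fin n → ℝ) (S : Finset (Fin n)) : ℝ :=
  ∏ i, if i ∈ S then x i else 1 - x i

theorem multilinearExt_eq_sum_weight (f : Finset (Fin n) → ℝ) (x : Fin n → ℝ) :
    multilinearExt f x = ∑ S, f S * weight x S := by
  unfold multilinearExt weight
  refine Finset.sum_congr rfl fun S _ => ?_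
  rw [← Finset.prod_mul_prod_compl S]
  congr 2
  · exact Finset.prod_congr rfl fun i hi => by simp [hi]
  · exact Finset.prod_congr rfl fun i hi => by simp [Finset.mem_compl.1 hi]

theorem weight_nonneg {x : Fin n → ℝ} (hx : x ∈ Set.Icc (0 : Fin n → ℝ) 1)
    (S : Finset (Fin n)) : 0 ≤ weight x S := by
  refine Finset.prod_nonneg fun i _ => ?_
  have h0 := hx.1 i
  have h1 := hx.2 i
  simp only [Pi.zero_apply, Pi.one_apply] at h0 h1
  split_ifs <;> linarith

theorem weight_update (x : Fin n → ℝ) (S : Finset (Fin n)) (i : Fin n) (r : ℝ) :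
    weight (Function.update x i r) S =
      (if i ∈ S then r else 1 - r) * ∏ j ∈ Finset.univ.erase i, if j ∈ S then x j else 1 - x j := by
  unfold weight
  rw [← Finset.mul_prod_erase Finset.univ _ (Finset.mem_univ i)]
  simp only [Function.update_self]
  congr 1
  refine Finset.prod_congr rfl fun j hj => ?_
  rw [Function.update_of_ne (Finset.ne_of_mem_erase hj)]

/-- Each weight has exactly one factor involving coordinate i, and that factor is affine. All
derivative computations reduce to this. -/
theorem multilinearExt_update (f : Finset (Fin n) → ℝ) (x : Fin n → ℝ) (i : Fin n) (r : ℝ) :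
    multilinearExt f (Function.update x i r) =
      (1 - r) * multilinearExt f (Function.update x i 0)
        + r * multilinearExt f (Function.update x i 1) := by
  simp only [multilinearExt_eq_sum_weight, Finset.mul_sum, ← Finset.sum_add_distrib]
  refine Finset.sum_congr rfl fun S _ => ?_
  simp only [weight_update]
  split_ifs <;> ring

theorem multilinearExt_split (f : Finset (Fin n) → ℝ) (x : Fin n → ℝ) (i : Fin n) :
    multilinearExt f x = (1 - x i) * multilinearExt f (Function.update x i 0)
        + x i * multilinearExt f (Function.update x i 1) := by
  rw [← multilinearExt_update, Function.update_eq_self]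

/-- Partial derivative of the multilinear extension. -/
def partialDeriv (f : Finset (Fin n) → ℝ) (i : Fin n) (x : Fin n → ℝ) : ℝ :=
  multilinearExt f (Function.update x i 1) - multilinearExt f (Function.update x i 0)

theorem multilinearExt_update_sub (f : Finset (Fin n) → ℝ) (x : Fin n → ℝ) (i : Fin n) (r : ℝ) :
    multilinearExt f (Function.update x i r) - multilinearExt f x =
      (r - x i) * partialDeriv f i x := by
  rw [multilinearExt_split f x i, multilinearExt_update f x i r, partialDeriv]
  ring

theorem sum_weight (x : Fin n → ℝ) : ∑ S, weight x S = 1 := by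
  have h := Finset.prod_add x (fun i => 1 - x i) Finset.univ
  simp only [add_sub_cancel, Finset.prod_const_one, Finset.powerset_univ] at h
  rw [h]
  refine Finset.sum_congr rfl fun S _ => ?_
  unfold weight
  rw [← Finset.prod_mul_prod_compl S, ← Finset.compl_eq_univ_sdiff]
  congr 1
  · exact Finset.prod_congr rfl fun i hi => by simp [hi]
  · exact Finset.prod_congr rfl fun i hi => by simp [Finset.mem_compl.1 hi]

theorem multilinearExt_const (c : ℝ) (x : Fin n → ℝ) :
    multilinearExt (fun _ => c) x = c := by
  rw [multilinearExt_eq_sum_weight, ← Finset.mul_sum, sum_weight, mul_one]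

theorem weight_eq_zero {x : Fin n → ℝ} {S : Finset (Fin n)} {i : Fin n} (hi : i ∈ S)
    (h : x i = 0) : weight x S = 0 :=
  Finset.prod_eq_zero (Finset.mem_univ i) (by simp [hi, h])

/-- Sets meeting the zero coordinates of x have weight 0. This form is needed because f is
controlled only on sets of common elements. -/
theorem multilinearExt_mono_of_support {f g : Finset (Fin n) → ℝ} {x : Fin n → ℝ}
    (hx : x ∈ Set.Icc (0 : Fin n → ℝ) 1)
    (h : ∀ S : Finset (Fin n), (∀ i ∈ S, x i ≠ 0) → f S ≤ g S) :
    multilinearExt f x ≤ multilinearExt g x := by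
  simp only [multilinearExt_eq_sum_weight]
  refine Finset.sum_le_sum fun S _ => ?_
  by_cases hS : ∀ i ∈ S, x i ≠ 0
  · exact mul_le_mul_of_nonneg_right (h S hS) (weight_nonneg hx S)
  · push Not at hS
    obtain ⟨i, hi, h0⟩ := hS
    simp [weight_eq_zero hi h0]

theorem multilinearExt_mono {f g : Finset (Fin n) → ℝ} {x : Fin n → ℝ}
    (hx : x ∈ Set.Icc (0 : Fin n → ℝ) 1) (h : ∀ S, f S ≤ g S) :
    multilinearExt f x ≤ multilinearExt g x :=
  multilinearExt_mono_of_support hx fun S _ => h S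

theorem multilinearExt_nonneg {f : Finset (Fin n) → ℝ} (hf : Nonneg f) {x : Fin n → ℝ}
    (hx : x ∈ Set.Icc (0 : Fin n → ℝ) 1) : 0 ≤ multilinearExt f x := by
  rw [← multilinearExt_const 0 x]
  exact multilinearExt_mono hx hf

theorem multilinearExt_add (f g : Finset (Fin n) → ℝ) (x : Fin n → ℝ) :
    multilinearExt (fun S => f S + g S) x = multilinearExt f x + multilinearExt g x := by
  simp only [multilinearExt_eq_sum_weight, ← Finset.sum_add_distrib, add_mul]

theorem multilinearExt_mul_left (c : ℝ) (f : Finset (Fin n) → ℝ) (x : Fin n → ℝ) :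
    multilinearExt (fun S => c * f S) x = c * multilinearExt f x := by
  simp only [multilinearExt_eq_sum_weight, Finset.mul_sum, mul_assoc]

theorem multilinearExt_sum {ι : Type*} (s : Finset ι) (f : ι → Finset (Fin n) → ℝ)
    (x : Fin n → ℝ) :
    multilinearExt (fun S => ∑ k ∈ s, f k S) x = ∑ k ∈ s, multilinearExt (f k) x := by
  simp only [multilinearExt_eq_sum_weight, Finset.sum_mul]
  exact Finset.sum_comm

/-- The extension at an integral point. -/
theorem multilinearExt_indicator (f : Finset (Fin n) → ℝ) (S : Finset (Fin n)) :
    multilinearExt f (fun i => if i ∈ S then 1 else 0) = f S := by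
  rw [multilinearExt_eq_sum_weight, Finset.sum_eq_single S]
  · have : weight (fun i => if i ∈ S then (1 : ℝ) else 0) S = 1 :=
      Finset.prod_eq_one fun i _ => by by_cases h : i ∈ S <;> simp [h]
    rw [this, mul_one]
  · intro T _ hT
    have : ∃ i, ¬ (i ∈ T ↔ i ∈ S) := by
      by_contra! h
      exact hT (Finset.ext h)
    obtain ⟨i, hi⟩ := this
    rw [weight, Finset.prod_eq_zero (Finset.mem_univ i), mul_zero]
    by_cases h : i ∈ S <;> by_cases h' : i ∈ T <;> simp_all
  · simp

/-- Turns a coordinate substitution into a change of the set function, so that submodularity can be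
applied set by set. The function f(insert i ·) ignores whether i is present, so its extension does
not depend on coordinate i; at coordinate value 1 it agrees with f. -/
theorem multilinearExt_update_one (f : Finset (Fin n) → ℝ) (x : Fin n → ℝ) (i : Fin n) :
    multilinearExt f (Function.update x i 1) = multilinearExt (fun S => f (insert i S)) x := by
  have key : ∀ r, multilinearExt (fun S => f (insert i S)) (Function.update x i 1)
      = multilinearExt (fun S => f (insert i S)) (Function.update x i r) := by
    have h01 : multilinearExt (fun S => f (insert i S)) (Function.update x i 0)
        = multilinearExt (fun S => f (insert i S)) (Function.update x i 1) := by
      simp only [multilinearExt_eq_sum_weight]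
      -- Toggling i exchanges the weights for coordinate values 0 and 1 and leaves f(insert i ·)
      -- unchanged.
      have hinv : Function.Involutive fun S : Finset (Fin n) => symmDiff S {i} :=
        fun S => symmDiff_symmDiff_cancel_right _ _
      refine Fintype.sum_equiv hinv.toPerm _ _ fun S => ?_
      have h1 : insert i (symmDiff S {i}) = insert i S := by
        ext j; by_cases h : j = i <;> simp [Finset.mem_symmDiff, h]
      simp only [Function.Involutive.coe_toPerm, h1, weight_update]
      have h2 : ∀ j ∈ Finset.univ.erase i,
          (if j ∈ symmDiff S {i} then x j else 1 - x j) = if j ∈ S then x j else 1 - x j := by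
        intro j hj
        have := Finset.ne_of_mem_erase hj
        simp [Finset.mem_symmDiff, this]
      rw [Finset.prod_congr rfl h2]
      by_cases h : i ∈ S <;> simp [Finset.mem_symmDiff, h]
    intro r
    rw [multilinearExt_update _ x i r, h01]
    ring
  have h := key (x i)
  rw [Function.update_eq_self] at h
  rw [← h]
  simp only [multilinearExt_eq_sum_weight]
  refine Finset.sum_congr rfl fun S _ => ?_
  by_cases h : i ∈ S
  · rw [Finset.insert_eq_of_mem h]
  · simp [weight_update, h]

theorem multilinearExt_update_zero (f : Finset (Fin n) → ℝ) (x : Fin n → ℝ) (i : Fin n) :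
    multilinearExt f (Function.update x i 0) = multilinearExt (fun S => f (S.erase i)) x := by
  have h2 : multilinearExt (fun S => f (S.erase i)) (Function.update x i 0)
      = multilinearExt f (Function.update x i 0) := by
    simp only [multilinearExt_eq_sum_weight]
    refine Finset.sum_congr rfl fun S _ => ?_
    by_cases h : i ∈ S
    · simp [weight_update, h]
    · rw [Finset.erase_eq_of_notMem h]
  have h3 := multilinearExt_update_one (fun S => f (S.erase i)) (Function.update x i 0) i
  have h4 := multilinearExt_update (fun S => f (S.erase i)) x i (x i)
  rw [Function.update_eq_self] at h4
  simp only [Finset.erase_insert_eq_erase, Function.update_idem] at h3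
  rw [h2] at h3
  rw [h4, h2, h3]
  ring

theorem update_mem_cube {x : Fin n → ℝ} (hx : x ∈ Set.Icc (0 : Fin n → ℝ) 1) (i : Fin n)
    {r : ℝ} (hr : r ∈ Set.Icc (0 : ℝ) 1) : Function.update x i r ∈ Set.Icc (0 : Fin n → ℝ) 1 := by
  constructor <;> intro j <;> by_cases h : j = i
  · subst h; simpa using hr.1
  · simpa [h] using hx.1 j
  · subst h; simpa using hr.2
  · simpa [h] using hx.2 j

/-! ### Submodularity: decreasing partial derivatives and concavity -/

theorem partialDeriv_update_self (f : Finset (Fin n) → ℝ) (i : Fin n) (x : Fin n → ℝ) (r : ℝ) :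
    partialDeriv f i (Function.update x i r) = partialDeriv f i x := by
  simp [partialDeriv]

/-- The partial derivative is affine in coordinate j, so only the values at j = 0 and j = 1 matter;
their comparison is the nonpositivity of the mixed second difference, averaged over random sets. -/
theorem partialDeriv_update_le {f : Finset (Fin n) → ℝ} (hf : Submodular f) (i j : Fin n)
    {x : Fin n → ℝ} (hx : x ∈ Set.Icc (0 : Fin n → ℝ) 1) {r : ℝ} (hr : x j ≤ r) :
    partialDeriv f i (Function.update x j r) ≤ partialDeriv f i x := by
  by_cases hij : j = i
  · subst hij; rw [partialDeriv_update_self]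
  have hs : ∀ s, partialDeriv f i (Function.update x j s) =
      (1 - s) * partialDeriv f i (Function.update x j 0)
        + s * partialDeriv f i (Function.update x j 1) := by
    intro s
    simp only [partialDeriv, Function.update_comm hij]
    rw [multilinearExt_update _ (Function.update x i 1) j s,
      multilinearExt_update _ (Function.update x i 0) j s]
    ring
  have h01 : partialDeriv f i (Function.update x j 1) ≤ partialDeriv f i (Function.update x j 0) := by
    simp only [partialDeriv, multilinearExt_update_one, multilinearExt_update_zero]
    rw [sub_le_sub_iff, ← multilinearExt_add, ← multilinearExt_add]
    refine multilinearExt_mono hx fun S => ?_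
    -- These two sets contain only i and only j of the pair; their union and intersection contain
    -- both and neither.
    have h := hf (insert i (S.erase j)) ((insert j S).erase i)
    have e1 : insert i (S.erase j) ∪ (insert j S).erase i = insert i (insert j S) := by
      ext k
      by_cases h1 : k = i <;> by_cases h2 : k = j <;> simp [h1, h2]
      exact em _
    have e2 : insert i (S.erase j) ∩ (insert j S).erase i = (S.erase j).erase i := by
      ext k; by_cases h1 : k = i <;> by_cases h2 : k = j <;> simp [h1, h2]
    rw [e1, e2] at h
    exact h
  have h1 := hs r
  have h2 := hs (x j)
  rw [Function.update_eq_self] at h2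
  rw [h1, h2]
  nlinarith

theorem partialDeriv_antitone {f : Finset (Fin n) → ℝ} (hf : Submodular f) (i : Fin n)
    {x y : Fin n → ℝ} (hx : 0 ≤ x) (hxy : x ≤ y) (hy : y ≤ 1) :
    partialDeriv f i y ≤ partialDeriv f i x := by
  classical
  have key : ∀ T : Finset (Fin n), partialDeriv f i (T.piecewise y x) ≤ partialDeriv f i x := by
    intro T
    induction T using Finset.induction_on with
    | empty => simp
    | insert j T hj ih =>
      rw [Finset.piecewise_insert]
      refine le_trans (partialDeriv_update_le hf i j ?_ ?_) ih
      · exact ⟨Finset.le_piecewise_of_le_of_le _ (hx.trans hxy) hx,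
          Finset.piecewise_le_of_le_of_le _ hy (hxy.trans hy)⟩
      · simpa [hj] using hxy j
  simpa using key Finset.univ

/-- `F(x + p) - F(x) ≤ p · ∇F(x)` for `p ≥ 0`. -/
theorem multilinearExt_add_sub_le {f : Finset (Fin n) → ℝ} (hf : Submodular f)
    {x y : Fin n → ℝ} (hx : 0 ≤ x) (hxy : x ≤ y) (hy : y ≤ 1) :
    multilinearExt f y - multilinearExt f x ≤ ∑ i, (y i - x i) * partialDeriv f i x := by
  classical
  -- Walk from x to y one coordinate at a time; each step is exact with the derivative at the
  -- current point, which is at most the derivative at x.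
  have key : ∀ T : Finset (Fin n), multilinearExt f (T.piecewise y x) - multilinearExt f x
      ≤ ∑ i ∈ T, (y i - x i) * partialDeriv f i x := by
    intro T
    induction T using Finset.induction_on with
    | empty => simp
    | insert j T hj ih =>
      rw [Finset.piecewise_insert, Finset.sum_insert hj]
      have h1 := multilinearExt_update_sub f (T.piecewise y x) j (y j)
      have h2 : partialDeriv f j (T.piecewise y x) ≤ partialDeriv f j x :=
        partialDeriv_antitone hf j hx (Finset.le_piecewise_of_le_of_le _ hxy le_rfl)
          (Finset.piecewise_le_of_le_of_le _ hy (hxy.trans hy))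
      have h3 := mul_le_mul_of_nonneg_left h2 (sub_nonneg.2 (hxy j))
      simp only [hj, not_false_eq_true, Finset.piecewise_eq_of_notMem] at h1
      linarith
  simpa using key Finset.univ

/-- `F(y) - F(x) ≥ (y - x) · ∇F(y)` for `x ≤ y`. -/
theorem le_multilinearExt_sub {f : Finset (Fin n) → ℝ} (hf : Submodular f)
    {x y : Fin n → ℝ} (hx : 0 ≤ x) (hxy : x ≤ y) (hy : y ≤ 1) :
    ∑ i, (y i - x i) * partialDeriv f i y ≤ multilinearExt f y - multilinearExt f x := by
  classical
  have key : ∀ T : Finset (Fin n), ∑ i ∈ T, (y i - x i) * partialDeriv f i y ≤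
      multilinearExt f (T.piecewise y x) - multilinearExt f x := by
    intro T
    induction T using Finset.induction_on with
    | empty => simp
    | insert j T hj ih =>
      rw [Finset.piecewise_insert, Finset.sum_insert hj]
      have h1 := multilinearExt_update_sub f (T.piecewise y x) j (y j)
      have h2 : partialDeriv f j y ≤ partialDeriv f j (T.piecewise y x) :=
        partialDeriv_antitone hf j (Finset.le_piecewise_of_le_of_le _ (hx.trans hxy) hx)
          (Finset.piecewise_le_of_le_of_le _ le_rfl hxy) hy
      have h3 := mul_le_mul_of_nonneg_left h2 (sub_nonneg.2 (hxy j))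
      simp only [hj, not_false_eq_true, Finset.piecewise_eq_of_notMem] at h1
      linarith
  simpa using key Finset.univ

/-- Diminishing returns of the multilinear extension: the increment from `c` to `a` is at least
the increment from `b` to `d`, where `d - b = a - c ≥ 0` and `c ≤ b`. -/
theorem multilinearExt_diminishing {f : Finset (Fin n) → ℝ} (hf : Submodular f)
    {a b c d : Fin n → ℝ} (hc : 0 ≤ c) (hca : c ≤ a) (hcb : c ≤ b) (hd : d ≤ 1)
    (h : c + d = a + b) :
    multilinearExt f c + multilinearExt f d ≤ multilinearExt f a + multilinearExt f b := by
  classical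
  have h' : ∀ i, c i + d i = a i + b i := fun i => congrFun h i
  have hbd : b ≤ d := fun i => by have := h' i; have := hca i; linarith
  have had : a ≤ d := fun i => by have := h' i; have := hcb i; linarith
  -- Two parallel walks, from b to d and from c to a, with equal steps; the lower walk sees the
  -- larger derivatives.
  have key : ∀ T : Finset (Fin n),
      multilinearExt f (T.piecewise d b) - multilinearExt f b ≤
      multilinearExt f (T.piecewise a c) - multilinearExt f c := by
    intro T
    induction T using Finset.induction_on with
    | empty => simp
    | insert j T hj ih =>
      simp only [Finset.piecewise_insert]
      have h1 := multilinearExt_update_sub f (T.piecewise d b) j (d j)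
      have h2 := multilinearExt_update_sub f (T.piecewise a c) j (a j)
      have h3 : partialDeriv f j (T.piecewise d b) ≤ partialDeriv f j (T.piecewise a c) :=
        partialDeriv_antitone hf j (Finset.le_piecewise_of_le_of_le _ (hc.trans hca) hc)
          (Finset.piecewise_le_piecewise _ had hcb)
          (Finset.piecewise_le_of_le_of_le _ hd (hbd.trans hd))
      have h4 := mul_le_mul_of_nonneg_left h3 (sub_nonneg.2 (hca j))
      simp only [hj, not_false_eq_true, Finset.piecewise_eq_of_notMem] at h1 h2
      have h5 : d j - b j = a j - c j := by linarith [h' j]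
      rw [h5] at h1
      linarith
  have := key Finset.univ
  simp only [Finset.piecewise_univ] at this
  linarith

/-- Concavity along nonnegative directions. -/
theorem multilinearExt_concave {f : Finset (Fin n) → ℝ} (hf : Submodular f)
    {x y z : Fin n → ℝ} {β : ℝ} (hx : 0 ≤ x) (hxy : x ≤ y) (hy : y ≤ 1) (h0 : 0 ≤ β) (h1 : β ≤ 1)
    (hz : ∀ i, z i = β * x i + (1 - β) * y i) :
    β * multilinearExt f x + (1 - β) * multilinearExt f y ≤ multilinearExt f z := by
  have hxz : x ≤ z := fun i => by rw [hz]; have := hxy i; nlinarith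
  have hzy : z ≤ y := fun i => by rw [hz]; have := hxy i; nlinarith
  have hA := le_multilinearExt_sub hf hx hxz (hzy.trans hy)
  have hB := multilinearExt_add_sub_le hf (hx.trans hxz) hzy hy
  -- The gradient at the intermediate point z bounds the increments on both sides of it.
  set G := ∑ i, (y i - x i) * partialDeriv f i z with hG
  have eA : ∑ i, (z i - x i) * partialDeriv f i z = (1 - β) * G := by
    rw [hG, Finset.mul_sum]
    exact Finset.sum_congr rfl fun i _ => by rw [hz]; ring
  have eB : ∑ i, (y i - z i) * partialDeriv f i z = β * G := by
    rw [hG, Finset.mul_sum]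
    exact Finset.sum_congr rfl fun i _ => by rw [hz]; ring
  rw [eA] at hA
  rw [eB] at hB
  nlinarith

/-- Adding to `x` a vector with entries of size at most `1 - β` keeps a `β` fraction of the
value. -/
theorem multilinearExt_ge_of_add {f : Finset (Fin n) → ℝ} (hf0 : Nonneg f) (hf : Submodular f)
    {x z : Fin n → ℝ} {β : ℝ} (hx : 0 ≤ x) (hxz : x ≤ z) (h0 : 0 ≤ β) (h1 : β ≤ 1)
    (hz : ∀ i, z i - x i ≤ (1 - β) * (1 - x i)) :
    β * multilinearExt f x ≤ multilinearExt f z := by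
  rcases eq_or_lt_of_le h1 with rfl | h1'
  · have : z = x := le_antisymm (fun i => by have := hz i; linarith) hxz
    simp [this]
  have hpos : 0 < 1 - β := by linarith
  -- Extend the segment from x through z until z is the combination β x + (1 - β) y; the hypothesis
  -- on z keeps y in the cube, where F(y) ≥ 0.
  set y : Fin n → ℝ := fun i => x i + (z i - x i) / (1 - β) with hy
  have hxy : x ≤ y := fun i => by
    have : 0 ≤ (z i - x i) / (1 - β) := div_nonneg (sub_nonneg.2 (hxz i)) hpos.le
    simp only [hy]; linarith
  have hy1 : y ≤ 1 := fun i => by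
    have : (z i - x i) / (1 - β) ≤ 1 - x i := by
      rw [div_le_iff₀ hpos]; linarith [hz i]
    simp only [hy, Pi.one_apply]; linarith
  have h := multilinearExt_concave hf hx hxy hy1 h0 h1 (z := z) fun i => by
    simp only [hy]; field_simp; ring
  have := multilinearExt_nonneg hf0 (x := y) ⟨hx.trans hxy, hy1⟩
  nlinarith

theorem differentiable_multilinearExt (f : Finset (Fin n) → ℝ) :
    Differentiable ℝ (multilinearExt f) := by
  unfold multilinearExt
  fun_prop

theorem fderiv_multilinearExt (f : Finset (Fin n) → ℝ) (x v : Fin n → ℝ) :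
    fderiv ℝ (multilinearExt f) x v = ∑ i, v i * partialDeriv f i x := by
  have hv : v = ∑ i, v i • (Pi.single i 1 : Fin n → ℝ) := by
    ext j; simp [Finset.sum_apply, Pi.single_apply]
  conv_lhs => rw [hv]
  rw [map_sum]
  refine Finset.sum_congr rfl fun i _ => ?_
  rw [map_smul, smul_eq_mul]
  congr 1
  have h1 : HasDerivAt (fun r : ℝ => Function.update x i r) (Pi.single i 1) (x i) :=
    hasDerivAt_update x i (x i)
  have h2 : HasFDerivAt (multilinearExt f) (fderiv ℝ (multilinearExt f) x)
      (Function.update x i (x i)) := by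
    rw [Function.update_eq_self]
    exact (differentiable_multilinearExt f x).hasFDerivAt
  have h3 := h2.comp_hasDerivAt (x i) h1
  have h4 : HasDerivAt (fun r : ℝ => multilinearExt f x + (r - x i) * partialDeriv f i x)
      (partialDeriv f i x) (x i) := by
    simpa using (((hasDerivAt_id (x i)).sub_const (x i)).mul_const (partialDeriv f i x)).const_add
      (multilinearExt f x)
  have h5 : (multilinearExt f ∘ fun r : ℝ => Function.update x i r) =
      fun r : ℝ => multilinearExt f x + (r - x i) * partialDeriv f i x := by
    ext r
    have := multilinearExt_update_sub f x i r
    simp only [Function.comp]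
    linarith
  rw [h5] at h3
  exact h3.unique h4

end Multilinear
end MultilinearRelaxation
end

noncomputable section

namespace MultilinearRelaxation

/-! ### Local search -/

section LocalSearch

variable {n : ℕ}

/-- Split y - x into the rise to x ⊔ y and the fall to x ⊓ y. Each is monotone, so the gradient at x
bounds F(x ⊔ y) - F(x) and F(x ⊓ y) - F(x) from above. -/
theorem sup_add_inf_le_of_fderiv_le {f : Finset (Fin n) → ℝ} (hf : Submodular f)
    {x y : Fin n → ℝ} {ε : ℝ} (hx : x ∈ Set.Icc (0 : Fin n → ℝ) 1)
    (hy : y ∈ Set.Icc (0 : Fin n → ℝ) 1) (h : fderiv ℝ (multilinearExt f) x (y - x) ≤ ε) :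
    multilinearExt f (x ⊔ y) + multilinearExt f (x ⊓ y) ≤ 2 * multilinearExt f x + ε := by
  have h1 := multilinearExt_add_sub_le hf hx.1 (le_sup_left : x ≤ x ⊔ y) (sup_le hx.2 hy.2)
  have h2 := le_multilinearExt_sub hf (le_inf hx.1 hy.1) (inf_le_left : x ⊓ y ≤ x) hx.2
  have h3 : ∑ i, ((x ⊔ y) i - x i) * partialDeriv f i x
      - ∑ i, (x i - (x ⊓ y) i) * partialDeriv f i x = fderiv ℝ (multilinearExt f) x (y - x) := by
    rw [fderiv_multilinearExt, ← Finset.sum_sub_distrib]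
    refine Finset.sum_congr rfl fun i _ => ?_
    have := max_add_min (x i) (y i)
    simp only [Pi.sup_apply, Pi.inf_apply, Pi.sub_apply]
    rw [← sub_mul]
    congr 1
    linarith
  linarith

theorem IsPolytope.convex {P : Set (Fin n → ℝ)} (hP : IsPolytope P) : Convex ℝ P := by
  obtain ⟨V, rfl⟩ := hP
  exact convex_convexHull ℝ _

theorem IsPolytope.isCompact {P : Set (Fin n → ℝ)} (hP : IsPolytope P) : IsCompact P := by
  obtain ⟨V, rfl⟩ := hP
  exact V.finite_toSet.isCompact_convexHull ℝ

/-- Let w' = w ⊓ (1 - x). Adding the local inequalities for (x, w) and (z, w'), and using F(x ⊔ w) +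
F(z ⊔ w') ≥ F(w') and F(w') + F(x ⊓ w) ≥ F(w), gives 2 F(x) + 2 F(z) + 2 ε ≥ F(w). -/
theorem max_localOpt_ge {f : Finset (Fin n) → ℝ} {P : Set (Fin n → ℝ)} (hf0 : Nonneg f)
    (hf : Submodular f) (hP : DownMonotone P) {ε : ℝ} {x z : Fin n → ℝ}
    (hx : IsLocalOpt f P ε x) (hz : IsLocalOpt f {y ∈ P | y ≤ 1 - x} ε z) {w : Fin n → ℝ}
    (hw : w ∈ P) :
    multilinearExt f w / 4 - ε / 2 ≤ max (multilinearExt f x) (multilinearExt f z) := by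
  have hxc := hP.1 hx.1
  have hwc := hP.1 hw
  have hzc := hP.1 hz.1.1
  have hzx := hz.1.2
  set w' := w ⊓ (1 - x) with hw'
  have hw'c : w' ∈ Set.Icc (0 : Fin n → ℝ) 1 :=
    ⟨le_inf hwc.1 (sub_nonneg.2 hxc.2), inf_le_left.trans hwc.2⟩
  have hw'P : w' ∈ P := hP.2 w hw w' hw'c inf_le_left
  have hx1 := sup_add_inf_le_of_fderiv_le hf hxc hwc (hx.2 w hw)
  have hz1 := sup_add_inf_le_of_fderiv_le hf hzc hw'c (hz.2 w' ⟨hw'P, inf_le_right⟩)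
  -- Where z exceeds w', the constraint z ≤ 1 - x forces w' = w, and the coordinate equals max (x -
  -- w) 0 + z ≤ 1; elsewhere it is max x w.
  have hd : (x ⊔ w) + (z ⊔ w') - w' ≤ 1 := fun i => by
    have h1 := hzx i
    have h2 := hxc.2 i
    have h3 := hwc.2 i
    have h4 := hzc.2 i
    have h5 := hwc.1 i
    simp only [hw', Pi.sub_apply, Pi.add_apply, Pi.sup_apply, Pi.inf_apply, Pi.one_apply,
      Pi.zero_apply] at *
    rcases max_cases (x i) (w i) with h | h <;> rcases min_cases (w i) (1 - x i) with h' | h' <;>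
      rcases max_cases (z i) (min (w i) (1 - x i)) with h'' | h'' <;> linarith
  have k1 := multilinearExt_diminishing hf (c := w') (a := x ⊔ w) (b := z ⊔ w')
    (d := (x ⊔ w) + (z ⊔ w') - w') hw'c.1 (inf_le_left.trans le_sup_right) le_sup_right hd
    (by abel)
  -- Here w - w' = max 0 (w + x - 1), which is at most both x and w.
  have hc : 0 ≤ w' + (x ⊓ w) - w := fun i => by
    have h2 := hxc.1 i
    have h3 := hwc.2 i
    have h4 := hwc.1 i
    have h5 := hxc.2 i
    simp only [hw', Pi.sub_apply, Pi.add_apply, Pi.inf_apply, Pi.one_apply, Pi.zero_apply] at *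
    rcases min_cases (x i) (w i) with h | h <;> rcases min_cases (w i) (1 - x i) with h' | h' <;>
      linarith
  have k2 := multilinearExt_diminishing hf (c := w' + (x ⊓ w) - w) (a := w') (b := x ⊓ w) (d := w)
    hc (fun i => by have : (x ⊓ w) i ≤ w i := (inf_le_right : x ⊓ w ≤ w) i
                    simp only [Pi.sub_apply, Pi.add_apply]; linarith)
    (fun i => by have : w' i ≤ w i := (inf_le_left : w' ≤ w) i
                 simp only [Pi.sub_apply, Pi.add_apply]; linarith) hwc.2 (by abel)
  have n1 := multilinearExt_nonneg hf0 (x := (x ⊔ w) + (z ⊔ w') - w')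
    ⟨fun i => by
      have h1 : w' i ≤ (z ⊔ w') i := (le_sup_right : w' ≤ z ⊔ w') i
      have h2 : x i ≤ (x ⊔ w) i := (le_sup_left : x ≤ x ⊔ w) i
      have h3 := hxc.1 i
      simp only [Pi.sub_apply, Pi.add_apply, Pi.zero_apply] at *
      linarith, hd⟩
  have n2 := multilinearExt_nonneg hf0 (x := w' + (x ⊓ w) - w)
    ⟨hc, fun i => by
      have h1 : (x ⊓ w) i ≤ w i := (inf_le_right : x ⊓ w ≤ w) i
      have h3 := hw'c.2 i
      simp only [Pi.sub_apply, Pi.add_apply, Pi.one_apply] at *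
      linarith⟩
  have n3 := multilinearExt_nonneg hf0 (x := z ⊓ w') ⟨le_inf hzc.1 hw'c.1, inf_le_left.trans hzc.2⟩
  have m1 := le_max_left (multilinearExt f x) (multilinearExt f z)
  have m2 := le_max_right (multilinearExt f x) (multilinearExt f z)
  linarith

/-- The target is q = w(1 - (1 - t)x/t), and w splits as r + u with r = w(1 - x/t), u = wx/t.
Concavity gives F(x ⊔ q) ≥ (1 - t)F(q) ≥ (1 - t)² F(r) + (1 - t)t F(w) and F(x ⊓ q) ≥ t F(u).
Because (1 - t)² = t, the terms in r and u combine to t(F(r) + F(u)) ≥ t F(w), for a total of t(2 -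
t) F(w) = (1 - t) F(w). -/
theorem restricted_localOpt_ge {f : Finset (Fin n) → ℝ} {P : Set (Fin n → ℝ)} (hf0 : Nonneg f)
    (hf : Submodular f) (hPc : Convex ℝ P) (hP : DownMonotone P) {t ε η : ℝ} {x : Fin n → ℝ}
    (ht : t * (2 - t) = 1 - t) (ht0 : 0 < t) (ht1 : t < 1) (hη0 : 0 < η) (hη : η ≤ t)
    (hx : IsLocalOpt f {y ∈ P | ∀ i, y i ≤ t} ε x) {w : Fin n → ℝ} (hw : w ∈ P)
    (hwi : IsIntegral w) :
    (1 - t) * multilinearExt f w - ε / η ≤ 2 * multilinearExt f x := by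
  have hxc := hP.1 hx.1.1
  have hwc := hP.1 hw
  have hxt := hx.1.2
  have hx0 : ∀ i, 0 ≤ x i := hxc.1
  have hw0 : ∀ i, 0 ≤ w i := hwc.1
  have hw1 : ∀ i, w i ≤ 1 := hwc.2
  have hxt1 : ∀ i, x i / t ≤ 1 := fun i => (div_le_one ht0).2 (hxt i)
  have hxt0 : ∀ i, 0 ≤ x i / t := fun i => div_nonneg (hx0 i) ht0.le
  have hxe : ∀ i, x i = t * (x i / t) := fun i => by field_simp
  -- the target direction
  set r : Fin n → ℝ := fun i => w i * (1 - x i / t) with hr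
  set q : Fin n → ℝ := fun i => w i * (1 - (1 - t) * (x i / t)) with hq
  have hr0 : 0 ≤ r := fun i => mul_nonneg (hw0 i) (by linarith [hxt1 i])
  have hqr : ∀ i, q i = (1 - t) * r i + (1 - (1 - t)) * w i := fun i => by
    simp only [hq, hr]; ring
  have hrw : r ≤ w := fun i => by
    have := mul_nonneg (hw0 i) (hxt0 i)
    simp only [hr]; nlinarith
  have hqw : q ≤ w := fun i => by rw [hqr]; have := hrw i; nlinarith
  have hq0 : 0 ≤ q := fun i => by
    rw [hqr]
    have h1 := hr0 i
    have h2 := hw0 i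
    simp only [Pi.zero_apply] at *
    nlinarith
  have hqc : q ∈ Set.Icc (0 : Fin n → ℝ) 1 := ⟨hq0, hqw.trans hwc.2⟩
  have hqP : q ∈ P := hP.2 w hw q hqc hqw
  have hη1 : η ≤ 1 := by linarith
  have hyP : x + η • (q - x) ∈ P := by
    have := hPc hx.1.1 hqP (by linarith : (0 : ℝ) ≤ 1 - η) hη0.le (by ring)
    convert this using 1
    ext i; simp; ring
  -- The shape of q gives q_i - x_i ≤ 1 - x_i/t, so a step of length η ≤ t in this direction
  -- respects the bound t. Dividing the local inequality by η then produces ε/η.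
  have hyt : ∀ i, (x + η • (q - x)) i ≤ t := fun i => by
    have h1 : q i ≤ 1 - (1 - t) * (x i / t) := by
      have h2 : 0 ≤ 1 - (1 - t) * (x i / t) := by
        have := hxt1 i; have := hxt0 i; nlinarith
      simp only [hq]; nlinarith [hw1 i]
    have h2 : (x + η • (q - x)) i = x i + η * (q i - x i) := by simp
    have h3 : q i - x i ≤ 1 - x i / t := by
      have := hxe i
      nlinarith
    have h4 : η * (q i - x i) ≤ t * (1 - x i / t) := by
      have := hxt1 i
      nlinarith
    have := hxe i
    rw [h2]; nlinarith
  have hloc := hx.2 _ ⟨hyP, hyt⟩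
  rw [add_sub_cancel_left, map_smul, smul_eq_mul] at hloc
  have hloc' : fderiv ℝ (multilinearExt f) x (q - x) ≤ ε / η := by
    rw [le_div_iff₀ hη0]; linarith
  have h1 := sup_add_inf_le_of_fderiv_le hf hxc hqc hloc'
  -- lower bounds for the two values
  have h2 : (1 - t) * multilinearExt f q ≤ multilinearExt f (x ⊔ q) := by
    refine multilinearExt_ge_of_add hf0 hf hq0 le_sup_right (by linarith) (by linarith) fun i => ?_
    simp only [Pi.sup_apply]
    rcases hwi i with h | h
    · have : q i = 0 := by simp [hq, h]
      rw [this, max_eq_left (hx0 i)]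
      linarith [hxt i]
    · have h3 : x i ≤ q i := by
        simp only [hq, h]
        have := hxt1 i
        have := hxe i
        nlinarith
      have h4 := hqc.2 i
      simp only [Pi.one_apply] at h4
      rw [max_eq_right h3]
      nlinarith
  have h3 : (1 - t) * multilinearExt f r + (1 - (1 - t)) * multilinearExt f w
      ≤ multilinearExt f q :=
    multilinearExt_concave hf hr0 hrw hwc.2 (by linarith) (by linarith) hqr
  set u : Fin n → ℝ := fun i => w i * (x i / t) with hu
  have hu0 : 0 ≤ u := fun i => mul_nonneg (hw0 i) (hxt0 i)
  have hu1 : u ≤ 1 := fun i => mul_le_one₀ (hw1 i) (hxt0 i) (hxt1 i)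
  -- As w is integral, x ⊓ q is exactly t u, a point between 0 and u.
  have h4 : t * multilinearExt f u ≤ multilinearExt f (x ⊓ q) := by
    have h := multilinearExt_concave hf (x := 0) (y := u) (z := x ⊓ q) (β := 1 - t) le_rfl hu0 hu1
      (by linarith) (by linarith) fun i => by
        simp only [Pi.inf_apply, Pi.zero_apply, hu, hq]
        rcases hwi i with h | h
        · simp [h, hx0 i]
        · rw [h, min_eq_left]
          · have := hxe i; linarith
          · have := hxt1 i
            have := hxe i
            nlinarith
    have := multilinearExt_nonneg hf0 (x := (0 : Fin n → ℝ)) ⟨le_rfl, zero_le_one⟩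
    nlinarith
  have h5 := multilinearExt_diminishing hf (c := 0) (d := w) (a := r) (b := u) le_rfl hr0 hu0 hwc.2
    (by ext i; simp only [Pi.add_apply, Pi.zero_apply, hr, hu]; ring)
  have h6 := multilinearExt_nonneg hf0 (x := (0 : Fin n → ℝ)) ⟨le_rfl, zero_le_one⟩
  have h7 := multilinearExt_nonneg hf0 hwc
  have h8 := mul_le_mul_of_nonneg_left h3 (by linarith : 0 ≤ 1 - t)
  have h9 := mul_le_mul_of_nonneg_left h5 ht0.le
  have h10 : (1 - t) * (1 - t) = t := by linarith
  have h11 := mul_nonneg ht0.le h6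
  have h12 : (1 - t) * ((1 - t) * multilinearExt f r + (1 - (1 - t)) * multilinearExt f w)
      = t * multilinearExt f r + (1 - t) * t * multilinearExt f w := by
    rw [mul_add, ← mul_assoc, h10]; ring
  have h13 : (1 - t) * t * multilinearExt f w + t * multilinearExt f w
      = (1 - t) * multilinearExt f w := by
    linear_combination multilinearExt f w * ht
  linarith

end LocalSearch
end MultilinearRelaxation
end

noncomputable section

namespace MultilinearRelaxation

/-! ### Expectations -/

section Expectation

variable {α β : Type*}

/-- Expectation of a nonnegative function. -/
def expect (d : PMF α) (φ : α → ℝ≥0∞) : ℝ≥0∞ := ∑' a, d a * φ a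

theorem expect_pure (a : α) (φ : α → ℝ≥0∞) : expect (PMF.pure a) φ = φ a := by
  unfold expect
  rw [tsum_eq_single a]
  · simp
  · intro b hb
    simp [PMF.pure_apply, hb]

theorem expect_bind (d : PMF α) (k : α → PMF β) (φ : β → ℝ≥0∞) :
    expect (d.bind k) φ = expect d fun a => expect (k a) φ := by
  unfold expect
  simp only [PMF.bind_apply, ← ENNReal.tsum_mul_right, ← ENNReal.tsum_mul_left]
  rw [ENNReal.tsum_comm]
  simp only [mul_assoc]

theorem expect_mono_of_support {d : PMF α} {φ ψ : α → ℝ≥0∞} (h : ∀ a ∈ d.support, φ a ≤ ψ a) :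
    expect d φ ≤ expect d ψ := by
  refine ENNReal.tsum_le_tsum fun a => ?_
  by_cases ha : a ∈ d.support
  · exact mul_le_mul_right (h a ha) _
  · rw [(PMF.apply_eq_zero_iff d a).2 ha]
    simp

theorem expect_const (d : PMF α) (c : ℝ≥0∞) : expect d (fun _ => c) = c := by
  unfold expect
  rw [ENNReal.tsum_mul_right, d.tsum_coe, one_mul]

theorem expect_add (d : PMF α) (φ ψ : α → ℝ≥0∞) :
    expect d (fun a => φ a + ψ a) = expect d φ + expect d ψ := by
  unfold expect
  simp only [mul_add]
  exact ENNReal.tsum_add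

theorem expect_le_of_support {d : PMF α} {φ : α → ℝ≥0∞} {c : ℝ≥0∞}
    (h : ∀ a ∈ d.support, φ a ≤ c) : expect d φ ≤ c :=
  (expect_mono_of_support h).trans (expect_const d c).le

theorem expect_coin {p : ℝ} (h0 : 0 ≤ p) (h1 : p ≤ 1) (φ : Bool → ℝ≥0∞) :
    expect (coin p) φ = ENNReal.ofReal p * φ true + ENNReal.ofReal (1 - p) * φ false := by
  unfold expect
  have hp : ENNReal.ofReal p ≤ 1 := by simpa using ENNReal.ofReal_le_ofReal h1
  rw [tsum_bool]
  simp only [coin, PMF.ofFintype_apply, min_eq_right hp, if_true, Bool.false_eq_true, if_false]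
  rw [add_comm, ENNReal.ofReal_sub _ h0, ENNReal.ofReal_one]

open Classical in
/-- The probability that `Q` fails. -/
def failProb (d : PMF α) (Q : α → Prop) : ℝ≥0∞ := expect d fun a => if Q a then 0 else 1

theorem failProb_eq_zero {d : PMF α} {Q : α → Prop} (h : ∀ a ∈ d.support, Q a) :
    failProb d Q = 0 :=
  le_antisymm (expect_le_of_support fun a ha => by simp [h a ha]) (zero_le)

theorem failProb_mono {d : PMF α} {Q R : α → Prop} (h : ∀ a ∈ d.support, Q a → R a) :
    failProb d R ≤ failProb d Q := by
  refine expect_mono_of_support fun a ha => ?_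
  by_cases hQ : Q a
  · simp [hQ, h a ha hQ]
  · rw [if_neg hQ]
    split_ifs <;> simp

theorem failProb_le_expect {d : PMF α} {Q : α → Prop} {φ : α → ℝ≥0∞}
    (h : ∀ a ∈ d.support, ¬ Q a → 1 ≤ φ a) : failProb d Q ≤ expect d φ := by
  refine expect_mono_of_support fun a ha => ?_
  by_cases hQ : Q a
  · simp [hQ]
  · simpa [hQ] using h a ha hQ

/-- Union bound for two stages: either the first stage misses R, or the second fails from a state
where R holds. -/
theorem failProb_bind {d : PMF α} {k : α → PMF β} {Q : β → Prop} {R : α → Prop} {ε δ : ℝ≥0∞}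
    (hR : failProb d R ≤ ε) (hQ : ∀ a ∈ d.support, R a → failProb (k a) Q ≤ δ) :
    failProb (d.bind k) Q ≤ ε + δ := by
  classical
  rw [failProb, expect_bind]
  calc expect d (fun a => failProb (k a) Q)
      ≤ expect d (fun a => (if R a then 0 else 1) + δ) := by
        refine expect_mono_of_support fun a ha => ?_
        by_cases h : R a
        · simpa [h] using hQ a ha h
        · simp only [h, if_false]
          refine le_trans ?_ le_self_add
          exact expect_le_of_support fun b _ => by split_ifs <;> simp
    _ = failProb d R + δ := by rw [expect_add, expect_const]; rfl
    _ ≤ ε + δ := by gcongr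

theorem toOuterMeasure_ge_of_failProb_le {d : PMF α} {Q : α → Prop} {ε : ℝ≥0∞}
    (h : failProb d Q ≤ ε) : 1 - ε ≤ d.toOuterMeasure {a | Q a} := by
  classical
  have h1 : d.toOuterMeasure {a | Q a} + failProb d Q = 1 := by
    rw [PMF.toOuterMeasure_apply, failProb, expect, ← ENNReal.tsum_add, ← d.tsum_coe]
    refine tsum_congr fun a => ?_
    by_cases hQ : Q a <;> simp [Set.indicator, hQ]
  rw [tsub_le_iff_right, ← h1]
  gcongr

end Expectation

/-! ### Reasoning about programs -/

section Logic

variable {n : ℕ} {f : Finset (Fin n) → ℝ} {opt : (Fin n → ℝ) → Fin n → ℝ}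

@[simp] theorem State.tick_nat (s : State) (k : ℕ) : (s.tick k).nat = s.nat := rfl
@[simp] theorem State.tick_real (s : State) (k : ℕ) : (s.tick k).real = s.real := rfl
@[simp] theorem State.tick_steps (s : State) (k : ℕ) : (s.tick k).steps = s.steps + k := rfl
@[simp] theorem State.writeNat_nat (s : State) (v k : ℕ) :
    (s.writeNat v k).nat = Function.update s.nat v k := rfl
@[simp] theorem State.writeNat_real (s : State) (v k : ℕ) : (s.writeNat v k).real = s.real := rfl
@[simp] theorem State.writeNat_steps (s : State) (v k : ℕ) :
    (s.writeNat v k).steps = s.steps := rfl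
@[simp] theorem State.writeReal_nat (s : State) (a i : ℕ) (r : ℝ) :
    (s.writeReal a i r).nat = s.nat := rfl
@[simp] theorem State.writeReal_real (s : State) (a i : ℕ) (r : ℝ) :
    (s.writeReal a i r).real = Function.update s.real a (Function.update (s.real a) i r) := rfl
@[simp] theorem State.writeReal_steps (s : State) (a i : ℕ) (r : ℝ) :
    (s.writeReal a i r).steps = s.steps := rfl
@[simp] theorem State.writeVec_nat (s : State) (a : ℕ) (x : Fin n → ℝ) :
    (s.writeVec a x).nat = s.nat := rfl
@[simp] theorem State.writeVec_real (s : State) (a : ℕ) (x : Fin n → ℝ) :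
    (s.writeVec a x).real =
      Function.update s.real a fun j => if h : j < n then x ⟨j, h⟩ else s.real a j := rfl
@[simp] theorem State.writeVec_steps (s : State) (a : ℕ) (x : Fin n → ℝ) :
    (s.writeVec a x).steps = s.steps := rfl

/-- Every possible final state of `p` started in `s` satisfies `Q`. -/
def Sure (f : Finset (Fin n) → ℝ) (opt : (Fin n → ℝ) → Fin n → ℝ) (p : Prog) (s : State)
    (Q : State → Prop) : Prop :=
  ∀ t ∈ (p.exec f opt s).support, Q t

theorem Sure.mono {p : Prog} {s : State} {Q R : State → Prop} (h : Sure f opt p s Q)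
    (hQR : ∀ t, Q t → R t) : Sure f opt p s R :=
  fun t ht => hQR t (h t ht)

theorem Sure.and {p : Prog} {s : State} {Q R : State → Prop} (h : Sure f opt p s Q)
    (h' : Sure f opt p s R) : Sure f opt p s fun t => Q t ∧ R t :=
  fun t ht => ⟨h t ht, h' t ht⟩

theorem sure_skip {s : State} {Q : State → Prop} :
    Sure f opt .skip s Q ↔ Q (s.tick 1) := by
  simp [Sure, Prog.exec]

theorem sure_setNat {v : ℕ} {e : NatExp} {s : State} {Q : State → Prop} :
    Sure f opt (.setNat v e) s Q ↔ Q ((s.writeNat v (e.eval s)).tick (e.cost + 1)) := by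
  simp [Sure, Prog.exec]

theorem sure_setReal {a : ℕ} {i : NatExp} {e : RealExp} {s : State} {Q : State → Prop} :
    Sure f opt (.setReal a i e) s Q ↔
      Q ((s.writeReal a (i.eval s) (e.eval s)).tick (i.cost + e.cost + 1)) := by
  simp [Sure, Prog.exec]

theorem sure_flip {v : ℕ} {e : RealExp} {s : State} {Q : State → Prop}
    (h : ∀ b : Bool, Q ((s.writeNat v (if b then 1 else 0)).tick (e.cost + 1))) :
    Sure f opt (.flip v e) s Q := by
  intro t ht
  simp only [Prog.exec, PMF.mem_support_bind_iff, PMF.mem_support_pure_iff] at ht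
  obtain ⟨b, _, rfl⟩ := ht
  exact h b

theorem sure_value {a b : ℕ} {s : State} {Q : State → Prop} :
    Sure f opt (.value a b) s Q ↔
      Q ((s.writeReal b 0 (f (Finset.univ.filter fun i : Fin n => s.real a i ≠ 0))).tick
        (n + 1)) := by
  simp only [Sure, Prog.exec, PMF.mem_support_pure_iff, forall_eq, State.readVec]
  refine iff_of_eq (congrArg Q ?_)
  congr!

theorem sure_linopt {a b : ℕ} {s : State} {Q : State → Prop} :
    Sure f opt (.linopt a b) s Q ↔
      Q ((s.writeVec b (opt (s.readVec n a))).tick (n + 1)) := by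
  simp [Sure, Prog.exec]

theorem sure_seq {p q : Prog} {s : State} {Q : State → Prop} :
    Sure f opt (.seq p q) s Q ↔ Sure f opt p s fun t => Sure f opt q t Q := by
  simp only [Sure, Prog.exec, PMF.mem_support_bind_iff]
  exact ⟨fun h t ht u hu => h u ⟨t, ht, hu⟩, fun h u ⟨t, ht, hu⟩ => h t ht u hu⟩

theorem sure_ite {c : Cond} {p q : Prog} {s : State} {Q : State → Prop} :
    Sure f opt (.ite c p q) s Q ↔ (c.holds s → Sure f opt p (s.tick c.cost) Q) ∧
      (¬ c.holds s → Sure f opt q (s.tick c.cost) Q) := by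
  by_cases h : c.holds s <;> simp [Sure, Prog.exec, h]

/-- The distribution after `k` rounds of a loop. -/
def iterDist (f : Finset (Fin n) → ℝ) (opt : (Fin n → ℝ) → Fin n → ℝ) (p : Prog) (s : State) :
    ℕ → PMF State
  | 0 => PMF.pure s
  | k + 1 => (iterDist f opt p s k).bind fun t => p.exec f opt (t.tick 1)

theorem exec_loop (e : NatExp) (p : Prog) (s : State) :
    (Prog.loop e p).exec f opt s = iterDist f opt p (s.tick (e.cost + 1)) (e.eval s) := by
  simp only [Prog.exec]
  induction e.eval s with
  | zero => rfl
  | succ k ih => simp only [iterDist, ← ih]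

theorem iterDist_support {p : Prog} {s : State} {K : ℕ} {Inv : ℕ → State → Prop}
    (h0 : Inv 0 s)
    (hstep : ∀ k < K, ∀ t, Inv k t → Sure f opt p (t.tick 1) (Inv (k + 1))) :
    ∀ k ≤ K, ∀ t ∈ (iterDist f opt p s k).support, Inv k t := by
  intro k
  induction k with
  | zero => intro _ t ht; simp only [iterDist, PMF.mem_support_pure_iff] at ht; rwa [ht]
  | succ k ih =>
    intro hk t ht
    simp only [iterDist, PMF.mem_support_bind_iff] at ht
    obtain ⟨u, hu, ht⟩ := ht
    exact hstep k hk u (ih (by omega) u hu) t ht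

theorem sure_loop {e : NatExp} {p : Prog} {s : State} {Inv : ℕ → State → Prop}
    (h0 : Inv 0 (s.tick (e.cost + 1)))
    (hstep : ∀ k < e.eval s, ∀ t, Inv k t → Sure f opt p (t.tick 1) (Inv (k + 1))) :
    Sure f opt (.loop e p) s (Inv (e.eval s)) := by
  intro t ht
  rw [exec_loop] at ht
  exact iterDist_support h0 hstep _ le_rfl t ht

/-! ### Frame conditions: what a program leaves unchanged -/

/-- `p` has no instruction that writes to register `v`. -/
def Prog.keepsNat (v : ℕ) : Prog → Prop
  | .setNat w _ => w ≠ v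
  | .flip w _ => w ≠ v
  | .seq p q => p.keepsNat v ∧ q.keepsNat v
  | .ite _ p q => p.keepsNat v ∧ q.keepsNat v
  | .loop _ p => p.keepsNat v
  | _ => True

/-- `p` has no instruction that writes to array `a`. -/
def Prog.keepsReal (a : ℕ) : Prog → Prop
  | .setReal b _ _ => b ≠ a
  | .value _ b => b ≠ a
  | .linopt _ b => b ≠ a
  | .seq p q => p.keepsReal a ∧ q.keepsReal a
  | .ite _ p q => p.keepsReal a ∧ q.keepsReal a
  | .loop _ p => p.keepsReal a
  | _ => True

theorem sure_keepsNat {v : ℕ} {p : Prog} (hp : p.keepsNat v) (s : State) :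
    Sure f opt p s fun t => t.nat v = s.nat v := by
  induction p generalizing s with
  | skip => simp [sure_skip]
  | setNat w e =>
    rw [sure_setNat]
    simp [Function.update_of_ne (Ne.symm hp)]
  | setReal a i e => simp [sure_setReal]
  | flip w e =>
    refine sure_flip fun b => ?_
    simp [Function.update_of_ne (Ne.symm hp)]
  | value a b => simp [sure_value]
  | linopt a b => simp [sure_linopt]
  | seq p q ihp ihq =>
    rw [sure_seq]
    exact (ihp hp.1 s).mono fun t ht => (ihq hp.2 t).mono fun u hu => hu.trans ht
  | ite c p q ihp ihq => exact sure_ite.2 ⟨fun _ => ihp hp.1 _, fun _ => ihq hp.2 _⟩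
  | loop e p ih =>
    exact sure_loop (Inv := fun _ t => t.nat v = s.nat v) rfl fun k _ t ht =>
      (ih hp _).mono fun u hu => hu.trans ht

theorem sure_keepsReal {a : ℕ} {p : Prog} (hp : p.keepsReal a) (s : State) :
    Sure f opt p s fun t => t.real a = s.real a := by
  induction p generalizing s with
  | skip => simp [sure_skip]
  | setNat w e => simp [sure_setNat]
  | setReal b i e =>
    rw [sure_setReal]
    simp [Function.update_of_ne (Ne.symm hp)]
  | flip w e => exact sure_flip fun b => by simp
  | value b c =>
    rw [sure_value]
    simp [Function.update_of_ne (Ne.symm hp)]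
  | linopt b c =>
    rw [sure_linopt]
    simp [Function.update_of_ne (Ne.symm hp)]
  | seq p q ihp ihq =>
    rw [sure_seq]
    exact (ihp hp.1 s).mono fun t ht => (ihq hp.2 t).mono fun u hu => hu.trans ht
  | ite c p q ihp ihq => exact sure_ite.2 ⟨fun _ => ihp hp.1 _, fun _ => ihq hp.2 _⟩
  | loop e p ih =>
    exact sure_loop (Inv := fun _ t => t.real a = s.real a) rfl fun k _ t ht =>
      (ih hp _).mono fun u hu => hu.trans ht

/-! ### Running time -/

/-- Polynomial bound for the value of an expression, given bounds for the registers. -/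
def NatExp.bound (q : ℕ → Polynomial ℕ) : NatExp → Polynomial ℕ
  | .const k => Polynomial.C k
  | .var v => q v
  | .add a b => a.bound q + b.bound q
  | .sub a _ => a.bound q

/-- All registers that occur in the expression satisfy `V`. -/
def NatExp.uses (V : ℕ → Prop) : NatExp → Prop
  | .const _ => True
  | .var v => V v
  | .add a b => a.uses V ∧ b.uses V
  | .sub a b => a.uses V ∧ b.uses V

/-- The registers in `V` are never written, and all loop bounds depend on them only. -/
def Prog.loopsOver (V : ℕ → Prop) : Prog → Prop
  | .setNat w _ => ¬ V w
  | .flip w _ => ¬ V w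
  | .seq p q => p.loopsOver V ∧ q.loopsOver V
  | .ite _ p q => p.loopsOver V ∧ q.loopsOver V
  | .loop e p => e.uses V ∧ p.loopsOver V
  | _ => True

/-- Polynomial bound for the running time, given bounds for the registers. -/
def Prog.timeBound (q : ℕ → Polynomial ℕ) : Prog → Polynomial ℕ
  | .skip => Polynomial.C 1
  | .setNat _ e => Polynomial.C (e.cost + 1)
  | .setReal _ i e => Polynomial.C (i.cost + e.cost + 1)
  | .flip _ e => Polynomial.C (e.cost + 1)
  | .value _ _ => Polynomial.X + 1
  | .linopt _ _ => Polynomial.X + 1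
  | .seq p r => p.timeBound q + r.timeBound q
  | .ite c p r => Polynomial.C c.cost + p.timeBound q + r.timeBound q
  | .loop e p => Polynomial.C (e.cost + 1) + e.bound q * (p.timeBound q + 1)

theorem NatExp.eval_le_bound {V : ℕ → Prop} {q : ℕ → Polynomial ℕ} {s : State} {m : ℕ}
    (hs : ∀ v, V v → s.nat v ≤ (q v).eval m) {e : NatExp} (he : e.uses V) :
    e.eval s ≤ (e.bound q).eval m := by
  induction e with
  | const k => simp [NatExp.eval, NatExp.bound]
  | var v => exact hs v he
  | add a b iha ihb =>
    simpa [NatExp.eval, NatExp.bound] using add_le_add (iha he.1) (ihb he.2)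
  | sub a b iha _ => exact (Nat.sub_le _ _).trans (iha he.1)

/-- Loop bounds read only registers in V, which never change, so bounds on their initial values
remain valid inside every nested loop. This makes the syntactic `timeBound` sound. -/
theorem sure_steps_le {V : ℕ → Prop} {q : ℕ → Polynomial ℕ} {p : Prog} (hp : p.loopsOver V)
    (s : State) (hs : ∀ v, V v → s.nat v ≤ (q v).eval n) :
    Sure f opt p s fun t =>
      t.steps ≤ s.steps + (p.timeBound q).eval n ∧ ∀ v, V v → t.nat v = s.nat v := by
  induction p generalizing s with
  | skip => simp [sure_skip, Prog.timeBound]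
  | setNat w e =>
    rw [sure_setNat]
    refine ⟨by simp [Prog.timeBound], fun v hv => ?_⟩
    have : v ≠ w := fun h => hp (h ▸ hv)
    simp [Function.update_of_ne this]
  | setReal a i e => simp [sure_setReal, Prog.timeBound]
  | flip w e =>
    refine sure_flip fun b => ⟨by simp [Prog.timeBound], fun v hv => ?_⟩
    have : v ≠ w := fun h => hp (h ▸ hv)
    simp [Function.update_of_ne this]
  | value a b => simp [sure_value, Prog.timeBound]
  | linopt a b => simp [sure_linopt, Prog.timeBound]
  | seq p r ihp ihr =>
    rw [sure_seq]
    refine (ihp hp.1 s hs).mono fun t ht => ?_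
    refine (ihr hp.2 t fun v hv => (ht.2 v hv).trans_le (hs v hv)).mono fun u hu =>
      ⟨?_, fun v hv => (hu.2 v hv).trans (ht.2 v hv)⟩
    have h1 := ht.1
    have h2 := hu.1
    simp only [Prog.timeBound, Polynomial.eval_add]
    omega
  | ite c p r ihp ihr =>
    rw [sure_ite]
    constructor <;> intro _
    · refine (ihp hp.1 (s.tick c.cost) hs).mono fun t ht => ⟨?_, ht.2⟩
      have h1 := ht.1
      simp only [Prog.timeBound, Polynomial.eval_add, Polynomial.eval_C, State.tick_steps] at *
      omega
    · refine (ihr hp.2 (s.tick c.cost) hs).mono fun t ht => ⟨?_, ht.2⟩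
      have h1 := ht.1
      simp only [Prog.timeBound, Polynomial.eval_add, Polynomial.eval_C, State.tick_steps] at *
      omega
  | loop e p ih =>
    refine (sure_loop (Inv := fun k t => t.steps ≤ s.steps + (e.cost + 1) +
      k * ((p.timeBound q).eval n + 1) ∧ ∀ v, V v → t.nat v = s.nat v) (by simp)
      fun k _ t ht => ?_).mono fun t ht => ⟨?_, ht.2⟩
    · refine (ih hp.2 (t.tick 1) fun v hv => (ht.2 v hv).trans_le (hs v hv)).mono fun u hu =>
        ⟨?_, fun v hv => (hu.2 v hv).trans (ht.2 v hv)⟩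
      have h1 := ht.1
      have h2 := hu.1
      simp only [State.tick_steps] at h2
      rw [add_mul]
      omega
    · have h1 := ht.1
      have h2 := NatExp.eval_le_bound hs hp.1
      have h3 := Nat.mul_le_mul_right ((p.timeBound q).eval n + 1) h2
      simp only [Prog.timeBound, Polynomial.eval_add, Polynomial.eval_mul, Polynomial.eval_C,
        Polynomial.eval_one]
      omega

/-! ### Counting loops -/

/-- Execute `p` with register `v` running through `0, …, e - 1`. -/
def Prog.forRange (v : ℕ) (e : NatExp) (p : Prog) : Prog :=
  .seq (.setNat v (.const 0)) (.loop e (.seq p (.setNat v (.add (.var v) (.const 1)))))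

/-- The registers that hold the sizes are preserved. -/
def Prog.keepsSizes (p : Prog) : Prop := p.keepsNat 0 ∧ p.keepsNat 1

/-- Two states with the same sizes. -/
def SameSizes (s t : State) : Prop := t.nat 0 = s.nat 0 ∧ t.nat 1 = s.nat 1

theorem Prog.keepsSizes.sure {p : Prog} (hp : p.keepsSizes) (s : State) :
    Sure f opt p s (SameSizes s) :=
  (sure_keepsNat hp.1 s).and (sure_keepsNat hp.2 s)

theorem exec_forRange (v : ℕ) (e : NatExp) (p : Prog) (s : State) :
    (Prog.forRange v e p).exec f opt s =
      iterDist f opt (.seq p (.setNat v (.add (.var v) (.const 1))))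
        (((s.writeNat v 0).tick 2).tick (e.cost + 1)) (e.eval ((s.writeNat v 0).tick 2)) := by
  rw [Prog.forRange, ← exec_loop]
  simp only [Prog.exec, PMF.pure_bind, NatExp.eval, NatExp.cost]

section

variable {v : ℕ} {e : NatExp} {p : Prog} {s : State} {K : ℕ}

/-- Tracks the counter and the sizes once and for all, so that later invariants need to speak only
of the real arrays. -/
theorem forRange_support (hv : 1 < v) (hpv : p.keepsNat v) (hp : p.keepsSizes)
    {Inv : ℕ → (ℕ → ℕ → ℝ) → Prop} (h0 : Inv 0 s.real)
    (hstep : ∀ k < K, ∀ t, SameSizes s t → t.nat v = k → Inv k t.real →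
      Sure f opt p t fun u => Inv (k + 1) u.real) (c : ℕ) :
    ∀ k ≤ K, ∀ t ∈ (iterDist f opt (.seq p (.setNat v (.add (.var v) (.const 1))))
        (((s.writeNat v 0).tick 2).tick c) k).support,
      SameSizes s t ∧ t.nat v = k ∧ Inv k t.real := by
  refine iterDist_support (Inv := fun k t => SameSizes s t ∧ t.nat v = k ∧ Inv k t.real) ?_ ?_
  · have h1 : 0 ≠ v := by omega
    have h2 : 1 ≠ v := by omega
    exact ⟨⟨by simp [Function.update_of_ne h1], by simp [Function.update_of_ne h2]⟩, by simp, h0⟩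
  · rintro k hk t ⟨ht1, ht2, ht3⟩
    rw [sure_seq]
    refine (((hp.sure (t.tick 1)).and (sure_keepsNat hpv (t.tick 1))).and
      (hstep k hk (t.tick 1) ht1 ht2 ht3)).mono fun u hu => ?_
    obtain ⟨⟨hu1, hu2⟩, hu3⟩ := hu
    rw [sure_setNat]
    have h1 : 0 ≠ v := by omega
    have h2 : 1 ≠ v := by omega
    refine ⟨⟨?_, ?_⟩, ?_, ?_⟩
    · simpa [Function.update_of_ne h1] using hu1.1.trans ht1.1
    · simpa [Function.update_of_ne h2] using hu1.2.trans ht1.2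
    · simp only [State.tick_nat] at hu2
      simp [NatExp.eval, hu2, ht2]
    · simpa using hu3

theorem sure_forRange (hv : 1 < v) (hpv : p.keepsNat v) (hp : p.keepsSizes)
    (he : e.eval ((s.writeNat v 0).tick 2) = K)
    {Inv : ℕ → (ℕ → ℕ → ℝ) → Prop} (h0 : Inv 0 s.real)
    (hstep : ∀ k < K, ∀ t, SameSizes s t → t.nat v = k → Inv k t.real →
      Sure f opt p t fun u => Inv (k + 1) u.real) :
    Sure f opt (.forRange v e p) s fun t => Inv K t.real := by
  intro t ht
  rw [exec_forRange, he] at ht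
  exact (forRange_support hv hpv hp h0 hstep _ K le_rfl t ht).2.2

/-- The supermartingale principle: a potential that does not increase in expectation in any round
does not increase over the loop. `Inv` records what holds surely along the way. -/
theorem expect_forRange (hv : 1 < v) (hpv : p.keepsNat v) (hp : p.keepsSizes)
    (he : e.eval ((s.writeNat v 0).tick 2) = K)
    {Inv : ℕ → (ℕ → ℕ → ℝ) → Prop} (h0 : Inv 0 s.real) {Φ : ℕ → (ℕ → ℕ → ℝ) → ℝ≥0∞}
    (hstep : ∀ k < K, ∀ t, SameSizes s t → t.nat v = k → Inv k t.real →
      Sure f opt p t fun u => Inv (k + 1) u.real)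
    (hexp : ∀ k < K, ∀ t, SameSizes s t → t.nat v = k → Inv k t.real →
      expect (p.exec f opt t) (fun u => Φ (k + 1) u.real) ≤ Φ k t.real) :
    expect ((Prog.forRange v e p).exec f opt s) (fun t => Φ K t.real) ≤ Φ 0 s.real := by
  rw [exec_forRange, he]
  suffices h : ∀ k ≤ K, expect (iterDist f opt (.seq p (.setNat v (.add (.var v) (.const 1))))
      (((s.writeNat v 0).tick 2).tick (e.cost + 1)) k) (fun t => Φ k t.real) ≤ Φ 0 s.real from
    h K le_rfl
  intro k
  induction k with
  | zero => intro _; simp [iterDist, expect_pure]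
  | succ k ih =>
    intro hk
    refine le_trans ?_ (ih (by omega))
    rw [iterDist, expect_bind]
    refine expect_mono_of_support fun t ht => ?_
    obtain ⟨h1, h2, h3⟩ := forRange_support hv hpv hp h0 hstep _ k (by omega) t ht
    simp only [Prog.exec, expect_bind, expect_pure, State.tick_real, State.writeNat_real]
    exact hexp k hk (t.tick 1) h1 h2 h3

/-- Union bound over the rounds, for an invariant that each round preserves only with high
probability. -/
theorem failProb_forRange (hv : 1 < v) (hpv : p.keepsNat v) (hp : p.keepsSizes)
    (he : e.eval ((s.writeNat v 0).tick 2) = K)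
    {Inv : ℕ → (ℕ → ℕ → ℝ) → Prop} (h0 : Inv 0 s.real) {ε : ℝ≥0∞}
    (hstep : ∀ k < K, ∀ t, SameSizes s t → t.nat v = k → Inv k t.real →
      failProb (p.exec f opt t) (fun u => Inv (k + 1) u.real) ≤ ε) :
    failProb ((Prog.forRange v e p).exec f opt s) (fun t => Inv K t.real) ≤ K * ε := by
  rw [exec_forRange, he]
  suffices h : ∀ k ≤ K, failProb (iterDist f opt (.seq p (.setNat v (.add (.var v) (.const 1))))
      (((s.writeNat v 0).tick 2).tick (e.cost + 1)) k) (fun t => Inv k t.real) ≤ k * ε from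
    h K le_rfl
  intro k
  induction k with
  | zero =>
    intro _
    rw [failProb_eq_zero]
    · simp
    · intro t ht
      simp only [iterDist, PMF.mem_support_pure_iff] at ht
      rw [ht]
      exact h0
  | succ k ih =>
    intro hk
    rw [iterDist]
    push_cast
    rw [add_mul, one_mul]
    refine failProb_bind (ih (by omega)) fun t ht hInv => ?_
    -- The counter and the sizes are right in every run, so they come from the trivial invariant
    -- rather than from `Inv`.
    obtain ⟨h1, h2, -⟩ := forRange_support (Inv := fun _ _ => True) hv hpv hp trivial
      (fun _ _ _ _ _ _ _ _ => trivial) _ k (by omega : k ≤ K) t ht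
    simp only [failProb, Prog.exec, expect_bind, expect_pure, State.tick_real, State.writeNat_real]
    exact hstep k hk (t.tick 1) h1 h2 hInv

end

theorem failProb_seq {p q : Prog} {s : State} {Q R : State → Prop} {ε δ : ℝ≥0∞}
    (hR : failProb (p.exec f opt s) R ≤ ε)
    (hQ : ∀ t ∈ (p.exec f opt s).support, R t → failProb (q.exec f opt t) Q ≤ δ) :
    failProb ((Prog.seq p q).exec f opt s) Q ≤ ε + δ :=
  failProb_bind hR hQ

end Logic
end MultilinearRelaxation
end

noncomputable section

namespace MultilinearRelaxation

/-! ### The sampling procedure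

Array 0 holds the point `y`, array 3 the random set, array 4 the accumulators. -/

section Sampling

variable {n : ℕ} {f : Finset (Fin n) → ℝ} {opt : (Fin n → ℝ) → Fin n → ℝ}

/-- Round the point in array 0 to a random set in array 3. -/
def drawProg : Prog :=
  .forRange 2 (.var 0) (.seq (.flip 3 (.cell 0 (.var 2)))
    (.ite (.natLt (.const 0) (.var 3)) (.setReal 3 (.var 2) (.const 1))
      (.setReal 3 (.var 2) (.const 0))))

/-- Add `f(R ∪ {i})` to the `i`-th accumulator for all `i ≤ n`; the index `n` stands for no
element. -/
def accumulateProg : Prog :=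
  .forRange 2 (.add (.var 0) (.const 1))
    -- Array 13 saves the entry while i is added to the set. For i = n the write lies beyond the
    -- entries that the oracle reads, so the value is f(R) itself.
    (.seq (.setReal 13 (.const 0) (.cell 3 (.var 2)))
    (.seq (.setReal 3 (.var 2) (.const 1))
    (.seq (.value 3 2)
    (.seq (.setReal 3 (.var 2) (.cell 13 (.const 0)))
      (.setReal 4 (.var 2) (.add (.cell 4 (.var 2)) (.cell 2 (.const 0))))))))

/-- Clear the accumulators and process as many samples as register 1 says. -/
def sampleProg : Prog :=
  .seq (.forRange 2 (.add (.var 0) (.const 1)) (.setReal 4 (.var 2) (.const 0)))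
    (.forRange 5 (.var 1) (.seq drawProg accumulateProg))

/-- The set encoded by an array. -/
def suppSet (n : ℕ) (r : ℕ → ℝ) : Finset (Fin n) := Finset.univ.filter fun i => r i ≠ 0

/-- `f(S ∪ {i})`, or `f(S)` if `i` is not an element of the ground set. -/
def valueWith (f : Finset (Fin n) → ℝ) (i : ℕ) (S : Finset (Fin n)) : ℝ :=
  f (Finset.univ.filter fun j => j ∈ S ∨ j.val = i)

theorem valueWith_of_lt (f : Finset (Fin n) → ℝ) (i : Fin n) (S : Finset (Fin n)) :
    valueWith f i S = f (insert i S) := by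
  unfold valueWith
  congr 1
  ext j
  simp [Fin.ext_iff, or_comm]

theorem valueWith_self (f : Finset (Fin n) → ℝ) (S : Finset (Fin n)) :
    valueWith f n S = f S := by
  unfold valueWith
  congr 1
  ext j
  simp [j.isLt.ne]

theorem sure_drawProg_keeps {s : State} {a : ℕ} (ha : a ≠ 3) :
    Sure f opt drawProg s fun t => t.real a = s.real a :=
  sure_keepsReal (by simp [drawProg, Prog.forRange, Prog.keepsReal, ha.symm]) s

theorem drawProg_keepsSizes : drawProg.keepsSizes := by
  simp [drawProg, Prog.forRange, Prog.keepsNat, Prog.keepsSizes]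

/-- Rounding one coordinate at a time is a martingale for the extension of G, because that extension
is affine in each coordinate. -/
theorem expect_drawProg {s : State} (hn : s.nat 0 = n)
    (hy : s.readVec n 0 ∈ Set.Icc (0 : Fin n → ℝ) 1) (G : Finset (Fin n) → ℝ) (hG : Nonneg G) :
    expect (drawProg.exec f opt s) (fun t => ENNReal.ofReal (G (suppSet n (t.real 3)))) ≤
      ENNReal.ofReal (multilinearExt G (s.readVec n 0)) := by
  set y := s.readVec n 0 with hydef
  -- The hybrid point after k tosses: the first k coordinates are already rounded, the others still
  -- equal y.
  set pt : ℕ → (ℕ → ℕ → ℝ) → Fin n → ℝ := fun k r i =>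
    if i.val < k then (if r 3 i ≠ 0 then 1 else 0) else y i with hpt
  have h0 : ∀ r, pt 0 r = y := fun r => by ext i; simp [hpt]
  have hN : ∀ r, multilinearExt G (pt n r) = G (suppSet n (r 3)) := fun r => by
    rw [← multilinearExt_indicator G]
    congr 1
    ext i
    simp [hpt, suppSet, i.isLt]
  have hcube : ∀ k r, pt k r ∈ Set.Icc (0 : Fin n → ℝ) 1 := by
    intro k r
    constructor <;> intro i <;> simp only [hpt] <;> split_ifs
    · simp
    · simp
    · exact hy.1 i
    · simp
    · simp
    · exact hy.2 i
  have key := expect_forRange (f := f) (opt := opt) (v := 2) (e := .var 0)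
    (p := .seq (.flip 3 (.cell 0 (.var 2)))
      (.ite (.natLt (.const 0) (.var 3)) (.setReal 3 (.var 2) (.const 1))
        (.setReal 3 (.var 2) (.const 0)))) (s := s) (K := n) (by norm_num)
    (by simp [Prog.keepsNat]) (by simp [Prog.keepsNat, Prog.keepsSizes])
    (by simpa [NatExp.eval] using hn) (Inv := fun _ r => r 0 = s.real 0) rfl
    (Φ := fun k r => ENNReal.ofReal (multilinearExt G (pt k r)))
    (fun k _ t _ _ ht => (sure_keepsReal (by simp [Prog.keepsReal]) t).mono
      fun u hu => hu.trans ht) ?_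
  · simp only [h0, hN] at key
    exact key
  · intro k hk t _ htk htI
    set i : Fin n := ⟨k, hk⟩ with hi
    have hyi : t.real 0 k = y i := by rw [htI]; rfl
    have hp0 : 0 ≤ y i := hy.1 i
    have hp1 : y i ≤ 1 := hy.2 i
    have hT : ∀ c : ℝ, pt (k + 1) (Function.update t.real 3 (Function.update (t.real 3) k c)) =
        Function.update (pt k t.real) i (if c ≠ 0 then 1 else 0) := by
      intro c
      ext j
      by_cases hj : j = i
      · subst hj; simp [hpt, hi]
      · have hjk : j.val ≠ k := fun h => hj (Fin.ext h)
        have hlt : (j.val < k + 1) ↔ j.val < k := by omega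
        simp only [hpt, Function.update_self, Function.update_of_ne hjk, Function.update_of_ne hj,
          hlt]
    simp only [Prog.exec, expect_bind, RealExp.eval, NatExp.eval, htk, hyi]
    rw [expect_coin hp0 hp1]
    simp only [expect_pure, Cond.holds, NatExp.eval, State.tick_nat, State.writeNat_nat,
      Function.update_self, if_true, Bool.false_eq_true, if_false, zero_lt_one, lt_irrefl,
      State.tick_real, State.writeReal_real, State.writeNat_real,
      Function.update_of_ne (show (2 : ℕ) ≠ 3 by norm_num), htk, hT]
    have hpti : pt k t.real i = y i := by simp [hpt, hi]
    rw [multilinearExt_split G (pt k t.real) i, hpti, ← ENNReal.ofReal_mul hp0,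
      ← ENNReal.ofReal_mul (by linarith), ← ENNReal.ofReal_add]
    · apply le_of_eq
      congr 1
      simp
      ring
    · exact mul_nonneg hp0 (multilinearExt_nonneg hG (update_mem_cube (hcube _ _) i (by simp)))
    · exact mul_nonneg (by linarith)
        (multilinearExt_nonneg hG (update_mem_cube (hcube _ _) i (by simp)))

theorem sure_accumulateProg {s : State} (hn : s.nat 0 = n) :
    Sure f opt accumulateProg s fun t =>
      ∀ i ≤ n, t.real 4 i = s.real 4 i + valueWith f i (suppSet n (s.real 3)) := by
  refine (sure_forRange (K := n + 1) (by norm_num) (by simp [Prog.keepsNat])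
    (by simp [Prog.keepsNat, Prog.keepsSizes]) (by simpa [NatExp.eval] using hn)
    (Inv := fun k r => r 3 = s.real 3 ∧ ∀ i, r 4 i =
      s.real 4 i + if i < k then valueWith f i (suppSet n (s.real 3)) else 0)
    (by simp) ?_).mono fun t ht i hi => ?_
  · rintro k hk t - htk ⟨h3, h4⟩
    simp only [sure_seq, sure_setReal, sure_value]
    simp [RealExp.eval, NatExp.eval, htk]
    refine ⟨h3, fun i => ?_⟩
    by_cases hik : i = k
    · subst hik
      simp only [Function.update_self, h4, lt_irrefl, if_false, add_zero]
      rw [if_pos (by omega)]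
      congr 1
      unfold valueWith
      congr 1
      ext j
      by_cases hj : j.val = i
      · simp [hj]
      · simp [hj, Function.update_of_ne, suppSet, h3]
    · have : (i ≤ k) ↔ i < k := by omega
      simp only [Function.update_of_ne hik, h4, this]
  · rw [ht.2 i, if_pos (by omega)]

/-- Exponential moment of a bounded function of the random set. -/
theorem multilinearExt_exp_le {y : Fin n → ℝ} (hy : y ∈ Set.Icc (0 : Fin n → ℝ) 1)
    {h : Finset (Fin n) → ℝ} {M l : ℝ}
    (h0 : ∀ S : Finset (Fin n), (∀ i ∈ S, y i ≠ 0) → 0 ≤ h S)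
    (h1 : ∀ S : Finset (Fin n), (∀ i ∈ S, y i ≠ 0) → h S ≤ M) (hl : |l| * M ≤ 1) :
    multilinearExt (fun S => Real.exp (l * (h S - multilinearExt h y))) y ≤
      Real.exp (l ^ 2 * M ^ 2) := by
  set μ := multilinearExt h y with hμ
  have hμ0 : 0 ≤ μ := by
    rw [← multilinearExt_const 0 y]
    exact multilinearExt_mono_of_support hy h0
  have hμ1 : μ ≤ M := by
    rw [← multilinearExt_const M y]
    exact multilinearExt_mono_of_support hy h1
  calc multilinearExt (fun S => Real.exp (l * (h S - μ))) y
      ≤ multilinearExt (fun S => (1 - l * μ + l ^ 2 * M ^ 2) + l * h S) y := by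
        refine multilinearExt_mono_of_support hy fun S hS => ?_
        have ha : |h S - μ| ≤ M := abs_le.2 ⟨by linarith [h0 S hS], by linarith [h1 S hS]⟩
        have hb : |l * (h S - μ)| ≤ |l| * M := by
          rw [abs_mul]; exact mul_le_mul_of_nonneg_left ha (abs_nonneg l)
        -- This is |exp u - 1 - u| ≤ u² for |u| ≤ 1. The linear term has mean zero, so only l²M²
        -- remains.
        have hc := Real.abs_exp_sub_one_sub_id_le (hb.trans hl)
        have hd : (l * (h S - μ)) ^ 2 ≤ l ^ 2 * M ^ 2 := by
          rw [← sq_abs, ← sq_abs l, ← mul_pow]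
          exact pow_le_pow_left₀ (abs_nonneg _) hb 2
        have he := (abs_le.1 hc).2
        linarith
    _ = 1 + l ^ 2 * M ^ 2 := by
        rw [multilinearExt_add, multilinearExt_const, multilinearExt_mul_left]
        ring
    _ ≤ _ := by linarith [Real.add_one_le_exp (l ^ 2 * M ^ 2)]

/-- The exponential potential that controls the deviation of the accumulators. -/
def potential (I : Finset ℕ) (μ : ℕ → ℝ) (l κ : ℝ) (k : ℕ) (g : ℕ → ℝ) : ℝ :=
  ∑ i ∈ I, (Real.exp (l * (g i - k * μ i) - k * κ) + Real.exp (-l * (g i - k * μ i) - k * κ))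

theorem potential_nonneg (I : Finset ℕ) (μ : ℕ → ℝ) (l κ : ℝ) (k : ℕ) (g : ℕ → ℝ) :
    0 ≤ potential I μ l κ k g :=
  Finset.sum_nonneg fun _ _ => by positivity

/-- One sample multiplies each exponential by at most exp(l²M²) in expectation, and the
normalization by exp(-kκ) absorbs this factor. Both signs of l are needed for two-sided deviations.
-/
theorem multilinearExt_potential_le {y : Fin n → ℝ} (hy : y ∈ Set.Icc (0 : Fin n → ℝ) 1)
    {h : ℕ → Finset (Fin n) → ℝ} {I : Finset ℕ} {M l : ℝ}
    (h0 : ∀ i ∈ I, ∀ S : Finset (Fin n), (∀ j ∈ S, y j ≠ 0) → 0 ≤ h i S)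
    (h1 : ∀ i ∈ I, ∀ S : Finset (Fin n), (∀ j ∈ S, y j ≠ 0) → h i S ≤ M) (hl : |l| * M ≤ 1)
    (k : ℕ) (g : ℕ → ℝ) :
    multilinearExt (fun S => potential I (fun i => multilinearExt (h i) y) l (l ^ 2 * M ^ 2)
      (k + 1) (fun i => g i + h i S)) y ≤
    potential I (fun i => multilinearExt (h i) y) l (l ^ 2 * M ^ 2) k g := by
  unfold potential
  rw [multilinearExt_sum]
  refine Finset.sum_le_sum fun i hi => ?_
  rw [multilinearExt_add]
  have key : ∀ l' : ℝ, l' ^ 2 = l ^ 2 → |l'| * M ≤ 1 →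
      multilinearExt (fun S => Real.exp (l' * (g i + h i S - ((k + 1 : ℕ) : ℝ) *
        multilinearExt (h i) y) - ((k + 1 : ℕ) : ℝ) * (l ^ 2 * M ^ 2))) y ≤
      Real.exp (l' * (g i - k * multilinearExt (h i) y) - k * (l ^ 2 * M ^ 2)) := by
    intro l' hl' hl1
    have e : ∀ S, Real.exp (l' * (g i + h i S - ((k + 1 : ℕ) : ℝ) *
        multilinearExt (h i) y) - ((k + 1 : ℕ) : ℝ) * (l ^ 2 * M ^ 2)) =
        (Real.exp (l' * (g i - k * multilinearExt (h i) y) - k * (l ^ 2 * M ^ 2)) *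
          Real.exp (-(l ^ 2 * M ^ 2))) * Real.exp (l' * (h i S - multilinearExt (h i) y)) := by
      intro S
      rw [← Real.exp_add, ← Real.exp_add]
      congr 1
      push_cast
      ring
    simp only [e]
    rw [multilinearExt_mul_left]
    have hx := multilinearExt_exp_le hy (h0 i hi) (h1 i hi) hl1
    rw [hl'] at hx
    calc _ ≤ _ := mul_le_mul_of_nonneg_left hx (by positivity)
      _ = _ := by
        rw [mul_assoc, ← Real.exp_add, neg_add_cancel, Real.exp_zero, mul_one]
  exact add_le_add (key l rfl hl) (key (-l) (by ring) (by rwa [abs_neg]))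

/-- Only the accumulators up to index n are controlled by the round, so G may depend only on them
(`hloc`). -/
theorem expect_sampleRound {s : State} (hn : s.nat 0 = n)
    (hy : s.readVec n 0 ∈ Set.Icc (0 : Fin n → ℝ) 1) (G : (ℕ → ℝ) → ℝ)
    (hG : ∀ g, 0 ≤ G g) (hloc : ∀ g g', (∀ i ≤ n, g i = g' i) → G g = G g') :
    expect ((Prog.seq drawProg accumulateProg).exec f opt s)
        (fun t => ENNReal.ofReal (G (t.real 4))) ≤
      ENNReal.ofReal (multilinearExt (fun S => G fun i => s.real 4 i + valueWith f i S)
        (s.readVec n 0)) := by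
  simp only [Prog.exec, expect_bind]
  refine le_trans (expect_mono_of_support fun t ht => ?_)
    (expect_drawProg (f := f) (opt := opt) hn hy (fun S => G fun i => s.real 4 i + valueWith f i S)
      fun S => hG _)
  have ht4 : t.real 4 = s.real 4 := sure_drawProg_keeps (by norm_num) t ht
  have htn : t.nat 0 = n := ((drawProg_keepsSizes.sure s t ht).1).trans hn
  refine expect_le_of_support fun u hu => ?_
  have hu4 := sure_accumulateProg htn u hu
  rw [hloc (u.real 4) (fun i => s.real 4 i + valueWith f i (suppSet n (t.real 3)))]
  intro i hi
  rw [hu4 i hi, ht4]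

/-- All accumulators in `I` are close to their expectations, up to `m τ` after `m` samples. -/
theorem failProb_sampleProg {s : State} {m : ℕ} (hn : s.nat 0 = n) (hm : s.nat 1 = m)
    (hy : s.readVec n 0 ∈ Set.Icc (0 : Fin n → ℝ) 1) {I : Finset ℕ} (hI : ∀ i ∈ I, i ≤ n)
    {M l τ : ℝ}
    (h0 : ∀ i ∈ I, ∀ S : Finset (Fin n), (∀ j ∈ S, s.readVec n 0 j ≠ 0) → 0 ≤ valueWith f i S)
    (h1 : ∀ i ∈ I, ∀ S : Finset (Fin n), (∀ j ∈ S, s.readVec n 0 j ≠ 0) → valueWith f i S ≤ M)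
    (hl0 : 0 ≤ l) (hl : l * M ≤ 1) :
    failProb (sampleProg.exec f opt s) (fun t => ∀ i ∈ I,
        |t.real 4 i - m * multilinearExt (valueWith f i) (s.readVec n 0)| ≤ m * τ) ≤
      ENNReal.ofReal (2 * (n + 1) * Real.exp (m * (l ^ 2 * M ^ 2 - l * τ))) := by
  set y := s.readVec n 0 with hydef
  set μ : ℕ → ℝ := fun i => multilinearExt (valueWith f i) y with hμ
  set κ := l ^ 2 * M ^ 2 with hκ
  set c := Real.exp (m * (κ - l * τ)) with hc
  -- Markov's inequality: a deviation beyond mτ in one tracked index already makes the potential at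
  -- least 1/c.
  have hφ : failProb (sampleProg.exec f opt s) (fun t => ∀ i ∈ I,
      |t.real 4 i - m * μ i| ≤ m * τ) ≤
      expect (sampleProg.exec f opt s)
        (fun t => ENNReal.ofReal (c * potential I μ l κ m (t.real 4))) := by
    refine failProb_le_expect fun t _ ht => ?_
    push Not at ht
    obtain ⟨i, hi, hlt⟩ := ht
    rw [ENNReal.one_le_ofReal]
    have hpos : ∀ j ∈ I, 0 ≤ Real.exp (l * (t.real 4 j - m * μ j) - m * κ) +
        Real.exp (-l * (t.real 4 j - m * μ j) - m * κ) := fun _ _ => by positivity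
    have h2 := Finset.single_le_sum hpos hi
    have h3 : Real.exp (l * (m * τ) - m * κ) ≤ Real.exp (l * (t.real 4 i - m * μ i) - m * κ) +
        Real.exp (-l * (t.real 4 i - m * μ i) - m * κ) := by
      rcases lt_abs.1 hlt with h | h
      · refine le_trans ?_ (le_add_of_nonneg_right (Real.exp_pos _).le)
        exact Real.exp_le_exp.2 (sub_le_sub_right (mul_le_mul_of_nonneg_left h.le hl0) _)
      · refine le_trans ?_ (le_add_of_nonneg_left (Real.exp_pos _).le)
        refine Real.exp_le_exp.2 (sub_le_sub_right ?_ _)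
        rw [neg_mul, ← mul_neg]
        exact mul_le_mul_of_nonneg_left h.le hl0
    calc (1 : ℝ) = c * Real.exp (l * (m * τ) - m * κ) := by
          rw [hc, ← Real.exp_add]
          rw [show (m : ℝ) * (κ - l * τ) + (l * (m * τ) - m * κ) = 0 by ring, Real.exp_zero]
      _ ≤ _ := mul_le_mul_of_nonneg_left (h3.trans h2) (Real.exp_pos _).le
  refine hφ.trans ?_
  rw [sampleProg]
  simp only [Prog.exec, expect_bind]
  refine expect_le_of_support fun t ht => ?_
  have hS : (Prog.forRange 2 (.add (.var 0) (.const 1))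
      (.setReal 4 (.var 2) (.const 0))).keepsSizes := by
    simp [Prog.forRange, Prog.keepsNat, Prog.keepsSizes]
  have htS : SameSizes s t := hS.sure s t ht
  have ht0 : t.real 0 = s.real 0 :=
    sure_keepsReal (by simp [Prog.forRange, Prog.keepsReal]) s t ht
  have ht4 : ∀ i ≤ n, t.real 4 i = 0 := by
    have := sure_forRange (f := f) (opt := opt) (v := 2) (e := .add (.var 0) (.const 1))
      (p := .setReal 4 (.var 2) (.const 0)) (s := s) (K := n + 1) (by norm_num)
      (by simp [Prog.keepsNat]) (by simp [Prog.keepsNat, Prog.keepsSizes])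
      (by simpa [NatExp.eval] using hn)
      (Inv := fun k r => ∀ i < k, r 4 i = 0) (by simp) (fun k hk u _ huk hu => by
        rw [sure_setReal]
        intro i hi
        by_cases hik : i = k
        · simp [NatExp.eval, RealExp.eval, huk, hik]
        · simp only [NatExp.eval, RealExp.eval, huk, State.tick_real, State.writeReal_real,
            Function.update_self, Function.update_of_ne hik]
          exact hu i (by omega))
    exact fun i hi => this t ht i (by omega)
  have hty : t.readVec n 0 = y := by ext i; simp [State.readVec, ht0, hydef]
  have hloc : ∀ k (g g' : ℕ → ℝ), (∀ i ≤ n, g i = g' i) →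
      c * potential I μ l κ k g = c * potential I μ l κ k g' := fun k g g' h => by
    unfold potential
    congr 1
    exact Finset.sum_congr rfl fun i hi => by rw [h i (hI i hi)]
  have key := expect_forRange (f := f) (opt := opt) (v := 5) (e := .var 1)
    (p := .seq drawProg accumulateProg) (s := t) (K := m) (by norm_num)
    (by simp [drawProg, accumulateProg, Prog.forRange, Prog.keepsNat])
    (by simp [drawProg, accumulateProg, Prog.forRange, Prog.keepsNat, Prog.keepsSizes])
    (by simpa [NatExp.eval] using htS.2.trans hm) (Inv := fun _ r => r 0 = s.real 0) ht0
    (Φ := fun k r => ENNReal.ofReal (c * potential I μ l κ k (r 4)))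
    (fun k _ u _ _ hu => (sure_keepsReal
      (by simp [drawProg, accumulateProg, Prog.forRange, Prog.keepsReal]) u).mono
      fun w hw => hw.trans hu)
    (fun k _ u huS _ hu => by
      have huy : u.readVec n 0 = y := by ext i; simp [State.readVec, hu, hydef]
      refine (expect_sampleRound (huS.1.trans (htS.1.trans hn)) (huy ▸ hy)
        (fun g => c * potential I μ l κ (k + 1) g)
        (fun g => mul_nonneg (Real.exp_pos _).le (potential_nonneg _ _ _ _ _ _))
        (hloc (k + 1))).trans ?_
      refine ENNReal.ofReal_le_ofReal ?_
      rw [multilinearExt_mul_left, huy]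
      exact mul_le_mul_of_nonneg_left (multilinearExt_potential_le hy h0 h1
        (by rwa [abs_of_nonneg hl0]) k (u.real 4)) (Real.exp_pos _).le)
  refine key.trans (ENNReal.ofReal_le_ofReal ?_)
  have hp0 : potential I μ l κ 0 (t.real 4) = 2 * I.card := by
    unfold potential
    rw [Finset.sum_congr rfl fun i hi => by rw [ht4 i (hI i hi)]]
    simp
    ring
  have hcard : (I.card : ℝ) ≤ n + 1 := by
    have : I ⊆ Finset.range (n + 1) := fun i hi => by
      have := hI i hi
      simp; omega
    have := Finset.card_le_card this
    rw [Finset.card_range] at this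
    exact_mod_cast this
  rw [hp0]
  have := Real.exp_pos (m * (κ - l * τ))
  rw [← hc] at this
  nlinarith

end Sampling
end MultilinearRelaxation
end

noncomputable section

namespace MultilinearRelaxation

/-! ### Continuous greedy steps -/

section Greedy

variable {n : ℕ} {f : Finset (Fin n) → ℝ}

theorem one_sub_sum_le_prod {ι : Type*} (T : Finset ι) {z : ι → ℝ} (h0 : ∀ i, 0 ≤ z i)
    (h1 : ∀ i, z i ≤ 1) : 1 - ∑ i ∈ T, z i ≤ ∏ i ∈ T, (1 - z i) := by
  classical
  induction T using Finset.induction_on with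
  | empty => simp
  | insert j T hj ih =>
    rw [Finset.sum_insert hj, Finset.prod_insert hj]
    have h2 := mul_le_mul_of_nonneg_left ih (sub_nonneg.2 (h1 j))
    have h3 := mul_nonneg (h0 j) (Finset.sum_nonneg fun i (_ : i ∈ T) => h0 i)
    nlinarith

/-- Let R(y) and R(z) be independent random sets. In F of the union keep only the events R(z) = ∅
and R(z) = {i}; the latter has probability at least z_i ∏(1 - z_j). The rest is discarded by
nonnegativity, so no upper bound on f is needed. -/
theorem prod_mul_le_multilinearExt_union (hf0 : Nonneg f) {z : Fin n → ℝ}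
    (hz : z ∈ Set.Icc (0 : Fin n → ℝ) 1) (T : Finset (Fin n)) {y : Fin n → ℝ}
    (hy : y ∈ Set.Icc (0 : Fin n → ℝ) 1) :
    (∏ i ∈ T, (1 - z i)) *
      (multilinearExt f y + ∑ i ∈ T, z i * multilinearExt f (Function.update y i 1)) ≤
    multilinearExt f (fun i => if i ∈ T then y i + z i * (1 - y i) else y i) := by
  have hz0 : ∀ i, 0 ≤ z i := hz.1
  have hz1 : ∀ i, z i ≤ 1 := hz.2
  induction T using Finset.induction_on generalizing y with
  | empty => simp
  | insert j T hj ih =>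
    set u : Fin n → ℝ := fun i => if i ∈ T then y i + z i * (1 - y i) else y i with hu
    have huj : u j = y j := by simp [hu, hj]
    have e1 : (fun i => if i ∈ insert j T then y i + z i * (1 - y i) else y i) =
        Function.update u j (y j + z j * (1 - y j)) := by
      ext i
      by_cases h : i = j
      · subst h; simp
      · simp [h, hu]
    have e2 : (fun i => if i ∈ T then Function.update y j 1 i + z i * (1 - Function.update y j 1 i)
        else Function.update y j 1 i) = Function.update u j 1 := by
      ext i
      by_cases h : i = j
      · subst h; simp [hj]
      · simp [h, hu]
    have hy' := update_mem_cube hy j (r := 1) (by simp)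
    have ih1 := ih hy
    have ih2 := ih hy'
    rw [e2] at ih2
    have d1 := multilinearExt_update_sub f u j (y j + z j * (1 - y j))
    have d2 := multilinearExt_update_sub f u j 1
    rw [huj] at d1 d2
    have e3 : multilinearExt f (Function.update u j (y j + z j * (1 - y j))) =
        (1 - z j) * multilinearExt f u + z j * multilinearExt f (Function.update u j 1) := by
      linear_combination d1 - z j * d2
    rw [e1, e3, Finset.prod_insert hj, Finset.sum_insert hj]
    set p := ∏ i ∈ T, (1 - z i) with hp
    have hp0 : 0 ≤ p := Finset.prod_nonneg fun i _ => sub_nonneg.2 (hz1 i)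
    have hs : 0 ≤ ∑ i ∈ T, z i *
        multilinearExt f (Function.update (Function.update y j 1) i 1) :=
      Finset.sum_nonneg fun i _ => mul_nonneg (hz0 i)
        (multilinearExt_nonneg hf0 (update_mem_cube hy' i (by simp)))
    have k1 := mul_le_mul_of_nonneg_left ih1 (sub_nonneg.2 (hz1 j))
    have k2 : p * multilinearExt f (Function.update y j 1) ≤
        multilinearExt f (Function.update u j 1) :=
      le_trans (mul_le_mul_of_nonneg_left (by linarith) hp0) ih2
    have k3 := mul_le_mul_of_nonneg_left k2 (hz0 j)
    have k4 := mul_nonneg (mul_nonneg hp0 (mul_nonneg (hz0 j) (hz0 j)))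
      (multilinearExt_nonneg hf0 hy')
    set X := multilinearExt f y
    set Y := multilinearExt f (Function.update y j 1)
    set S := ∑ i ∈ T, z i * multilinearExt f (Function.update y i 1)
    -- The term p z_j² Y is the slack from using 1 - z_j also in the summand where j is chosen; it
    -- is nonnegative.
    have e4 : (1 - z j) * p * (X + (z j * Y + S)) =
        (1 - z j) * (p * (X + S)) + z j * (p * Y) - p * (z j * z j) * Y := by ring
    linarith

/-- The union of two independent random sets. -/
theorem one_sub_sum_mul_le_multilinearExt_union (hf0 : Nonneg f) {y z : Fin n → ℝ}
    (hz : z ∈ Set.Icc (0 : Fin n → ℝ) 1) (hy : y ∈ Set.Icc (0 : Fin n → ℝ) 1) :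
    (1 - ∑ i, z i) *
      (multilinearExt f y + ∑ i, z i * multilinearExt f (Function.update y i 1)) ≤
    multilinearExt f (fun i => y i + z i * (1 - y i)) := by
  have h := prod_mul_le_multilinearExt_union hf0 hz Finset.univ hy
  simp only [Finset.mem_univ, if_true] at h
  refine le_trans (mul_le_mul_of_nonneg_right (one_sub_sum_le_prod _ hz.1 hz.2) ?_) h
  exact add_nonneg (multilinearExt_nonneg hf0 hy) (Finset.sum_nonneg fun i _ =>
    mul_nonneg (hz.1 i) (multilinearExt_nonneg hf0 (update_mem_cube hy i (by simp))))

/-- Expand (1 - δ Σ v)(F(y) + δ A), where A is the weighted sum of the values with one element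
added. The first-order term is the claimed gain; the second-order loss is δ² (Σ v) A ≤ δ² n · nM. -/
theorem greedy_increment (hf0 : Nonneg f) {y v : Fin n → ℝ} {δ M : ℝ}
    (hy : y ∈ Set.Icc (0 : Fin n → ℝ) 1) (hv : v ∈ Set.Icc (0 : Fin n → ℝ) 1) (hδ0 : 0 ≤ δ)
    (hδ1 : δ ≤ 1) (hM : ∀ i, v i ≠ 0 → multilinearExt f (Function.update y i 1) ≤ M)
    (hM0 : 0 ≤ M) :
    multilinearExt f y
      + δ * ∑ i, v i * (multilinearExt f (Function.update y i 1) - multilinearExt f y)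
      - δ ^ 2 * n ^ 2 * M ≤
    multilinearExt f (fun i => y i + δ * v i * (1 - y i)) := by
  have hv0 : ∀ i, 0 ≤ v i := hv.1
  have hv1 : ∀ i, v i ≤ 1 := hv.2
  have h := one_sub_sum_mul_le_multilinearExt_union hf0 (y := y) (z := fun i => δ * v i)
    ⟨fun i => mul_nonneg hδ0 (hv0 i), fun i => mul_le_one₀ hδ1 (hv0 i) (hv1 i)⟩ hy
  simp only [mul_assoc, ← Finset.mul_sum] at h ⊢
  set X := multilinearExt f y
  set A := ∑ i, v i * multilinearExt f (Function.update y i 1) with hA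
  set s := ∑ i, v i with hs
  have hX : 0 ≤ X := multilinearExt_nonneg hf0 hy
  have e : ∑ i, v i * (multilinearExt f (Function.update y i 1) - X) = A - s * X := by
    rw [hA, hs, Finset.sum_mul, ← Finset.sum_sub_distrib]
    exact Finset.sum_congr rfl fun i _ => by ring
  have hs0 : 0 ≤ s := Finset.sum_nonneg fun i _ => hv0 i
  have hsn : s ≤ n := by
    refine (Finset.sum_le_sum fun i _ => hv1 i).trans ?_
    simp
  have hAn : A ≤ n * M := by
    have : ∀ i ∈ Finset.univ, v i * multilinearExt f (Function.update y i 1) ≤ M := fun i _ => by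
      by_cases hi : v i = 0
      · simp [hi, hM0]
      · have h1 := hM i hi
        have h2 := multilinearExt_nonneg hf0 (update_mem_cube hy i (r := 1) (by simp))
        have h3 := mul_le_mul_of_nonneg_right (hv1 i) h2
        linarith
    refine (Finset.sum_le_sum this).trans ?_
    simp
  have hn0 : (0 : ℝ) ≤ n := Nat.cast_nonneg n
  have hsA : s * A ≤ n * (n * M) :=
    (mul_le_mul_of_nonneg_left hAn hs0).trans
      (mul_le_mul_of_nonneg_right hsn (mul_nonneg hn0 hM0))
  have h4 := mul_le_mul_of_nonneg_left hsA (mul_nonneg hδ0 hδ0)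
  rw [e]
  nlinarith

theorem multilinearExt_update_one_sub (f : Finset (Fin n) → ℝ) (y : Fin n → ℝ) (i : Fin n) :
    multilinearExt f (Function.update y i 1) - multilinearExt f y =
      (1 - y i) * partialDeriv f i y :=
  multilinearExt_update_sub f y i 1

/-- The direction of any point `x` is good as long as `y` is bounded away from `1`. -/
theorem le_sum_marginal (hf0 : Nonneg f) (hf : Submodular f) {x y : Fin n → ℝ} {β : ℝ}
    (hx : x ∈ Set.Icc (0 : Fin n → ℝ) 1) (hy : y ∈ Set.Icc (0 : Fin n → ℝ) 1) (hβ0 : 0 ≤ β)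
    (hβ1 : β ≤ 1) (hyβ : ∀ i, y i ≤ 1 - β) :
    β * multilinearExt f x - multilinearExt f y ≤
      ∑ i, x i * (multilinearExt f (Function.update y i 1) - multilinearExt f y) := by
  have hx0 : ∀ i, 0 ≤ x i := hx.1
  have hx1 : ∀ i, x i ≤ 1 := hx.2
  have hy0 : ∀ i, 0 ≤ y i := hy.1
  have hy1 : ∀ i, y i ≤ 1 := hy.2
  -- The union of y and x. Its gradient increment from y is exactly the sum of marginals weighted by
  -- x, while z - x = y(1 - x) ≤ (1 - β)(1 - x) gives F(z) ≥ β F(x).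
  set z : Fin n → ℝ := fun i => y i + x i * (1 - y i) with hz
  have hyz : y ≤ z := fun i => by
    have := mul_nonneg (hx0 i) (sub_nonneg.2 (hy1 i))
    simp only [hz]; linarith
  have hz1 : z ≤ 1 := fun i => by
    have := mul_nonneg (sub_nonneg.2 (hx1 i)) (sub_nonneg.2 (hy1 i))
    simp only [hz, Pi.one_apply]; linarith
  have h1 := multilinearExt_add_sub_le hf hy.1 hyz hz1
  have h2 := multilinearExt_ge_of_add hf0 hf (x := x) (z := z) (β := β) hx.1
    (fun i => by
      have := mul_nonneg (hy0 i) (sub_nonneg.2 (hx1 i))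
      simp only [hz]; linarith) hβ0 hβ1
    (fun i => by
      have := mul_le_mul_of_nonneg_right (hyβ i) (sub_nonneg.2 (hx1 i))
      simp only [hz]; linarith)
  have e : ∑ i, (z i - y i) * partialDeriv f i y =
      ∑ i, x i * (multilinearExt f (Function.update y i 1) - multilinearExt f y) :=
    Finset.sum_congr rfl fun i _ => by
      rw [multilinearExt_update_one_sub]; simp only [hz]; ring
  linarith

/-- The recursion B ≥ (1 - δ)A + δ(1 - δ)^k a - δe reproduces the closed form kδ(1 - δ)^(k-1) a, a
discrete version of s·exp(-s)·a. -/
theorem greedy_recursion {δ a e A B : ℝ} {k : ℕ} (hδ1 : δ ≤ 1)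
    (hA : k * δ * (1 - δ) ^ (k - 1) * a - k * δ * e ≤ A)
    (hB : A + δ * ((1 - δ) ^ k * a - A) - δ * e ≤ B) (hδ0 : 0 ≤ δ) (he : 0 ≤ e) :
    (k + 1 : ℕ) * δ * (1 - δ) ^ k * a - (k + 1 : ℕ) * δ * e ≤ B := by
  have h1 := mul_le_mul_of_nonneg_left hA (sub_nonneg.2 hδ1)
  -- At k = 0 the exponent k - 1 is truncated, but the factor k vanishes.
  have h2 : (k : ℝ) * ((1 - δ) ^ (k - 1) * (1 - δ)) = k * (1 - δ) ^ k := by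
    rcases Nat.eq_zero_or_pos k with rfl | hk
    · simp
    · rw [← pow_succ, Nat.sub_add_cancel hk]
  have h3 : (1 - δ) * (k * δ * (1 - δ) ^ (k - 1) * a - k * δ * e) =
      δ * a * (k * (1 - δ) ^ k) - (1 - δ) * (k * δ * e) := by
    rw [← h2]; ring
  have h4 : 0 ≤ δ * (k * δ * e) := by positivity
  push_cast
  nlinarith

/-- With m = k + 1, 1 - 1/m is the inverse of 1 + 1/k ≤ exp(1/k), so the k-th power is at least 1/e
> 0.36. -/
theorem one_sub_inv_pow_ge (m : ℕ) (hm : 0 < m) :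
    (0.36 : ℝ) ≤ (1 - 1 / (m : ℝ)) ^ (m - 1) := by
  obtain ⟨k, rfl⟩ : ∃ k, m = k + 1 := ⟨m - 1, by omega⟩
  rcases Nat.eq_zero_or_pos k with rfl | hk
  · norm_num
  have hk' : (0 : ℝ) < k := by exact_mod_cast hk
  have h1 : Real.exp (-(1 / (k : ℝ))) ≤ 1 - 1 / ((k + 1 : ℕ) : ℝ) := by
    have h2 := Real.add_one_le_exp (1 / (k : ℝ))
    rw [Real.exp_neg]
    have h3 : (1 : ℝ) - 1 / ((k + 1 : ℕ) : ℝ) = (1 / (k : ℝ) + 1)⁻¹ := by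
      push_cast
      field_simp
      ring
    rw [h3]
    exact inv_anti₀ (by positivity) h2
  have h4 := pow_le_pow_left₀ (Real.exp_pos _).le h1 k
  rw [← Real.exp_nat_mul] at h4
  have h5 : (k : ℝ) * -(1 / (k : ℝ)) = -1 := by field_simp
  rw [h5] at h4
  refine le_trans ?_ h4
  rw [Real.exp_neg, le_inv_comm₀ (by norm_num) (Real.exp_pos 1)]
  have := Real.exp_one_lt_d9
  norm_num
  linarith

end Greedy

/-! ### Common and rare elements -/

section Rare

variable {n : ℕ} {f : Finset (Fin n) → ℝ} {P : Set (Fin n → ℝ)}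

theorem multilinearExt_zero (f : Finset (Fin n) → ℝ) :
    multilinearExt f (0 : Fin n → ℝ) = f ∅ := by
  rw [← multilinearExt_indicator f ∅]
  congr 1

theorem multilinearExt_single (f : Finset (Fin n) → ℝ) (i : Fin n) :
    multilinearExt f (Function.update 0 i 1) = f {i} := by
  rw [← multilinearExt_indicator f {i}]
  congr 1
  ext j
  by_cases h : j = i
  · subst h; simp
  · simp [h]

/-- First-order bound at 0, where each partial derivative is f({i}) - f(∅) ≤ f({i}). -/
theorem multilinearExt_le_linear (hf0 : Nonneg f) (hf : Submodular f) {x : Fin n → ℝ}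
    (hx : x ∈ Set.Icc (0 : Fin n → ℝ) 1) :
    multilinearExt f x ≤ f ∅ + ∑ i, x i * f {i} := by
  have h := multilinearExt_add_sub_le hf le_rfl hx.1 hx.2
  rw [multilinearExt_zero] at h
  have : ∑ i, (x i - (0 : Fin n → ℝ) i) * partialDeriv f i 0 ≤ ∑ i, x i * f {i} := by
    refine Finset.sum_le_sum fun i _ => ?_
    have h1 : partialDeriv f i 0 ≤ f {i} := by
      rw [partialDeriv, multilinearExt_single]
      have := multilinearExt_nonneg hf0 (update_mem_cube (x := (0 : Fin n → ℝ))
        ⟨le_rfl, zero_le_one⟩ i (r := 0) (by simp))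
      linarith
    have h2 := hx.1 i
    simp only [Pi.zero_apply, sub_zero] at *
    exact mul_le_mul_of_nonneg_left h1 h2
  linarith

theorem le_linear_of_mem (hf0 : Nonneg f) (hf : Submodular f) (S : Finset (Fin n)) :
    f S ≤ f ∅ + ∑ i ∈ S, f {i} := by
  induction S using Finset.induction_on with
  | empty => simp
  | insert j S hj ih =>
    have h := hf {j} S
    rw [Finset.sum_insert hj]
    have h1 := hf0 ({j} ∩ S)
    rw [Finset.insert_eq]
    linarith

/-- A classification of the elements by `w` into common (`1`) and rare (`0`) ones, together with a
solution `b` of the linear relaxation over the rare elements and its value `L`. -/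
structure Classified (f : Finset (Fin n) → ℝ) (P : Set (Fin n → ℝ)) (w b : Fin n → ℝ) (L : ℝ) :
    Prop where
  zero_or_one : ∀ i, w i = 0 ∨ w i = 1
  common : ∀ i, w i = 1 → ∃ x ∈ P, 1 ≤ x i * (50 * n)
  rare : ∀ i, w i = 0 → ∀ x ∈ P, x i * (50 * n) < 1
  mem : b ∈ P
  b_eq_zero : ∀ i, w i = 1 → b i = 0
  value_eq : L = f ∅ + ∑ i, b i * f {i}
  le_value : ∀ x ∈ P, (∀ i, w i = 1 → x i = 0) → f ∅ + ∑ i, x i * f {i} ≤ L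

namespace Classified

variable {w b : Fin n → ℝ} {L : ℝ}

/-- Apply the union bound with y = 0: F(b) ≥ (1 - Σ b_i) L, and rarity gives Σ b_i ≤ n · 1/(50n). -/
theorem multilinearExt_ge (hc : Classified f P w b L) (hf0 : Nonneg f) (hP : DownMonotone P)
    (hn : 0 < n) : 49 / 50 * L ≤ multilinearExt f b := by
  have hb := hP.1 hc.mem
  have h := one_sub_sum_mul_le_multilinearExt_union hf0 (y := 0) (z := b) hb
    ⟨le_rfl, zero_le_one⟩
  simp only [multilinearExt_zero, multilinearExt_single, Pi.zero_apply, sub_zero, mul_one,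
    zero_add] at h
  rw [← hc.value_eq] at h
  have hn' : (0 : ℝ) < n := by exact_mod_cast hn
  have hs : ∑ i, b i ≤ 1 / 50 := by
    have : ∀ i ∈ Finset.univ, b i ≤ 1 / (50 * n) := fun i _ => by
      rw [le_div_iff₀ (by positivity)]
      rcases hc.zero_or_one i with h0 | h1
      · exact (hc.rare i h0 b hc.mem).le
      · rw [hc.b_eq_zero i h1]; norm_num
    refine (Finset.sum_le_sum this).trans (le_of_eq ?_)
    simp
    field_simp
  have hL : 0 ≤ L := by
    rw [hc.value_eq]
    exact add_nonneg (hf0 _) (Finset.sum_nonneg fun i _ => mul_nonneg (hb.1 i) (hf0 _))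
  have := mul_le_mul_of_nonneg_right (show (49 / 50 : ℝ) ≤ 1 - ∑ i, b i by linarith) hL
  exact this.trans h

theorem rare_le (hc : Classified f P w b L) (hf0 : Nonneg f) (hf : Submodular f)
    (hP : DownMonotone P) {x : Fin n → ℝ} (hx : x ∈ P) (hxw : ∀ i, w i = 1 → x i = 0) :
    multilinearExt f x ≤ L :=
  (multilinearExt_le_linear hf0 hf (hP.1 hx)).trans (hc.le_value x hx hxw)

/-- Keep only coordinate i of a point of P with x_i ≥ 1/(50n): its value is at least x_i f({i}), and
it is supported on common elements. -/
theorem common_le (hc : Classified f P w b L) (hf0 : Nonneg f) (hP : DownMonotone P) {a : ℝ}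
    (ha : ∀ x ∈ P, (∀ i, w i = 0 → x i = 0) → multilinearExt f x ≤ a) {i : Fin n} (hi : w i = 1) :
    f {i} ≤ 50 * n * a := by
  obtain ⟨x, hx, h1⟩ := hc.common i hi
  have hxc := hP.1 hx
  have hx0 : 0 ≤ x i := hxc.1 i
  have hx1 : x i ≤ 1 := hxc.2 i
  have hu : Function.update (0 : Fin n → ℝ) i (x i) ∈ Set.Icc (0 : Fin n → ℝ) 1 :=
    update_mem_cube ⟨le_rfl, zero_le_one⟩ i ⟨hx0, hx1⟩
  have h2 := ha (Function.update 0 i (x i)) (hP.2 x hx _ hu fun j => by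
      by_cases h : j = i
      · subst h; simp
      · simpa [h] using hxc.1 j) fun j hj => by
      have : j ≠ i := fun h => by rw [h, hi] at hj; norm_num at hj
      simp [this]
  rw [multilinearExt_update, multilinearExt_single] at h2
  have h3 := multilinearExt_nonneg hf0 (update_mem_cube (x := (0 : Fin n → ℝ))
        ⟨le_rfl, zero_le_one⟩ i (r := 0) (by simp))
  have h4 := mul_nonneg (sub_nonneg.2 hx1) h3
  have h5 := hf0 {i}
  have h6 : x i * f {i} ≤ a := by linarith
  have h7 := mul_le_mul_of_nonneg_right h1 h5
  have h8 := mul_le_mul_of_nonneg_left h6 (show (0 : ℝ) ≤ 50 * n by positivity)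
  linarith

/-- Subadditivity gives f(S) ≤ f(∅) + Σ f({i}) ≤ a + n · 50na. This is the range that makes the
number of samples polynomial. -/
theorem value_le (hc : Classified f P w b L) (hf0 : Nonneg f) (hf : Submodular f)
    (hP : DownMonotone P) (hn : 0 < n) {a : ℝ}
    (ha : ∀ x ∈ P, (∀ i, w i = 0 → x i = 0) → multilinearExt f x ≤ a) {S : Finset (Fin n)}
    (hS : ∀ i ∈ S, w i = 1) : f S ≤ 51 * n ^ 2 * a := by
  have hn' : (1 : ℝ) ≤ n := by exact_mod_cast hn
  have h0 : f ∅ ≤ a := by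
    rw [← multilinearExt_zero f]
    exact ha 0 (hP.2 b hc.mem 0 ⟨le_rfl, zero_le_one⟩ (hP.1 hc.mem).1) fun _ _ => rfl
  have ha0 : 0 ≤ a := (hf0 _).trans h0
  have h1 : ∑ i ∈ S, f {i} ≤ n * (50 * n * a) := by
    refine (Finset.sum_le_sum fun i hi => hc.common_le hf0 hP ha (hS i hi)).trans ?_
    rw [Finset.sum_const, nsmul_eq_mul]
    refine mul_le_mul_of_nonneg_right ?_ (by positivity)
    exact_mod_cast (Finset.card_le_univ S).trans (by simp)
  have h2 := le_linear_of_mem hf0 hf S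
  have h3 : a ≤ n ^ 2 * a := le_mul_of_one_le_left ha0 (one_le_pow₀ hn')
  nlinarith

end Classified

theorem multilinearExt_le_add_restrict (hf0 : Nonneg f) (hf : Submodular f) {x w : Fin n → ℝ}
    (hx : x ∈ Set.Icc (0 : Fin n → ℝ) 1) (hw : ∀ i, w i = 0 ∨ w i = 1) :
    multilinearExt f x ≤
      multilinearExt f (fun i => w i * x i) + multilinearExt f (fun i => (1 - w i) * x i) := by
  have h0 := multilinearExt_nonneg hf0 (x := (0 : Fin n → ℝ)) ⟨le_rfl, zero_le_one⟩
  have h := multilinearExt_diminishing hf (c := 0) (d := x) (a := fun i => w i * x i)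
    (b := fun i => (1 - w i) * x i) le_rfl
    (fun i => by have : 0 ≤ x i := hx.1 i; rcases hw i with h | h <;> simp [h, this])
    (fun i => by have : 0 ≤ x i := hx.1 i; rcases hw i with h | h <;> simp [h, this]) hx.2
    (by ext i; simp only [Pi.add_apply, Pi.zero_apply]; ring)
  linarith

end Rare
end MultilinearRelaxation
end

noncomputable section

namespace MultilinearRelaxation

/-! ### The measured continuous greedy process -/

section GreedyTrajectory

variable {n : ℕ} {f : Finset (Fin n) → ℝ} {P : Set (Fin n → ℝ)} {w : Fin n → ℝ} {δ : ℝ}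

/-- Invariants of the process that do not depend on the random choices, after `k` steps of length
`δ`. -/
structure GreedyInv (P : Set (Fin n → ℝ)) (w : Fin n → ℝ) (δ : ℝ) (k : ℕ) (y : Fin n → ℝ) :
    Prop where
  nonneg : ∀ i, 0 ≤ y i
  le : ∀ i, y i ≤ 1 - (1 - δ) ^ k
  eq_zero : ∀ i, w i = 0 → y i = 0
  dominated : ∃ p ∈ P, ∀ i, y i ≤ k * δ * p i

theorem GreedyInv.zero {p : Fin n → ℝ} (hp : p ∈ P) : GreedyInv P w δ 0 (0 : Fin n → ℝ) where
  nonneg _ := le_rfl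
  le _ := by simp
  eq_zero _ _ := rfl
  dominated := ⟨p, hp, fun _ => by simp⟩

theorem GreedyInv.mem_cube {k : ℕ} {y : Fin n → ℝ} (h : GreedyInv P w δ k y) (hδ1 : δ ≤ 1) :
    y ∈ Set.Icc (0 : Fin n → ℝ) 1 :=
  ⟨h.nonneg, fun i => (h.le i).trans (by
    have := pow_nonneg (sub_nonneg.2 hδ1) k
    simp only [Pi.one_apply]; linarith)⟩

theorem GreedyInv.mem {k : ℕ} {y : Fin n → ℝ} (h : GreedyInv P w δ k y) (hP : DownMonotone P)
    (hδ1 : δ ≤ 1) (hk : k * δ ≤ 1) : y ∈ P := by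
  obtain ⟨p, hp, hyp⟩ := h.dominated
  refine hP.2 p hp y (h.mem_cube hδ1) fun i => (hyp i).trans ?_
  have : 0 ≤ p i := (hP.1 hp).1 i
  exact mul_le_of_le_one_left this hk

/-- The factor 1 - y_i means that a step removes at most a δ fraction of the distance of y_i to 1,
whence the bound 1 - (1 - δ)^k. -/
theorem GreedyInv.succ {k : ℕ} {y v : Fin n → ℝ} (h : GreedyInv P w δ k y) (hPc : Convex ℝ P)
    (hP : DownMonotone P) (hw : ∀ i, w i = 0 ∨ w i = 1) (hδ0 : 0 ≤ δ) (hδ1 : δ ≤ 1) (hv : v ∈ P) :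
    GreedyInv P w δ (k + 1) (fun i => y i + δ * (w i * v i) * (1 - y i)) := by
  have hv0 : ∀ i, 0 ≤ v i := (hP.1 hv).1
  have hv1 : ∀ i, v i ≤ 1 := (hP.1 hv).2
  have hy1 : ∀ i, y i ≤ 1 := (h.mem_cube hδ1).2
  have hwv0 : ∀ i, 0 ≤ w i * v i := fun i => by rcases hw i with h | h <;> simp [h, hv0 i]
  have hwv : ∀ i, w i * v i ≤ v i := fun i => by rcases hw i with h | h <;> simp [h, hv0 i]
  have hd0 : ∀ i, 0 ≤ δ * (w i * v i) := fun i => mul_nonneg hδ0 (hwv0 i)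
  refine ⟨fun i => ?_, fun i => ?_, fun i hi => ?_, ?_⟩
  · exact add_nonneg (h.nonneg i) (mul_nonneg (hd0 i) (sub_nonneg.2 (hy1 i)))
  · have h1 : δ * (w i * v i) ≤ δ := mul_le_of_le_one_right hδ0 ((hwv i).trans (hv1 i))
    have h2 := mul_le_mul_of_nonneg_right h1 (sub_nonneg.2 (hy1 i))
    have h3 := mul_le_mul_of_nonneg_left (h.le i) (sub_nonneg.2 hδ1)
    rw [pow_succ]
    nlinarith
  · simp [hi, h.eq_zero i hi]
  · obtain ⟨p, hp, hyp⟩ := h.dominated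
    have hk : (0 : ℝ) < k + 1 := by positivity
    -- The dominating point is the running average of the oracle answers.
    refine ⟨((k : ℝ) / (k + 1)) • p + ((1 : ℝ) / (k + 1)) • v,
      hPc hp hv (by positivity) (by positivity) (by field_simp), fun i => ?_⟩
    have h1 : δ * (w i * v i) * (1 - y i) ≤ δ * v i := by
      have h2 : δ * (w i * v i) * (1 - y i) ≤ δ * (w i * v i) :=
        mul_le_of_le_one_right (hd0 i) (by linarith [h.nonneg i])
      exact h2.trans (mul_le_mul_of_nonneg_left (hwv i) hδ0)
    have h3 := hyp i
    simp only [Pi.add_apply, Pi.smul_apply, smul_eq_mul]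
    push_cast
    have e : ((k : ℝ) + 1) * δ * (k / (k + 1) * p i + 1 / (k + 1) * v i) =
        k * δ * p i + δ * v i := by
      field_simp
    rw [e]
    linarith

/-- The indices whose accumulators matter: the common elements, and `n`. -/
def trackedIndices (w : Fin n → ℝ) : Finset ℕ := by
  classical exact (Finset.range (n + 1)).filter fun i => ∀ h : i < n, w ⟨i, h⟩ = 1

theorem le_of_mem_trackedIndices {i : ℕ} (hi : i ∈ trackedIndices w) : i ≤ n := by
  simp only [trackedIndices, Finset.mem_filter, Finset.mem_range] at hi
  omega

theorem mem_trackedIndices_of_common {i : Fin n} (hi : w i = 1) : i.val ∈ trackedIndices w := by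
  simp only [trackedIndices, Finset.mem_filter, Finset.mem_range]
  exact ⟨by omega, fun _ => hi⟩

theorem mem_trackedIndices_self : n ∈ trackedIndices w := by
  simp [trackedIndices]

theorem multilinearExt_valueWith (f : Finset (Fin n) → ℝ) (y : Fin n → ℝ) (i : Fin n) :
    multilinearExt (valueWith f i) y = multilinearExt f (Function.update y i 1) := by
  rw [multilinearExt_update_one]
  congr 1
  ext S
  exact valueWith_of_lt f i S

theorem multilinearExt_valueWith_self (f : Finset (Fin n) → ℝ) (y : Fin n → ℝ) :
    multilinearExt (valueWith f n) y = multilinearExt f y := by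
  congr 1
  ext S
  exact valueWith_self f S

/-- The values seen by the sampling procedure are bounded. -/
theorem Classified.valueWith_le {b : Fin n → ℝ} {L : ℝ} (hc : Classified f P w b L)
    (hf0 : Nonneg f) (hf : Submodular f) (hP : DownMonotone P) (hn : 0 < n) {a : ℝ}
    (ha : ∀ x ∈ P, (∀ i, w i = 0 → x i = 0) → multilinearExt f x ≤ a) {y : Fin n → ℝ}
    (hy : ∀ i, w i = 0 → y i = 0) {i : ℕ} (hi : i ∈ trackedIndices w) {S : Finset (Fin n)}
    (hS : ∀ j ∈ S, y j ≠ 0) : valueWith f i S ≤ 51 * n ^ 2 * a := by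
  refine hc.value_le hf0 hf hP hn ha fun j hj => ?_
  simp only [Finset.mem_filter, Finset.mem_univ, true_and] at hj
  rcases hj with hj | hj
  · exact (hc.zero_or_one j).resolve_left fun h => hS j hj (hy j h)
  · simp only [trackedIndices, Finset.mem_filter] at hi
    have h := hi.2 (hj ▸ j.isLt)
    have e : (⟨i, hj ▸ j.isLt⟩ : Fin n) = j := Fin.ext hj.symm
    rwa [e] at h

/-- The oracle direction v does at least as well as x for the estimated objective. Each estimated
marginal is off by 2τ after division by m, and the comparison is made for x and for v, which costs
4nτ; the other error is the second-order loss of `greedy_increment`. -/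
theorem greedy_value_step {b : Fin n → ℝ} {L : ℝ} (hc : Classified f P w b L) (hf0 : Nonneg f)
    (hf : Submodular f) (hP : DownMonotone P) {a τ M : ℝ} {k m : ℕ} (hm : 0 < m)
    (hδ : δ = 1 / m) {x y v c : Fin n → ℝ} {g : ℕ → ℝ} (hx : x ∈ P)
    (hxw : ∀ i, w i = 0 → x i = 0) (hxa : multilinearExt f x = a) (hy : GreedyInv P w δ k y)
    (hτ : 0 ≤ τ)
    (hg : ∀ i ∈ trackedIndices w, |g i - m * multilinearExt (valueWith f i) y| ≤ m * τ)
    (hM : ∀ i ∈ trackedIndices w, ∀ S : Finset (Fin n), (∀ j ∈ S, y j ≠ 0) →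
      valueWith f i S ≤ M)
    (hcv : ∀ i, c i = w i * (g i - g n)) (hv : v ∈ P)
    (hopt : ∑ i, c i * x i ≤ ∑ i, c i * v i) :
    multilinearExt f y + δ * ((1 - δ) ^ k * a - multilinearExt f y)
      - δ * (4 * n * τ + δ * n ^ 2 * M) ≤
      multilinearExt f (fun i => y i + δ * (w i * v i) * (1 - y i)) := by
  have hm' : (0 : ℝ) < m := by exact_mod_cast hm
  have hδ0 : 0 ≤ δ := by rw [hδ]; positivity
  have hδ1 : δ ≤ 1 := by
    rw [hδ, div_le_one hm']
    exact_mod_cast hm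
  have hyc := hy.mem_cube hδ1
  have hvc := hP.1 hv
  have hxc := hP.1 hx
  have hv0 : ∀ i, 0 ≤ v i := hvc.1
  have hv1 : ∀ i, v i ≤ 1 := hvc.2
  have hx0 : ∀ i, 0 ≤ x i := hxc.1
  have hx1 : ∀ i, x i ≤ 1 := hxc.2
  have hw := hc.zero_or_one
  have hmean : ∀ i ∈ trackedIndices w, multilinearExt (valueWith f i) y ≤ M := fun i hi => by
    rw [← multilinearExt_const M y]
    exact multilinearExt_mono_of_support hyc (hM i hi)
  have hM0 : 0 ≤ M := by
    refine le_trans ?_ (hmean n mem_trackedIndices_self)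
    rw [multilinearExt_valueWith_self]
    exact multilinearExt_nonneg hf0 hyc
  have hinc := greedy_increment hf0 (y := y) (v := fun i => w i * v i) (δ := δ) (M := M) hyc
    ⟨fun i => by rcases hw i with h | h <;> simp [h, hv0 i],
      fun i => by rcases hw i with h | h <;> simp [h, hv1 i]⟩ hδ0 hδ1
    (fun i hi => by
      have : w i = 1 := (hw i).resolve_left fun h => hi (by simp [h])
      rw [← multilinearExt_valueWith]
      exact hmean _ (mem_trackedIndices_of_common this)) hM0
  have hpow0 : 0 ≤ (1 - δ) ^ k := pow_nonneg (sub_nonneg.2 hδ1) k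
  have hpow1 : (1 - δ) ^ k ≤ 1 := pow_le_one₀ (sub_nonneg.2 hδ1) (by linarith)
  have hdir := le_sum_marginal hf0 hf (x := x) (y := y) hxc hyc hpow0 hpow1 hy.le
  rw [hxa] at hdir
  -- comparison of the estimates with the exact marginal values
  set D : Fin n → ℝ := fun i => multilinearExt f (Function.update y i 1) - multilinearExt f y
    with hD
  have hest : ∀ i, w i = 1 → |c i - m * D i| ≤ 2 * m * τ := fun i hi => by
    have h1 := abs_le.1 (hg i (mem_trackedIndices_of_common hi))
    have h2 := abs_le.1 (hg n mem_trackedIndices_self)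
    rw [multilinearExt_valueWith] at h1
    rw [multilinearExt_valueWith_self] at h2
    rw [hcv, hi, abs_le]
    simp only [hD]
    constructor <;> linarith
  have hcard : ∑ _i : Fin n, 2 * (m : ℝ) * τ = n * (2 * m * τ) := by simp
  have hup : ∑ i, c i * v i ≤ m * ∑ i, w i * v i * D i + n * (2 * m * τ) := by
    rw [← hcard, Finset.mul_sum, ← Finset.sum_add_distrib]
    refine Finset.sum_le_sum fun i _ => ?_
    have hpos : 0 ≤ 2 * (m : ℝ) * τ := by positivity
    rcases hw i with h | h
    · simp [hcv, h, hpos]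
    · have h1 := (abs_le.1 (hest i h)).2
      have h2 := mul_le_mul_of_nonneg_right h1 (hv0 i)
      have h3 := mul_le_of_le_one_right hpos (hv1 i)
      rw [h]
      nlinarith
  have hlo : m * ∑ i, x i * D i - n * (2 * m * τ) ≤ ∑ i, c i * x i := by
    rw [← hcard, Finset.mul_sum, ← Finset.sum_sub_distrib]
    refine Finset.sum_le_sum fun i _ => ?_
    have hpos : 0 ≤ 2 * (m : ℝ) * τ := by positivity
    rcases hw i with h | h
    · simp [hxw i h, hpos]
    · have h1 := (abs_le.1 (hest i h)).1
      have h2 := mul_le_mul_of_nonneg_right h1 (hx0 i)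
      have h3 := mul_le_of_le_one_right hpos (hx1 i)
      nlinarith
  have hsum : ∑ i, x i * D i - 4 * n * τ ≤ ∑ i, w i * v i * D i := by
    have : m * (∑ i, x i * D i - 4 * n * τ) ≤ m * ∑ i, w i * v i * D i := by linarith
    exact le_of_mul_le_mul_left this hm'
  have h5 := mul_le_mul_of_nonneg_left (show (1 - δ) ^ k * a - multilinearExt f y - 4 * n * τ ≤
    ∑ i, w i * v i * D i by linarith) hδ0
  have e : (fun i => y i + δ * (w i * v i) * (1 - y i)) =
      fun i => y i + δ * ((fun j => w j * v j) i) * (1 - y i) := rfl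
  rw [e]
  refine le_trans ?_ hinc
  have e2 : δ * (4 * n * τ + δ * n ^ 2 * M) = δ * (4 * n * τ) + δ ^ 2 * n ^ 2 * M := by ring
  rw [e2]
  linarith

end GreedyTrajectory
end MultilinearRelaxation
end

noncomputable section

namespace MultilinearRelaxation

/-! ### The algorithm

Register 0 holds `n`, register 1 the number of rounds and samples. Array 0 is the current point,
4 the accumulators, 5 an objective vector, 6 an answer of the linear optimization oracle, 7 the
classification of the elements, 8 the objective for the rare elements, 9 the solution for the rare
elements; entry 0 of the arrays 10, 11 and 12 holds the number of rounds, `n`, and the value of the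
linear relaxation. -/

section Algorithm

variable {n : ℕ} {f : Finset (Fin n) → ℝ} {opt : (Fin n → ℝ) → Fin n → ℝ}
  {P : Set (Fin n → ℝ)}

/-- Compute `10 ^ 13 * n ^ 8` in register 1. -/
def sizeProg : Prog :=
  .seq (.setNat 1 (.const (10 ^ 13)))
    -- Registers can only be added, so each of the eight rounds multiplies by n through repeated
    -- addition in register 4.
    (.loop (.const 8) (.seq (.setNat 4 (.const 0))
      (.seq (.loop (.var 0) (.setNat 4 (.add (.var 4) (.var 1)))) (.setNat 1 (.var 4)))))

/-- Real copies of the two sizes. -/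
def countProg : Prog :=
  -- No expression converts a register to a real number, so the copies are counted up.
  .seq (.forRange 2 (.var 0)
      (.setReal 11 (.const 0) (.add (.cell 11 (.const 0)) (.const 1))))
    (.forRange 2 (.var 1) (.setReal 10 (.const 0) (.add (.cell 10 (.const 0)) (.const 1))))

/-- Classify the elements. -/
def classifyProg : Prog :=
  .forRange 2 (.var 0)
    -- Array 5 holds the unit vector of i: as an objective it yields the maximum of x_i over P, as a
    -- set it yields f({i}). It is cleared again before the next element.
    (.seq (.setReal 5 (.var 2) (.const 1))
    (.seq (.linopt 5 6)
    (.seq (.value 5 2)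
    (.seq (.setReal 5 (.var 2) (.const 0))
      (.ite (.realLt (.mul (.cell 6 (.var 2)) (.mul (.const 50) (.cell 11 (.const 0)))) (.const 1))
        (.seq (.setReal 7 (.var 2) (.const 0)) (.setReal 8 (.var 2) (.cell 2 (.const 0))))
        (.seq (.setReal 7 (.var 2) (.const 1)) (.setReal 8 (.var 2) (.const 0))))))))

/-- Solve the linear relaxation over the rare elements. -/
def rareProg : Prog :=
  .seq (.linopt 8 9)
  -- Array 5 is zero here, so the oracle returns f(∅).
  (.seq (.value 5 2)
  (.seq (.setReal 12 (.const 0) (.cell 2 (.const 0)))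
    (.forRange 2 (.var 0)
      (.seq (.setReal 9 (.var 2) (.mul (.cell 9 (.var 2)) (.sub (.const 1) (.cell 7 (.var 2)))))
        (.setReal 12 (.const 0) (.add (.cell 12 (.const 0))
          (.mul (.cell 9 (.var 2)) (.cell 8 (.var 2)))))))))

/-- Everything that precedes the greedy process. -/
def setupProg : Prog := .seq countProg (.seq classifyProg rareProg)

/-- Move the current point, given the accumulators. -/
def updateProg : Prog :=
  .seq (.forRange 2 (.var 0) (.setReal 5 (.var 2)
      -- Register 0 holds n, so the subtracted entry is the accumulated f(R). The objective is m
      -- times the estimated marginals, set to zero on rare elements.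
      (.mul (.cell 7 (.var 2)) (.sub (.cell 4 (.var 2)) (.cell 4 (.var 0))))))
  (.seq (.linopt 5 6)
    (.forRange 2 (.var 0) (.setReal 0 (.var 2) (.add (.cell 0 (.var 2))
      (.mul (.mul (.div (.const 1) (.cell 10 (.const 0)))
        (.mul (.cell 7 (.var 2)) (.cell 6 (.var 2)))) (.sub (.const 1) (.cell 0 (.var 2))))))))

/-- The greedy process. -/
def greedyProg : Prog := .forRange 6 (.var 1) (.seq sampleProg updateProg)

/-- Output the better one of the two solutions. -/
def selectProg : Prog :=
  -- Entry n of array 4 is m times the estimate of F at the greedy point; it is compared with m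
  -- times the value 49/50 · L guaranteed for the rare solution.
  .ite (.realLt (.mul (.const 50) (.cell 4 (.var 0)))
      (.mul (.const 49) (.mul (.cell 10 (.const 0)) (.cell 12 (.const 0)))))
    (.forRange 2 (.var 0) (.setReal 0 (.var 2) (.cell 9 (.var 2)))) .skip

/-- The algorithm after the computation of the sizes. -/
def optimizeProg : Prog := .seq setupProg (.seq greedyProg (.seq sampleProg selectProg))

/-- The whole algorithm. -/
def algorithm : Prog := .seq sizeProg optimizeProg

/-! ### Correctness of the program pieces -/

theorem State.readVec_eq (s : State) (a : ℕ) : s.readVec n a = fun i : Fin n => s.real a i := rfl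

theorem sure_sizeProg {s : State} (hn : s.nat 0 = n) :
    Sure f opt sizeProg s fun t => t.nat 0 = n ∧ t.nat 1 = 10 ^ 13 * n ^ 8 := by
  rw [sizeProg, sure_seq, sure_setNat]
  refine sure_loop (Inv := fun k t => t.nat 0 = n ∧ t.nat 1 = 10 ^ 13 * n ^ k) ?_ ?_
  · simp [NatExp.eval, hn]
  · rintro k - t ⟨h0, h1⟩
    simp only [sure_seq, sure_setNat]
    refine (sure_loop (Inv := fun j u => u.nat 0 = n ∧ u.nat 1 = 10 ^ 13 * n ^ k ∧
      u.nat 4 = j * (10 ^ 13 * n ^ k)) ?_ ?_).mono ?_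
    · simp [NatExp.eval, h0, h1]
    · rintro j - u ⟨hu0, hu1, hu4⟩
      rw [sure_setNat]
      simp [NatExp.eval, hu0, hu1, hu4]
      ring
    · rintro u ⟨hu0, hu1, hu4⟩
      simp only [NatExp.eval, State.tick_nat, State.writeNat_nat] at hu4
      rw [Function.update_of_ne (by norm_num), h0] at hu4
      simp [NatExp.eval, hu0, hu4]
      ring

theorem sure_sizeProg_real (s : State) : Sure f opt sizeProg s fun t => t.real = s.real :=
  fun t ht => funext fun a =>
    sure_keepsReal (p := sizeProg) (by simp [sizeProg, Prog.keepsReal]) s t ht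

theorem sure_countProg {s : State} {m : ℕ} (hn : s.nat 0 = n) (hm : s.nat 1 = m)
    (h11 : s.real 11 0 = 0) (h10 : s.real 10 0 = 0) :
    Sure f opt countProg s fun t => t.real 11 0 = n ∧ t.real 10 0 = m := by
  rw [countProg, sure_seq]
  have hA := sure_forRange (f := f) (opt := opt) (v := 2) (e := .var 0)
    (p := .setReal 11 (.const 0) (.add (.cell 11 (.const 0)) (.const 1))) (s := s) (K := n)
    (by norm_num) (by simp [Prog.keepsNat]) (by simp [Prog.keepsNat, Prog.keepsSizes])
    (by simpa [NatExp.eval] using hn)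
    (Inv := fun k r => r 11 0 = k ∧ r 10 0 = 0) (by simp [h11, h10])
    (fun k _ t _ _ ht => by simp [sure_setReal, RealExp.eval, NatExp.eval, ht])
  have hS : (Prog.forRange 2 (.var 0)
      (.setReal 11 (.const 0) (.add (.cell 11 (.const 0)) (.const 1)))).keepsSizes := by
    simp [Prog.forRange, Prog.keepsNat, Prog.keepsSizes]
  refine (hA.and (hS.sure s)).mono fun t ht => ?_
  obtain ⟨⟨h1, h2⟩, h3⟩ := ht
  refine sure_forRange (K := m) (by norm_num) (by simp [Prog.keepsNat])
    (by simp [Prog.keepsNat, Prog.keepsSizes]) (by simpa [NatExp.eval] using h3.2.trans hm)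
    (Inv := fun k r => r 11 0 = n ∧ r 10 0 = k) (by simp [h1, h2])
    (fun k _ u _ _ hu => by simp [sure_setReal, RealExp.eval, NatExp.eval, hu])

theorem sure_classifyProg {s : State} (hn : s.nat 0 = n) (hopt : IsLinOptOracle P opt)
    (h5 : s.real 5 = 0) (h11 : s.real 11 0 = n) :
    Sure f opt classifyProg s fun t => t.real 5 = 0 ∧ ∀ i : Fin n,
      (t.real 7 i = 0 ∧ t.real 8 i = f {i} ∧ ∀ x ∈ P, x i * (50 * n) < 1) ∨
      (t.real 7 i = 1 ∧ t.real 8 i = 0 ∧ ∃ x ∈ P, 1 ≤ x i * (50 * n)) := by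
  refine (sure_forRange (K := n) (by norm_num) (by simp [Prog.keepsNat])
    (by simp [Prog.keepsNat, Prog.keepsSizes]) (by simpa [NatExp.eval] using hn)
    (Inv := fun k r => r 5 = 0 ∧ r 11 0 = n ∧ ∀ i : Fin n, i.val < k →
      (r 7 i = 0 ∧ r 8 i = f {i} ∧ ∀ x ∈ P, x i * (50 * n) < 1) ∨
      (r 7 i = 1 ∧ r 8 i = 0 ∧ ∃ x ∈ P, 1 ≤ x i * (50 * n))) (by simp [h5, h11]) ?_).mono
    fun t ht => ⟨ht.1, fun i => ht.2.2 i i.isLt⟩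
  rintro k hk t - htk ⟨ht5, ht11, htI⟩
  set i : Fin n := ⟨k, hk⟩ with hi
  have hcost : (fun j : Fin n => Function.update (0 : ℕ → ℝ) k 1 j) =
      fun j => if j = i then 1 else 0 := by
    ext j
    by_cases hj : j = i
    · subst hj; simp [hi]
    · have : j.val ≠ k := fun h => hj (Fin.ext h)
      simp [hj, this]
  have hsupp : (Finset.univ.filter fun j : Fin n => Function.update (0 : ℕ → ℝ) k 1 j ≠ 0) =
      {i} := by
    ext j
    simp [congrFun hcost j]
  obtain ⟨hmem, hmax⟩ := hopt fun j => if j = i then 1 else 0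
  simp only [ite_mul, one_mul, zero_mul, Finset.sum_ite_eq', Finset.mem_univ, if_true] at hmax
  set o := opt fun j => if j = i then 1 else 0 with ho
  have hback : Function.update (Function.update (0 : ℕ → ℝ) k 1) k 0 = 0 := by
    ext j
    by_cases hj : j = k
    · subst hj; simp
    · simp [hj]
  have hrest : ∀ (a b : ℝ) (j : Fin n), j.val < k + 1 →
      ((j = i ∧ Function.update (t.real 7) k a j = a ∧ Function.update (t.real 8) k b j = b) ∨
      (j.val < k ∧ Function.update (t.real 7) k a j = t.real 7 j ∧
        Function.update (t.real 8) k b j = t.real 8 j)) := by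
    intro a b j hj
    by_cases h : j = i
    · subst h; simp [hi]
    · have : j.val ≠ k := fun h' => h (Fin.ext h')
      exact Or.inr ⟨by omega, by simp [this], by simp [this]⟩
  simp only [sure_seq, sure_setReal, sure_linopt, sure_value, sure_ite]
  simp only [State.tick_real, State.tick_nat, State.writeReal_real, State.writeReal_nat,
    State.writeVec_real, State.writeVec_nat, NatExp.eval, RealExp.eval, Cond.holds, htk,
    State.readVec_eq, Function.update_self, ne_eq, Nat.reduceEqDiff,
    not_false_eq_true, Function.update_of_ne, ht5, hcost, ← ho, hback, ht11, hk, dif_pos,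
    Nat.cast_one, Nat.cast_zero, Nat.cast_ofNat, true_and, hsupp]
  refine ⟨fun hlt j hj => ?_, fun hge j hj => ?_⟩
  · rcases hrest 0 (f {i}) j hj with ⟨rfl, h7, h8⟩ | ⟨hjk, h7, h8⟩
    · refine Or.inl ⟨h7, h8, fun x hx => ?_⟩
      exact lt_of_le_of_lt (mul_le_mul_of_nonneg_right (hmax x hx) (by positivity)) hlt
    · rw [h7, h8]
      exact htI j hjk
  · rcases hrest 1 0 j hj with ⟨rfl, h7, h8⟩ | ⟨hjk, h7, h8⟩
    · exact Or.inr ⟨h7, h8, o, hmem, not_lt.1 hge⟩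
    · rw [h7, h8]
      exact htI j hjk

theorem sure_rareProg {s : State} (hn : s.nat 0 = n) (hopt : IsLinOptOracle P opt)
    (hP : DownMonotone P) (h5 : s.real 5 = 0)
    (hcl : ∀ i : Fin n,
      (s.real 7 i = 0 ∧ s.real 8 i = f {i} ∧ ∀ x ∈ P, x i * (50 * n) < 1) ∨
      (s.real 7 i = 1 ∧ s.real 8 i = 0 ∧ ∃ x ∈ P, 1 ≤ x i * (50 * n))) :
    Sure f opt rareProg s fun t =>
      Classified f P (t.readVec n 7) (t.readVec n 9) (t.real 12 0) := by
  obtain ⟨hmem, hmax⟩ := hopt (s.readVec n 8)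
  set o := opt (s.readVec n 8) with ho
  have hemp : (Finset.univ.filter fun i : Fin n => s.real 5 i ≠ 0) = ∅ := by simp [h5]
  simp only [rareProg, sure_seq, sure_linopt, sure_value, sure_setReal]
  simp only [State.tick_real, State.writeReal_real, State.writeVec_real, NatExp.eval, RealExp.eval,
    Function.update_self, ne_eq, Nat.reduceEqDiff,
    not_false_eq_true, Function.update_of_ne, ← ho]
  refine (sure_forRange (K := n) (by norm_num) (by simp [Prog.keepsNat])
    (by simp [Prog.keepsNat, Prog.keepsSizes]) (by simpa [NatExp.eval] using hn)
    (Inv := fun k r => r 7 = s.real 7 ∧ r 8 = s.real 8 ∧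
      (∀ i : Fin n, r 9 i = if i.val < k then o i * (1 - s.real 7 i) else o i) ∧
      r 12 0 = f ∅ + ∑ i : Fin n, if i.val < k then o i * (1 - s.real 7 i) * s.real 8 i else 0)
    ?_ ?_).mono ?_
  · refine ⟨by simp, by simp, fun i => by simp [ho], ?_⟩
    simp only [State.tick_real, State.writeReal_real, Function.update_self, ne_eq,
      Nat.reduceEqDiff, not_false_eq_true, Function.update_of_ne,
      Nat.not_lt_zero, if_false, Finset.sum_const_zero, add_zero]
    congr 1
  · rintro k hk t - htk ⟨h7, h8, h9, h12⟩
    have h9k := h9 ⟨k, hk⟩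
    simp only [lt_irrefl, if_false] at h9k
    simp only [sure_seq, sure_setReal]
    simp only [State.tick_real, State.tick_nat, State.writeReal_real, State.writeReal_nat,
      NatExp.eval, RealExp.eval, Function.update_self, ne_eq, 
      Nat.reduceEqDiff, not_false_eq_true, Function.update_of_ne, htk, h7, h8, h9k, h12,
      Nat.cast_one, true_and]
    constructor
    · intro j
      by_cases hj : j.val = k
      · have : j = ⟨k, hk⟩ := Fin.ext hj
        subst this
        simp
      · have : (j.val < k + 1) ↔ j.val < k := by omega
        simp only [Function.update_of_ne hj, h9 j, this]
    · rw [add_assoc]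
      congr 1
      have hsplit : ∀ j : Fin n, (if j.val < k + 1 then o j * (1 - s.real 7 j) * s.real 8 j else 0)
          = (if j.val < k then o j * (1 - s.real 7 j) * s.real 8 j else 0) +
            if j = ⟨k, hk⟩ then o j * (1 - s.real 7 j) * s.real 8 j else 0 := by
        intro j
        by_cases hj : j = ⟨k, hk⟩
        · subst hj; simp
        · have h1 : j.val ≠ k := fun h => hj (Fin.ext h)
          have : (j.val < k + 1) ↔ j.val < k := by omega
          simp only [this, hj, if_false, add_zero]
      simp only [hsplit, Finset.sum_add_distrib, Finset.sum_ite_eq', Finset.mem_univ, if_true]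
  · rintro t ⟨h7, h8, h9, h12⟩
    have h9' : ∀ i : Fin n, t.real 9 i = o i * (1 - s.real 7 i) := fun i => by
      rw [h9 i, if_pos i.isLt]
    have h12' : t.real 12 0 = f ∅ + ∑ i : Fin n, o i * (1 - s.real 7 i) * s.real 8 i := by
      rw [h12]
      congr 1
      exact Finset.sum_congr rfl fun i _ => if_pos i.isLt
    have ho0 : ∀ i, 0 ≤ o i := (hP.1 hmem).1
    have ho1 : ∀ i, o i ≤ 1 := (hP.1 hmem).2
    have hb0 : ∀ i : Fin n, 0 ≤ t.real 9 i := fun i => by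
      rw [h9']
      rcases hcl i with h | h <;> simp [h.1, ho0 i]
    have hbo : ∀ i : Fin n, t.real 9 i ≤ o i := fun i => by
      rw [h9']
      rcases hcl i with h | h <;> simp [h.1, ho0 i]
    refine ⟨fun i => ?_, fun i hi => ?_, fun i hi => ?_, ?_, fun i hi => ?_, ?_, fun x hx hxw => ?_⟩
    · simp only [State.readVec, h7]
      exact (hcl i).imp And.left And.left
    · simp only [State.readVec, h7] at hi
      rcases hcl i with h | h
      · rw [h.1] at hi; norm_num at hi
      · exact h.2.2
    · simp only [State.readVec, h7] at hi
      rcases hcl i with h | h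
      · exact h.2.2
      · rw [h.1] at hi; norm_num at hi
    · exact hP.2 o hmem _ ⟨hb0, fun i => (hbo i).trans (ho1 i)⟩ hbo
    · simp only [State.readVec, h7] at hi ⊢
      rw [h9', hi]
      ring
    · rw [h12']
      congr 1
      refine Finset.sum_congr rfl fun i _ => ?_
      simp only [State.readVec, h9']
      rcases hcl i with h | h
      · rw [h.2.1]
      · rw [h.1]; ring
    · rw [h12']
      refine add_le_add_right ?_ _
      calc ∑ i, x i * f {i} = ∑ i, s.readVec n 8 i * x i := by
            refine Finset.sum_congr rfl fun i _ => ?_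
            simp only [State.readVec, h7] at hxw ⊢
            rcases hcl i with h | h
            · rw [h.2.1]; ring
            · rw [hxw i h.1]; ring
        _ ≤ ∑ i, s.readVec n 8 i * o i := hmax x hx
        _ = _ := by
            refine Finset.sum_congr rfl fun i _ => ?_
            simp only [State.readVec]
            rcases hcl i with h | h
            · rw [h.1]; ring
            · rw [h.2.1]; ring

theorem sure_updateProg {s : State} (hn : s.nat 0 = n) :
    Sure f opt updateProg s fun t => t.readVec n 0 = fun i => s.readVec n 0 i +
      1 / s.real 10 0 * (s.readVec n 7 i * opt (fun j => s.readVec n 7 j *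
        (s.real 4 j - s.real 4 n)) i) * (1 - s.readVec n 0 i) := by
  rw [updateProg, sure_seq]
  have hA := sure_forRange (f := f) (opt := opt) (v := 2) (e := .var 0)
    (p := .setReal 5 (.var 2)
      (.mul (.cell 7 (.var 2)) (.sub (.cell 4 (.var 2)) (.cell 4 (.var 0))))) (s := s) (K := n)
    (by norm_num) (by simp [Prog.keepsNat]) (by simp [Prog.keepsNat, Prog.keepsSizes])
    (by simpa [NatExp.eval] using hn)
    (Inv := fun k r => (r 0 = s.real 0 ∧ r 4 = s.real 4 ∧ r 7 = s.real 7 ∧ r 10 = s.real 10) ∧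
      ∀ j < k, r 5 j = s.real 7 j * (s.real 4 j - s.real 4 n)) (by simp)
    (by
      rintro k hk t htS htk ⟨⟨h0, h4, h7, h10⟩, h5⟩
      rw [sure_setReal]
      simp only [State.tick_real, State.writeReal_real, NatExp.eval, RealExp.eval,
        Function.update_self, ne_eq, Nat.reduceEqDiff, not_false_eq_true,
        Function.update_of_ne, OfNat.zero_ne_ofNat, htk, htS.1, hn, h0, h4, h7, h10, true_and]
      intro j hj
      by_cases hjk : j = k
      · subst hjk; simp
      · rw [Function.update_of_ne hjk, h5 j (by omega)])
  have hS : (Prog.forRange 2 (.var 0) (.setReal 5 (.var 2)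
      (.mul (.cell 7 (.var 2)) (.sub (.cell 4 (.var 2)) (.cell 4 (.var 0)))))).keepsSizes := by
    simp [Prog.forRange, Prog.keepsNat, Prog.keepsSizes]
  refine (hA.and (hS.sure s)).mono ?_
  rintro t ⟨⟨⟨h0, h4, h7, h10⟩, h5⟩, htS⟩
  have hobj : t.readVec n 5 = fun j : Fin n => s.readVec n 7 j * (s.real 4 j - s.real 4 n) := by
    ext j
    exact h5 j j.isLt
  rw [sure_seq, sure_linopt]
  set v := opt (t.readVec n 5) with hv
  refine (sure_forRange (K := n) (by norm_num) (by simp [Prog.keepsNat])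
    (by simp [Prog.keepsNat, Prog.keepsSizes])
    (by simpa [NatExp.eval] using htS.1.trans hn)
    (Inv := fun k r => (r 7 = s.real 7 ∧ r 10 = s.real 10 ∧ ∀ i : Fin n, r 6 i = v i) ∧
      ∀ i : Fin n, r 0 i = if i.val < k then s.readVec n 0 i +
      1 / s.real 10 0 * (s.readVec n 7 i * v i) * (1 - s.readVec n 0 i) else s.real 0 i)
    (by simp [h7, h10, h0]) ?_).mono ?_
  · rintro k hk u - huk ⟨⟨g7, g10, g6⟩, g0⟩
    have g0k := g0 ⟨k, hk⟩
    have g6k := g6 ⟨k, hk⟩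
    simp only [lt_irrefl, if_false] at g0k g6k
    rw [sure_setReal]
    simp only [State.tick_real, State.writeReal_real, NatExp.eval, RealExp.eval,
      Function.update_self, ne_eq, not_false_eq_true,
      Function.update_of_ne, OfNat.ofNat_ne_zero, huk, g7, g10, g6, g0k, g6k, true_and,
      implies_true, Nat.cast_one]
    intro i
    by_cases hi : i.val = k
    · have : i = ⟨k, hk⟩ := Fin.ext hi
      subst this
      simp [State.readVec]
    · have : (i.val < k + 1) ↔ i.val < k := by omega
      simp only [Function.update_of_ne hi, g0 i, this]
  · rintro u ⟨-, g0⟩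
    ext i
    have := g0 i
    rw [if_pos i.isLt, hv, hobj] at this
    exact this

theorem sure_selectProg {s : State} (hn : s.nat 0 = n) :
    Sure f opt selectProg s fun t =>
      (50 * s.real 4 n < 49 * (s.real 10 0 * s.real 12 0) ∧ t.output n = s.readVec n 9) ∨
      (49 * (s.real 10 0 * s.real 12 0) ≤ 50 * s.real 4 n ∧ t.output n = s.readVec n 0) := by
  rw [selectProg, sure_ite, sure_skip]
  simp only [Cond.holds, RealExp.eval, NatExp.eval, hn, Nat.cast_ofNat, not_lt]
  refine ⟨fun h => ?_, fun h => Or.inr ⟨h, rfl⟩⟩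
  refine (sure_forRange (K := n) (by norm_num) (by simp [Prog.keepsNat])
    (by simp [Prog.keepsNat, Prog.keepsSizes]) (by simpa [NatExp.eval] using hn)
    (Inv := fun k r => r 9 = s.real 9 ∧ ∀ i < k, r 0 i = s.real 9 i) (by simp) ?_).mono ?_
  · rintro k hk u - huk ⟨h9, h0⟩
    rw [sure_setReal]
    simp only [State.tick_real, State.writeReal_real, NatExp.eval, RealExp.eval,
      Function.update_self, ne_eq, OfNat.ofNat_ne_zero, not_false_eq_true,
      Function.update_of_ne, huk, h9, true_and]
    intro i hi
    by_cases hik : i = k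
    · subst hik; simp
    · rw [Function.update_of_ne hik, h0 i (by omega)]
  · rintro t ⟨-, h0⟩
    exact Or.inl ⟨h, funext fun i => h0 i i.isLt⟩

end Algorithm
end MultilinearRelaxation
end

noncomputable section

namespace MultilinearRelaxation

/-! ### Analysis of the algorithm -/

section Analysis

variable {n : ℕ} {f : Finset (Fin n) → ℝ} {opt : (Fin n → ℝ) → Fin n → ℝ}
  {P : Set (Fin n → ℝ)} {m : ℕ}

/-- The memory after the setup phase. -/
def SetupInv (f : Finset (Fin n) → ℝ) (P : Set (Fin n → ℝ)) (m : ℕ) (r : ℕ → ℕ → ℝ) : Prop :=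
  r 10 0 = m ∧ Classified f P (fun i => r 7 i) (fun i => r 9 i) (r 12 0)

theorem SetupInv.congr {r r' : ℕ → ℕ → ℝ} (h : SetupInv f P m r) (h7 : r' 7 = r 7)
    (h9 : r' 9 = r 9) (h10 : r' 10 = r 10) (h12 : r' 12 = r 12) : SetupInv f P m r' := by
  unfold SetupInv at *
  rwa [h7, h9, h10, h12]

theorem SetupInv.sure {p : Prog} {s : State} (h : SetupInv f P m s.real) (h7 : p.keepsReal 7)
    (h9 : p.keepsReal 9) (h10 : p.keepsReal 10) (h12 : p.keepsReal 12) :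
    Sure f opt p s fun t => SetupInv f P m t.real ∧ t.real 7 = s.real 7 := fun t ht =>
  ⟨h.congr (sure_keepsReal h7 s t ht) (sure_keepsReal h9 s t ht) (sure_keepsReal h10 s t ht)
    (sure_keepsReal h12 s t ht), sure_keepsReal h7 s t ht⟩

theorem setupProg_keepsSizes : setupProg.keepsSizes := by
  simp [setupProg, countProg, classifyProg, rareProg, Prog.forRange, Prog.keepsNat,
    Prog.keepsSizes]

theorem sure_setupProg {s : State} (hn : s.nat 0 = n) (hm : s.nat 1 = m)
    (hs : s.real = fun _ _ => 0) (hopt : IsLinOptOracle P opt) (hP : DownMonotone P) :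
    Sure f opt setupProg s fun t => SetupInv f P m t.real ∧ t.real 0 = 0 := by
  have hk0 : setupProg.keepsReal 0 := by
    simp [setupProg, countProg, classifyProg, rareProg, Prog.forRange, Prog.keepsReal]
  refine Sure.and ?_ ((sure_keepsReal hk0 s).mono fun t ht => by rw [ht, hs]; rfl)
  rw [setupProg, sure_seq]
  have k1 : countProg.keepsSizes := by
    simp [countProg, Prog.forRange, Prog.keepsNat, Prog.keepsSizes]
  have k2 : countProg.keepsReal 5 := by simp [countProg, Prog.forRange, Prog.keepsReal]
  refine ((sure_countProg hn hm (by rw [hs]) (by rw [hs])).and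
    ((k1.sure s).and (sure_keepsReal k2 s))).mono ?_
  rintro t ⟨⟨h11, h10⟩, htS, h5⟩
  rw [sure_seq]
  have k3 : classifyProg.keepsSizes := by
    simp [classifyProg, Prog.forRange, Prog.keepsNat, Prog.keepsSizes]
  have k4 : classifyProg.keepsReal 10 := by simp [classifyProg, Prog.forRange, Prog.keepsReal]
  refine ((sure_classifyProg (htS.1.trans hn) hopt (by rw [h5, hs]; rfl) h11).and
    ((k3.sure t).and (sure_keepsReal k4 t))).mono ?_
  rintro u ⟨⟨hu5, hucl⟩, huS, hu10⟩
  have k5 : rareProg.keepsReal 10 := by simp [rareProg, Prog.forRange, Prog.keepsReal]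
  refine ((sure_rareProg (huS.1.trans (htS.1.trans hn)) hopt hP hu5 hucl).and
    (sure_keepsReal k5 u)).mono ?_
  rintro v ⟨hcl, hv10⟩
  exact ⟨by rw [hv10, hu10, h10], hcl⟩

theorem sampleProg_keepsSizes : sampleProg.keepsSizes := by
  simp [sampleProg, drawProg, accumulateProg, Prog.forRange, Prog.keepsNat, Prog.keepsSizes]

theorem sure_sampleProg_real {s : State} (h : SetupInv f P m s.real) :
    Sure f opt sampleProg s fun t =>
      (SetupInv f P m t.real ∧ t.real 7 = s.real 7) ∧ t.real 0 = s.real 0 := by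
  refine (h.sure ?_ ?_ ?_ ?_).and (sure_keepsReal ?_ s) <;>
    simp [sampleProg, drawProg, accumulateProg, Prog.forRange, Prog.keepsReal]

/-- The invariants of the greedy loop that hold in every run. -/
def LoopInv (f : Finset (Fin n) → ℝ) (P : Set (Fin n → ℝ)) (m k : ℕ) (r : ℕ → ℕ → ℝ) : Prop :=
  SetupInv f P m r ∧ GreedyInv P (fun i => r 7 i) (1 / m) k (fun i => r 0 i)

theorem sure_updateProg_loopInv {s : State} {k : ℕ} (hn : s.nat 0 = n) (hm : 0 < m)
    (hPc : Convex ℝ P) (hP : DownMonotone P) (hopt : IsLinOptOracle P opt)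
    (h : LoopInv f P m k s.real) :
    Sure f opt updateProg s fun t => LoopInv f P m (k + 1) t.real ∧
      t.readVec n 0 = fun i => s.readVec n 0 i +
      1 / (m : ℝ) * (s.readVec n 7 i * opt (fun j => s.readVec n 7 j *
        (s.real 4 j - s.real 4 n)) i) * (1 - s.readVec n 0 i) := by
  have hm' : (1 : ℝ) ≤ m := by exact_mod_cast hm
  have hk : Sure f opt updateProg s fun t => SetupInv f P m t.real ∧ t.real 7 = s.real 7 := by
    refine h.1.sure ?_ ?_ ?_ ?_ <;> simp [updateProg, Prog.forRange, Prog.keepsReal]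
  refine (hk.and (sure_updateProg hn)).mono ?_
  rintro t ⟨⟨h1, h7⟩, h0⟩
  rw [h.1.1] at h0
  refine ⟨⟨h1, ?_⟩, h0⟩
  have h0' : (fun i : Fin n => t.real 0 i) = _ := h0
  rw [h7, h0']
  exact h.2.succ hPc hP h.1.2.zero_or_one (by positivity)
    ((div_le_one (by linarith)).2 hm') (hopt _).1

theorem sure_round {s : State} {k : ℕ} (hn : s.nat 0 = n) (hm : 0 < m)
    (hPc : Convex ℝ P) (hP : DownMonotone P) (hopt : IsLinOptOracle P opt)
    (h : LoopInv f P m k s.real) :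
    Sure f opt (.seq sampleProg updateProg) s fun t => LoopInv f P m (k + 1) t.real := by
  rw [sure_seq]
  refine ((sampleProg_keepsSizes.sure s).and (sure_sampleProg_real h.1)).mono ?_
  rintro t ⟨htS, ⟨h1, h7⟩, h0⟩
  refine (sure_updateProg_loopInv (htS.1.trans hn) hm hPc hP hopt (k := k) ⟨h1, ?_⟩).mono
    fun u hu => hu.1
  rw [h7, h0]
  exact h.2

theorem LoopInv.zero {r : ℕ → ℕ → ℝ} (h : SetupInv f P m r) (h0 : r 0 = 0) :
    LoopInv f P m 0 r := by
  refine ⟨h, ?_⟩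
  have : (fun i : Fin n => r 0 i) = 0 := by rw [h0]; rfl
  rw [this]
  exact GreedyInv.zero h.2.mem

theorem round_keepsNat : (Prog.seq sampleProg updateProg).keepsNat 6 := by
  simp [sampleProg, drawProg, accumulateProg, updateProg, Prog.forRange, Prog.keepsNat]

theorem round_keepsSizes : (Prog.seq sampleProg updateProg).keepsSizes := by
  simp [sampleProg, drawProg, accumulateProg, updateProg, Prog.forRange, Prog.keepsNat,
    Prog.keepsSizes]

theorem greedyProg_keepsSizes : greedyProg.keepsSizes := by
  simp [greedyProg, sampleProg, drawProg, accumulateProg, updateProg, Prog.forRange, Prog.keepsNat,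
    Prog.keepsSizes]

theorem sure_greedyProg {s : State} (hn : s.nat 0 = n) (hm1 : s.nat 1 = m) (hm : 0 < m)
    (hPc : Convex ℝ P) (hP : DownMonotone P) (hopt : IsLinOptOracle P opt)
    (h : SetupInv f P m s.real) (h0 : s.real 0 = 0) :
    Sure f opt greedyProg s fun t => LoopInv f P m m t.real :=
  sure_forRange (by norm_num) round_keepsNat round_keepsSizes
    (by simpa [NatExp.eval] using hm1) (LoopInv.zero h h0)
    fun _ _ _ htS _ ht => sure_round (htS.1.trans hn) hm hPc hP hopt ht

theorem LoopInv.mem {r : ℕ → ℕ → ℝ} (h : LoopInv f P m m r) (hm : 0 < m) (hP : DownMonotone P) :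
    (fun i : Fin n => r 0 i) ∈ P := by
  have hm' : (1 : ℝ) ≤ m := by exact_mod_cast hm
  exact h.2.mem hP ((div_le_one (by linarith)).2 hm') (by field_simp; exact le_rfl)

theorem sure_optimizeProg_mem {s : State} (hn : s.nat 0 = n) (hm1 : s.nat 1 = m) (hm : 0 < m)
    (hs : s.real = fun _ _ => 0) (hPc : Convex ℝ P) (hP : DownMonotone P)
    (hopt : IsLinOptOracle P opt) :
    Sure f opt optimizeProg s fun t => t.output n ∈ P := by
  rw [optimizeProg, sure_seq]
  refine ((setupProg_keepsSizes.sure s).and (sure_setupProg hn hm1 hs hopt hP)).mono ?_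
  rintro t ⟨htS, ht, ht0⟩
  rw [sure_seq]
  have htn := htS.1.trans hn
  refine ((greedyProg_keepsSizes.sure t).and
    (sure_greedyProg htn (htS.2.trans hm1) hm hPc hP hopt ht ht0)).mono ?_
  rintro u ⟨huS, hu⟩
  rw [sure_seq]
  refine ((sampleProg_keepsSizes.sure u).and (sure_sampleProg_real hu.1)).mono ?_
  rintro v ⟨hvS, ⟨hv, -⟩, hv0⟩
  refine (sure_selectProg (hvS.1.trans (huS.1.trans htn))).mono ?_
  rintro x (⟨-, hx⟩ | ⟨-, hx⟩) <;> rw [hx]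
  · exact hv.2.mem
  · have := hu.mem hm hP
    rw [← hv0] at this
    exact this

theorem failProb_sample {s : State} {k : ℕ} (hn : s.nat 0 = n) (hm1 : s.nat 1 = m) (hm : 0 < m)
    (hn0 : 0 < n) (hf0 : Nonneg f) (hf : Submodular f) (hP : DownMonotone P)
    (h : LoopInv f P m k s.real) {B l τ : ℝ}
    (hB : ∀ x ∈ P, (∀ i : Fin n, s.real 7 i = 0 → x i = 0) → multilinearExt f x ≤ B)
    (hl0 : 0 ≤ l) (hl : l * (51 * n ^ 2 * B) ≤ 1) :
    failProb (sampleProg.exec f opt s) (fun t => ∀ i ∈ trackedIndices (s.readVec n 7),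
        |t.real 4 i - m * multilinearExt (valueWith f i) (s.readVec n 0)| ≤ m * τ) ≤
      ENNReal.ofReal (2 * (n + 1) * Real.exp (m * (l ^ 2 * (51 * n ^ 2 * B) ^ 2 - l * τ))) := by
  have hm' : (1 : ℝ) ≤ m := by exact_mod_cast hm
  exact failProb_sampleProg hn hm1 (h.2.mem_cube ((div_le_one (by linarith)).2 hm'))
    (fun i hi => le_of_mem_trackedIndices hi) (fun _ _ _ _ => hf0 _)
    (fun i hi S hS => h.1.2.valueWith_le hf0 hf hP hn0 hB h.2.eq_zero hi hS) hl0 hl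

/-- The greedy loop succeeds up to the failure of the samples. -/
theorem failProb_greedyProg {s : State} (hn : s.nat 0 = n) (hm1 : s.nat 1 = m) (hm : 0 < m)
    (hn0 : 0 < n) (hf0 : Nonneg f) (hf : Submodular f) (hPc : Convex ℝ P) (hP : DownMonotone P)
    (hopt : IsLinOptOracle P opt) (h : SetupInv f P m s.real) (h0 : s.real 0 = 0) {B l τ : ℝ}
    (hB0 : 0 ≤ B)
    (hB : ∀ x ∈ P, (∀ i : Fin n, s.real 7 i = 0 → x i = 0) → multilinearExt f x ≤ B)
    (hl0 : 0 ≤ l) (hl : l * (51 * n ^ 2 * B) ≤ 1) (hτ : 0 ≤ τ) {x : Fin n → ℝ} (hx : x ∈ P)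
    (hxw : ∀ i : Fin n, s.real 7 i = 0 → x i = 0) {e : ℝ}
    (he : 4 * n * τ + 1 / m * n ^ 2 * (51 * n ^ 2 * B) = e) :
    failProb (greedyProg.exec f opt s) (fun t => (LoopInv f P m m t.real ∧
        t.real 7 = s.real 7) ∧
        m * (1 / m) * (1 - 1 / m) ^ (m - 1) * multilinearExt f x - m * (1 / m) * e ≤
          multilinearExt f (t.readVec n 0)) ≤
      m * ENNReal.ofReal
        (2 * (n + 1) * Real.exp (m * (l ^ 2 * (51 * n ^ 2 * B) ^ 2 - l * τ))) := by
  have hm' : (1 : ℝ) ≤ m := by exact_mod_cast hm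
  have hδ1 : 1 / (m : ℝ) ≤ 1 := (div_le_one (by linarith)).2 hm'
  refine failProb_forRange (K := m) (by norm_num) round_keepsNat round_keepsSizes
    (by simpa [NatExp.eval] using hm1) (Inv := fun k r => (LoopInv f P m k r ∧
      r 7 = s.real 7) ∧ k * (1 / m) * (1 - 1 / m) ^ (k - 1) * multilinearExt f x -
        k * (1 / m) * e ≤ multilinearExt f (fun i : Fin n => r 0 i)) ?_ ?_
  · refine ⟨⟨LoopInv.zero h h0, rfl⟩, ?_⟩
    have := multilinearExt_nonneg hf0 ((LoopInv.zero h h0).2.mem_cube hδ1)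
    simpa using this
  · rintro k hk t htS - ⟨⟨htI, ht7⟩, htv⟩
    have htn := htS.1.trans hn
    -- Only the sampling of a round can fail; once the estimates are close, the deterministic update
    -- preserves the value bound surely.
    rw [← add_zero (ENNReal.ofReal _)]
    refine failProb_seq (failProb_sample htn (htS.2.trans hm1) hm hn0 hf0 hf hP htI
      (by rwa [ht7]) hl0 hl) fun u hu hclose => ?_
    have huS := sampleProg_keepsSizes.sure t u hu
    obtain ⟨⟨hu1, hu7⟩, hu0⟩ := sure_sampleProg_real htI.1 u hu
    have huI : LoopInv f P m k u.real := ⟨hu1, by rw [hu7, hu0]; exact htI.2⟩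
    refine (failProb_eq_zero ?_).le
    have hk7 : updateProg.keepsReal 7 := by simp [updateProg, Prog.forRange, Prog.keepsReal]
    have hS := (sure_updateProg_loopInv (huS.1.trans htn) hm hPc hP hopt huI).and
      (sure_keepsReal hk7 u)
    refine fun v hv => ?_
    obtain ⟨⟨hv1, hv0⟩, hv7⟩ := hS v hv
    refine ⟨⟨hv1, by rw [hv7, hu7, ht7]⟩, ?_⟩
    have hv0' : (fun i : Fin n => v.real 0 i) = _ := hv0
    rw [hv0']
    have e7 : t.readVec n 7 = u.readVec n 7 := by
      simp only [State.readVec_eq, hu7]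
    have e0 : t.readVec n 0 = u.readVec n 0 := by
      simp only [State.readVec_eq, hu0]
    rw [e7, e0] at hclose
    obtain ⟨o1, o2⟩ := hopt fun j => u.readVec n 7 j * (u.real 4 j - u.real 4 n)
    have hw7 : ∀ i : Fin n, u.real 7 i = 0 → x i = 0 := by rwa [hu7, ht7]
    have hstep := greedy_value_step (w := u.readVec n 7) (δ := 1 / m) (M := 51 * n ^ 2 * B)
      hu1.2 hf0 hf hP hm rfl hx hw7 rfl huI.2 hτ hclose
      (fun i hi S hS => hu1.2.valueWith_le hf0 hf hP hn0
        (by rwa [hu7, ht7]) huI.2.eq_zero hi hS) (fun _ => rfl) o1 (o2 x hx)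
    have hB' : 0 ≤ 51 * (n : ℝ) ^ 2 * B := by positivity
    have he0 : 0 ≤ e := by rw [← he]; positivity
    refine greedy_recursion hδ1 (A := multilinearExt f (u.readVec n 0)) ?_ ?_ (by positivity) he0
    · rw [← e0]; exact htv
    · rw [← he]; exact hstep

end Analysis
end MultilinearRelaxation
end

noncomputable section

namespace MultilinearRelaxation

/-! ### Choice of the parameters, running time and approximation ratios -/

section Guarantee

variable {n : ℕ} {f : Finset (Fin n) → ℝ} {opt : (Fin n → ℝ) → Fin n → ℝ}
  {P : Set (Fin n → ℝ)} {m : ℕ}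

open Classical in
/-- The classification of the elements that the algorithm computes. -/
def commonWeight (P : Set (Fin n → ℝ)) (i : Fin n) : ℝ :=
  if ∃ x ∈ P, 1 ≤ x i * (50 * n) then 1 else 0

/-- The classification depends on P alone and not on the oracle's tie-breaking, so comparison points
can be fixed before the run. -/
theorem Classified.eq_commonWeight {w b : Fin n → ℝ} {L : ℝ} (hc : Classified f P w b L) :
    w = commonWeight P := by
  ext i
  unfold commonWeight
  rcases hc.zero_or_one i with h | h
  · rw [h, if_neg]
    rintro ⟨x, hx, h1⟩
    exact absurd (hc.rare i h x hx) (not_lt.2 h1)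
  · rw [h, if_pos (hc.common i h)]

theorem commonWeight_zero_or_one (P : Set (Fin n → ℝ)) (i : Fin n) :
    commonWeight P i = 0 ∨ commonWeight P i = 1 := by
  unfold commonWeight
  split_ifs <;> simp

/-- The failure probability of all samples together. -/
theorem sampling_failure_le (hn : 0 < n) (hm : m = 10 ^ 13 * n ^ 8) {B M τ l : ℝ} (hB : 0 < B)
    (hM : M = 51 * n ^ 2 * B) (hτ : τ = B / (1000 * n)) (hl : l = τ / (2 * M ^ 2)) :
    (m + 1) * (2 * (n + 1) * Real.exp (m * (l ^ 2 * M ^ 2 - l * τ))) ≤ Real.exp (-n) := by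
  have hn1 : (1 : ℝ) ≤ n := by exact_mod_cast hn
  have hn' : (0 : ℝ) < n := by linarith
  have hm' : (m : ℝ) = 10 ^ 13 * n ^ 8 := by rw [hm]; push_cast; ring
  -- For this l the exponent is -mτ²/(4M²) with τ/M = 1/(51000 n³): the factor n⁸ in m pays for n⁶
  -- and leaves n².
  have e1 : m * (l ^ 2 * M ^ 2 - l * τ) = -(10 ^ 13 / (4 * 51000 ^ 2) * n ^ 2) := by
    rw [hl, hm', hτ, hM]
    field_simp
    ring
  have e2 : m * (l ^ 2 * M ^ 2 - l * τ) ≤ -(900 * (n : ℝ) ^ 2) := by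
    rw [e1, neg_le_neg_iff]
    refine mul_le_mul_of_nonneg_right (by norm_num) (by positivity)
  have hne : (n : ℝ) + 1 ≤ Real.exp n := Real.add_one_le_exp _
  have hn8 : (n : ℝ) ^ 8 ≤ Real.exp (8 * n) := by
    have := pow_le_pow_left₀ hn'.le (show (n : ℝ) ≤ Real.exp n by linarith) 8
    rwa [← Real.exp_nat_mul] at this
  have h50 : (4 * 10 ^ 13 : ℝ) ≤ Real.exp 50 := by
    have h1 : (2 : ℝ) ≤ Real.exp 1 := by linarith [Real.add_one_le_exp (1 : ℝ)]
    have h2 := pow_le_pow_left₀ (by norm_num) h1 50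
    rw [← Real.exp_nat_mul] at h2
    norm_num at h2 ⊢
    linarith
  have hm1 : (m : ℝ) + 1 ≤ 2 * 10 ^ 13 * Real.exp (8 * n) := by
    have : (1 : ℝ) ≤ Real.exp (8 * n) := Real.one_le_exp (by positivity)
    rw [hm']
    nlinarith
  calc (m + 1) * (2 * (n + 1) * Real.exp (m * (l ^ 2 * M ^ 2 - l * τ)))
      ≤ (2 * 10 ^ 13 * Real.exp (8 * n)) * (2 * Real.exp n * Real.exp (-(900 * (n : ℝ) ^ 2))) := by
        gcongr
    _ = (4 * 10 ^ 13) * (Real.exp (8 * n) * Real.exp n * Real.exp (-(900 * (n : ℝ) ^ 2))) := by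
        ring
    _ ≤ Real.exp 50 * (Real.exp (8 * n) * Real.exp n * Real.exp (-(900 * (n : ℝ) ^ 2))) := by
        gcongr
    _ = Real.exp (50 + (8 * n + n + -(900 * (n : ℝ) ^ 2))) := by
        simp only [Real.exp_add]
    -- For n ≥ 1, 900 n² dominates 50 + 10 n.
    _ ≤ Real.exp (-n) := Real.exp_le_exp.2 (by nlinarith)

/-- With high probability the output is good compared with the points supported on common
elements, and compared with the points supported on rare elements. The parameter `B` is the scale
of the error. -/
theorem failProb_optimizeProg {s : State} (hn : s.nat 0 = n) (hm1 : s.nat 1 = m)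
    (hm : m = 10 ^ 13 * n ^ 8) (hn0 : 0 < n) (hs : s.real = fun _ _ => 0) (hf0 : Nonneg f)
    (hf : Submodular f) (hPp : IsPolytope P) (hP : DownMonotone P) (hopt : IsLinOptOracle P opt)
    {B : ℝ} (hB0 : 0 < B)
    (hB : ∀ x ∈ P, (∀ i, commonWeight P i = 0 → x i = 0) → multilinearExt f x ≤ B)
    {x : Fin n → ℝ} (hx : x ∈ P) (hxw : ∀ i, commonWeight P i = 0 → x i = 0) :
    failProb (optimizeProg.exec f opt s) (fun t =>
        0.36 * multilinearExt f x - 0.01 * B ≤ multilinearExt f (t.output n) ∧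
        ∀ y ∈ P, (∀ i, commonWeight P i = 1 → y i = 0) →
          0.98 * multilinearExt f y - 0.01 * B ≤ multilinearExt f (t.output n)) ≤
      ENNReal.ofReal (Real.exp (-n)) := by
  have hn1 : (1 : ℝ) ≤ n := by exact_mod_cast hn0
  have hnpos : (0 : ℝ) < n := by linarith
  have hmpos : 0 < m := by rw [hm]; positivity
  have hmR : (0 : ℝ) < m := by exact_mod_cast hmpos
  have hm' : (m : ℝ) = 10 ^ 13 * n ^ 8 := by rw [hm]; push_cast; ring
  have hPc := hPp.convex
  -- M bounds the sampled values, τ makes 4nτ equal to 0.004 B, and l minimizes l²M² - lτ. These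
  -- parameters belong to the analysis; the program knows none of them.
  set M : ℝ := 51 * n ^ 2 * B with hM
  set τ : ℝ := B / (1000 * n) with hτ
  set l : ℝ := τ / (2 * M ^ 2) with hl
  have hM0 : 0 < M := by positivity
  have hτ0 : 0 < τ := by positivity
  have hl0 : 0 ≤ l := by positivity
  have hτB : 1000 * n * τ = B := by rw [hτ]; field_simp
  have hlM : l * M ≤ 1 := by
    have h1 : l * M = τ / (2 * M) := by rw [hl]; field_simp
    rw [h1, div_le_one (by positivity), hM]
    have h2 : 1 ≤ (n : ℝ) ^ 2 := one_le_pow₀ hn1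
    nlinarith
  set q : ℝ := 2 * (n + 1) * Real.exp (m * (l ^ 2 * M ^ 2 - l * τ)) with hq
  have hq0 : 0 ≤ q := by positivity
  have htotal : (m : ℝ≥0∞) * ENNReal.ofReal q + ENNReal.ofReal q ≤
      ENNReal.ofReal (Real.exp (-n)) := by
    have e : (m : ℝ≥0∞) * ENNReal.ofReal q + ENNReal.ofReal q =
        ENNReal.ofReal ((m + 1) * q) := by
      rw [add_mul, one_mul, ENNReal.ofReal_add (by positivity) hq0,
        ENNReal.ofReal_mul (p := (m : ℝ)) (by positivity), ENNReal.ofReal_natCast]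
    rw [e]
    exact ENNReal.ofReal_le_ofReal (sampling_failure_le hn0 hm hB0 hM hτ hl)
  refine le_trans ?_ htotal
  rw [optimizeProg, ← zero_add ((m : ℝ≥0∞) * ENNReal.ofReal q + ENNReal.ofReal q)]
  refine failProb_seq (R := fun t => SameSizes s t ∧ SetupInv f P m t.real ∧ t.real 0 = 0)
    (failProb_eq_zero ((setupProg_keepsSizes.sure s).and
      (sure_setupProg hn hm1 hs hopt hP))).le ?_
  rintro t - ⟨htS, ht, ht0⟩
  have htn := htS.1.trans hn
  have htm := htS.2.trans hm1
  have hw : (fun i : Fin n => t.real 7 i) = commonWeight P := ht.2.eq_commonWeight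
  have hwi : ∀ i : Fin n, t.real 7 i = commonWeight P i := fun i => congrFun hw i
  have hBt : ∀ x ∈ P, (∀ i : Fin n, t.real 7 i = 0 → x i = 0) → multilinearExt f x ≤ B := by
    simpa only [hwi] using hB
  refine failProb_seq (failProb_greedyProg htn htm hmpos hn0 hf0 hf hPc hP hopt ht ht0 hB0.le hBt
    hl0 hlM hτ0.le hx (by simpa only [hwi] using hxw) rfl) ?_
  rintro u hu ⟨⟨huI, hu7⟩, huv⟩
  have huS := greedyProg_keepsSizes.sure t u hu
  have hun := huS.1.trans htn
  rw [← add_zero (ENNReal.ofReal q)]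
  refine failProb_seq (failProb_sample hun (huS.2.trans htm) hmpos hn0 hf0 hf hP huI
    (by rwa [hu7]) hl0 hlM) ?_
  intro v hv hclose
  have hvS := sampleProg_keepsSizes.sure u v hv
  obtain ⟨⟨hv1, hv7⟩, hv0⟩ := sure_sampleProg_real huI.1 v hv
  refine (failProb_eq_zero fun z hz => ?_).le
  have hsel := sure_selectProg (hvS.1.trans hun) z hz
  -- the value of the greedy solution and of its estimate
  have h1 := abs_le.1 (hclose n mem_trackedIndices_self)
  rw [multilinearExt_valueWith_self] at h1
  have e0 : u.readVec n 0 = v.readVec n 0 := by simp only [State.readVec_eq, hv0]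
  rw [e0] at h1 huv
  have hval : 0.36 * multilinearExt f x - 0.005 * B ≤ multilinearExt f (v.readVec n 0) := by
    refine le_trans ?_ huv
    have hone : (m : ℝ) * (1 / m) = 1 := by field_simp
    rw [hone, one_mul, one_mul]
    have k1 := mul_le_mul_of_nonneg_right (one_sub_inv_pow_ge m hmpos)
      (multilinearExt_nonneg hf0 (hP.1 hx))
    have k2 : 1 / (m : ℝ) * n ^ 2 * (51 * n ^ 2 * B) ≤ 0.001 * B := by
      have k3 : 1 / (m : ℝ) * n ^ 2 * (51 * n ^ 2 * B) = (51 * n ^ 4 / m) * B := by ring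
      rw [k3]
      refine mul_le_mul_of_nonneg_right ?_ hB0.le
      rw [div_le_iff₀ hmR, hm']
      have k4 : (n : ℝ) ^ 4 ≤ n ^ 8 := pow_le_pow_right₀ hn1 (by norm_num)
      nlinarith
    have k5 : 4 * n * τ = 0.004 * B := by rw [← hτB]; ring
    linarith
  have hτs : τ ≤ 0.001 * B := by
    rw [← hτB]
    nlinarith
  have hLb := hv1.2.multilinearExt_ge hf0 hP hn0
  have hv9 : v.readVec n 9 = fun i : Fin n => v.real 9 i := rfl
  rw [hv1.1] at hsel
  have hwv : ∀ i : Fin n, v.real 7 i = commonWeight P i := fun i => by rw [hv7, hu7, hwi]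
  have hfin : 0.36 * multilinearExt f x - 0.01 * B ≤ multilinearExt f (z.output n) ∧
      0.98 * v.real 12 0 - 0.01 * B ≤ multilinearExt f (z.output n) := by
    -- The estimate is within τ of the greedy value, and the rare solution has value at least 49/50
    -- · L, so in either case the output loses at most τ against both.
    rcases hsel with ⟨hlt, hz⟩ | ⟨hge, hz⟩
    · rw [hz, hv9]
      have k1 : m * (50 * (multilinearExt f (v.readVec n 0) - τ)) < m * (49 * v.real 12 0) := by
        linarith [h1.1]
      have k2 := lt_of_mul_lt_mul_left k1 hmR.le
      constructor <;> linarith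
    · rw [hz]
      have k1 : m * (49 * v.real 12 0) ≤ m * (50 * (multilinearExt f (v.readVec n 0) + τ)) := by
        linarith [h1.2]
      have k2 := le_of_mul_le_mul_left k1 hmR
      constructor <;> linarith
  refine ⟨hfin.1, fun y hy hyw => ?_⟩
  have := hv1.2.rare_le hf0 hf hP hy (by simpa only [hwv] using hyw)
  linarith [hfin.2]

/-- Every property of the output that follows from the guarantees of `failProb_optimizeProg` holds
with high probability. -/
theorem failProb_algorithm {Q : (Fin n → ℝ) → Prop} (hn0 : 0 < n) (hf0 : Nonneg f)
    (hf : Submodular f) (hPp : IsPolytope P) (hP : DownMonotone P) (hopt : IsLinOptOracle P opt)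
    {B : ℝ} (hB0 : 0 < B)
    (hB : ∀ x ∈ P, (∀ i, commonWeight P i = 0 → x i = 0) → multilinearExt f x ≤ B)
    {x : Fin n → ℝ} (hx : x ∈ P) (hxw : ∀ i, commonWeight P i = 0 → x i = 0)
    (hQ : ∀ z ∈ P, 0.36 * multilinearExt f x - 0.01 * B ≤ multilinearExt f z →
        (∀ y ∈ P, (∀ i, commonWeight P i = 1 → y i = 0) →
          0.98 * multilinearExt f y - 0.01 * B ≤ multilinearExt f z) → Q z) :
    failProb (algorithm.run f opt) (fun t => Q (t.output n)) ≤ ENNReal.ofReal (Real.exp (-n)) := by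
  rw [Prog.run, algorithm, ← zero_add (ENNReal.ofReal _)]
  refine failProb_seq (R := fun t => (t.nat 0 = n ∧ t.nat 1 = 10 ^ 13 * n ^ 8) ∧
      t.real = fun _ _ => 0)
    (failProb_eq_zero ((sure_sizeProg (by simp [initState])).and
      (sure_sizeProg_real _))).le ?_
  rintro t - ⟨⟨htn, htm⟩, hs⟩
  have hm : 0 < 10 ^ 13 * n ^ 8 := by positivity
  refine le_trans (failProb_mono fun z hz hz' => ?_)
    (failProb_optimizeProg htn htm rfl hn0 hs hf0 hf hPp hP hopt hB0 hB hx hxw)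
  exact hQ _ (sure_optimizeProg_mem htn htm hm hs hPp.convex hP hopt z hz) hz'.1 hz'.2

theorem sure_algorithm_mem (hPp : IsPolytope P) (hP : DownMonotone P)
    (hopt : IsLinOptOracle P opt) :
    Sure f opt algorithm (initState n) fun t => t.output n ∈ P := by
  rcases Nat.eq_zero_or_pos n with rfl | hn0
  -- For n = 0 the number of rounds is 0, but the space has a single point, which lies in P.
  · intro t _
    rw [Subsingleton.elim (t.output 0) (opt 0)]
    exact (hopt 0).1
  · rw [algorithm, sure_seq]
    refine ((sure_sizeProg (by simp [initState])).and (sure_sizeProg_real _)).mono ?_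
    rintro t ⟨⟨htn, htm⟩, hs⟩
    exact sure_optimizeProg_mem htn htm (by positivity) hs hPp.convex hP hopt

/-- A bound for the number of steps of the algorithm. -/
def algorithmTime : Polynomial ℕ :=
  sizeProg.timeBound (fun _ => Polynomial.X) +
    optimizeProg.timeBound fun v => if v = 0 then Polynomial.X else 10 ^ 13 * Polynomial.X ^ 8

/-- The program is split after `sizeProg`: register 1 is written there, and may bound loops only
afterwards, when its value 10^13 n^8 is known. -/
theorem sure_algorithm_steps :
    Sure f opt algorithm (initState n) fun t => t.steps ≤ algorithmTime.eval n := by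
  rw [algorithm, sure_seq]
  have h1 : sizeProg.loopsOver fun v => v = 0 := by
    simp [sizeProg, Prog.loopsOver, NatExp.uses]
  have h2 : optimizeProg.loopsOver fun v => v = 0 ∨ v = 1 := by
    simp [optimizeProg, setupProg, countProg, classifyProg, rareProg, greedyProg, sampleProg,
      drawProg, accumulateProg, updateProg, selectProg, Prog.forRange, Prog.loopsOver, NatExp.uses]
  refine ((sure_steps_le (q := fun _ => Polynomial.X) h1 (initState n)
    (by rintro v rfl; simp [initState])).and
      (sure_sizeProg (s := initState n) (by simp [initState]))).mono ?_
  rintro t ⟨⟨ht, -⟩, htn, htm⟩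
  refine (sure_steps_le (q := fun v => if v = 0 then Polynomial.X else 10 ^ 13 * Polynomial.X ^ 8)
    h2 t ?_).mono fun u hu => ?_
  · rintro v (rfl | rfl)
    · simp [htn]
    · simp [htm]
  · have := hu.1
    simp only [initState] at ht
    simp only [algorithmTime, Polynomial.eval_add]
    omega

/-- The largest value over the points of `P` that are supported on common elements is attained. -/
theorem exists_common_max (f : Finset (Fin n) → ℝ) (hPp : IsPolytope P) (hP : DownMonotone P)
    (hne : P.Nonempty) : ∃ x ∈ P, (∀ i, commonWeight P i = 0 → x i = 0) ∧
      ∀ y ∈ P, (∀ i, commonWeight P i = 0 → y i = 0) →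
        multilinearExt f y ≤ multilinearExt f x := by
  obtain ⟨p, hp⟩ := hne
  have hcl : IsClosed {x : Fin n → ℝ | ∀ i, commonWeight P i = 0 → x i = 0} := by
    have : {x : Fin n → ℝ | ∀ i, commonWeight P i = 0 → x i = 0} =
        ⋂ i, ⋂ _ : commonWeight P i = 0, {x | x i = 0} := by
      ext x; simp
    rw [this]
    exact isClosed_iInter fun i => isClosed_iInter fun _ =>
      isClosed_eq (continuous_apply i) continuous_const
  obtain ⟨x, hx, hmax⟩ := (hPp.isCompact.inter_right hcl).exists_isMaxOn
    ⟨0, hP.2 p hp 0 ⟨le_rfl, zero_le_one⟩ (hP.1 hp).1, fun _ _ => rfl⟩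
    (differentiable_multilinearExt f).continuous.continuousOn
  exact ⟨x, hx.1, hx.2, fun y hy hyw => hmax ⟨hy, hyw⟩⟩

theorem common_mul_mem (hP : DownMonotone P) {x w : Fin n → ℝ} (hx : x ∈ P)
    (hw : ∀ i, w i = 0 ∨ w i = 1) : (fun i => w i * x i) ∈ P := by
  have h0 : ∀ i, 0 ≤ x i := (hP.1 hx).1
  have h1 : ∀ i, x i ≤ 1 := (hP.1 hx).2
  refine hP.2 x hx _ ⟨fun i => ?_, fun i => ?_⟩ fun i => ?_ <;>
    rcases hw i with h | h <;> simp [h, h0 i, h1 i]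

theorem multilinearExt_le_common_add_rare (hf0 : Nonneg f) (hf : Submodular f)
    (hP : DownMonotone P) {x : Fin n → ℝ} (hx : x ∈ P) :
    ∃ y ∈ P, ∃ z ∈ P, (∀ i, commonWeight P i = 0 → y i = 0) ∧
      (∀ i, commonWeight P i = 1 → z i = 0) ∧
      multilinearExt f x ≤ multilinearExt f y + multilinearExt f z := by
  have hw := commonWeight_zero_or_one P
  refine ⟨_, common_mul_mem hP hx hw, _, common_mul_mem (w := fun i => 1 - commonWeight P i) hP hx
    (fun i => ?_), fun i hi => by simp [hi], fun i hi => by simp [hi],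
    multilinearExt_le_add_restrict hf0 hf (hP.1 hx) hw⟩
  rcases hw i with h | h <;> simp [h]

/-- With a the best common value and r the rare part of x, the output is at least 0.35 a and at
least 0.98 r - 0.01 a; a suitable average of the two exceeds 0.25 (a + r). -/
theorem failProb_algorithm_quarter (hn0 : 0 < n) (hf0 : Nonneg f) (hf : Submodular f)
    (hPp : IsPolytope P) (hP : DownMonotone P) (hopt : IsLinOptOracle P opt) :
    failProb (algorithm.run f opt) (fun t => ∀ x ∈ P,
      0.25 * multilinearExt f x ≤ multilinearExt f (t.output n)) ≤
      ENNReal.ofReal (Real.exp (-n)) := by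
  have hne : P.Nonempty := ⟨_, (hopt 0).1⟩
  obtain ⟨a, haP, haw, hamax⟩ := exists_common_max f hPp hP hne
  have ha0 := multilinearExt_nonneg hf0 (hP.1 haP)
  rcases ha0.lt_or_eq with hpos | hzero
  · refine failProb_algorithm (Q := fun z => ∀ x ∈ P, 0.25 * multilinearExt f x ≤ multilinearExt f z)
      hn0 hf0 hf hPp hP hopt hpos hamax haP haw fun z hz h1 h2 x hx => ?_
    obtain ⟨y, hy, y', hy', hyw, hyw', hle⟩ := multilinearExt_le_common_add_rare hf0 hf hP hx
    have h3 := hamax y hy hyw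
    have h4 := h2 y' hy' hyw'
    have h5 := multilinearExt_nonneg hf0 (hP.1 hy')
    linarith
  -- The error scale must be positive. If the best common value is 0, the optimum over P takes its
  -- place: it is then carried by the rare elements, and the ratio is 0.97. If it is 0 too, every
  -- point of P is optimal.
  · obtain ⟨o, hoP, homax⟩ := hPp.isCompact.exists_isMaxOn hne
      (differentiable_multilinearExt f).continuous.continuousOn
    have homax' : ∀ x ∈ P, multilinearExt f x ≤ multilinearExt f o := fun x hx => homax hx
    rcases (multilinearExt_nonneg hf0 (hP.1 hoP)).lt_or_eq with hopos | hozero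
    · refine failProb_algorithm (Q := fun z => ∀ x ∈ P, 0.25 * multilinearExt f x ≤ multilinearExt f z)
        hn0 hf0 hf hPp hP hopt hopos (fun x hx _ => homax' x hx) haP haw fun z hz h1 h2 x hx => ?_
      obtain ⟨y, hy, y', hy', hyw, hyw', hle⟩ := multilinearExt_le_common_add_rare hf0 hf hP hoP
      have h3 := hamax y hy hyw
      have h4 := h2 y' hy' hyw'
      have h5 := homax' x hx
      linarith
    · rw [failProb_eq_zero]
      · exact zero_le
      · intro t ht x hx
        have h1 := homax' x hx
        have h2 := multilinearExt_nonneg hf0 (hP.1 (sure_algorithm_mem hPp hP hopt t ht))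
        linarith

theorem failProb_algorithm_integral (hn0 : 0 < n) (hf0 : Nonneg f) (hf : Submodular f)
    (hPp : IsPolytope P) (hP : DownMonotone P) (hopt : IsLinOptOracle P opt) :
    failProb (algorithm.run f opt) (fun t => ∀ x ∈ P, IsIntegral x →
      0.309 * multilinearExt f x ≤ multilinearExt f (t.output n)) ≤
      ENNReal.ofReal (Real.exp (-n)) := by
  have hne : P.Nonempty := ⟨_, (hopt 0).1⟩
  obtain ⟨a, haP, haw, hamax⟩ := exists_common_max f hPp hP hne
  have hn1 : (1 : ℝ) ≤ n := by exact_mod_cast hn0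
  -- An integral point with x_i = 1 is itself a witness that i is common, as 1 ≤ 50n.
  have hint : ∀ x ∈ P, IsIntegral x → multilinearExt f x ≤ multilinearExt f a := by
    refine fun x hx hxi => hamax x hx fun i hi => (hxi i).resolve_right fun h => ?_
    unfold commonWeight at hi
    rw [if_pos ⟨x, hx, by rw [h]; linarith⟩] at hi
    norm_num at hi
  have ha0 := multilinearExt_nonneg hf0 (hP.1 haP)
  rcases ha0.lt_or_eq with hpos | hzero
  · refine failProb_algorithm (Q := fun z => ∀ x ∈ P, IsIntegral x →
      0.309 * multilinearExt f x ≤ multilinearExt f z) hn0 hf0 hf hPp hP hopt hpos hamax haP haw fun z hz h1 h2 x hx hxi => ?_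
    have h3 := hint x hx hxi
    linarith
  · rw [failProb_eq_zero]
    · exact zero_le
    · intro t ht x hx hxi
      have h1 := hint x hx hxi
      have h2 := multilinearExt_nonneg hf0 (hP.1 (sure_algorithm_mem hPp hP hopt t ht))
      linarith

/-- A bound on the failure probability for positive `n` makes the algorithm an approximation
algorithm. -/
theorem isPolyTimeApprox_algorithm {α : ℝ} {C : ∀ {n : ℕ}, (Fin n → ℝ) → Prop}
    (h : ∀ (n : ℕ) (f : Finset (Fin n) → ℝ) (P : Set (Fin n → ℝ))
      (opt : (Fin n → ℝ) → Fin n → ℝ), 0 < n → Nonneg f → Submodular f → IsPolytope P →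
      DownMonotone P → IsLinOptOracle P opt →
      failProb (algorithm.run f opt) (fun t => ∀ x ∈ P, C x →
        α * multilinearExt f x ≤ multilinearExt f (t.output n)) ≤
        ENNReal.ofReal (Real.exp (-n))) :
    IsPolyTimeApprox α C algorithm := by
  refine ⟨algorithmTime, fun n f P opt hf0 hf hPp hP hopt => ⟨fun s hs =>
    ⟨sure_algorithm_steps s hs, sure_algorithm_mem hPp hP hopt s hs⟩, ?_⟩⟩
  rcases Nat.eq_zero_or_pos n with rfl | hn0
  -- For n = 0 the required probability is 1 - exp 0 = 0.
  · simp
  · have := toOuterMeasure_ge_of_failProb_le (h n f P opt hn0 hf0 hf hPp hP hopt)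
    rwa [← ENNReal.ofReal_one, ← ENNReal.ofReal_sub _ (Real.exp_pos _).le] at this

end Guarantee
end MultilinearRelaxation
end

open MultilinearRelaxation in
theorem theorem1 :
    -- a polynomial-time 0.25-approximation
    (∃ A : Prog, IsPolyTimeApprox 0.25 (fun _ => True) A) ∧
    -- a polynomial-time 0.309-approximation with respect to the best integer point
    (∃ A : Prog, IsPolyTimeApprox 0.309 (fun x => IsIntegral x) A) ∧
    -- two rounds of local search: the better of the two local optima has value at least opt / 4,
    -- up to the accuracy of the local optima
    (∀ (n : ℕ) (f : Finset (Fin n) → ℝ) (P : Set (Fin n → ℝ)),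
      Nonneg f → Submodular f → IsPolytope P → DownMonotone P →
      ∀ (ε : ℝ) (x z : Fin n → ℝ), 0 ≤ ε → IsLocalOpt f P ε x →
        IsLocalOpt f {y ∈ P | y ≤ 1 - x} ε z →
        ∀ w ∈ P, multilinearExt f w / 4 - ε / 2 ≤ max (multilinearExt f x) (multilinearExt f z)) ∧
    -- restricted local search on P ∩ [0,t]^N with t = (3 - √5) / 2: a local optimum has at least
    -- (√5 - 1) / 4 ≥ 0.309 times the value of any integer point, up to the accuracy
    (∀ (n : ℕ) (f : Finset (Fin n) → ℝ) (P : Set (Fin n → ℝ)),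
      Nonneg f → Submodular f → IsPolytope P → DownMonotone P →
      ∀ (t ε η : ℝ) (x : Fin n → ℝ), t = (3 - √5) / 2 → 0 ≤ ε → 0 < η → η ≤ t →
        IsLocalOpt f {y ∈ P | ∀ i, y i ≤ t} ε x →
        ∀ w ∈ P, IsIntegral w →
          ((√5 - 1) / 4 - η / 2) * multilinearExt f w - ε / (2 * η) ≤ multilinearExt f x) := by
  refine ⟨⟨algorithm, isPolyTimeApprox_algorithm ?_⟩, ⟨algorithm, isPolyTimeApprox_algorithm ?_⟩,
    ?_, ?_⟩
  · intro n f P opt hn0 hf0 hf hPp hP hopt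
    simpa using failProb_algorithm_quarter hn0 hf0 hf hPp hP hopt
  · intro n f P opt hn0 hf0 hf hPp hP hopt
    exact failProb_algorithm_integral hn0 hf0 hf hPp hP hopt
  · intro n f P hf0 hf _ hP ε x z _ hx hz w hw
    exact max_localOpt_ge hf0 hf hP hx hz hw
  · intro n f P hf0 hf hPp hP t ε η x ht _ hη0 hη hx w hw hwi
    have h5 : √5 ^ 2 = 5 := Real.sq_sqrt (by norm_num)
    have h5l : 2 < √5 := Real.lt_sqrt_of_sq_lt (by norm_num)
    have h5u : √5 < 3 := by nlinarith [Real.sqrt_nonneg 5]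
    have h := restricted_localOpt_ge hf0 hf hPp.convex hP (by rw [ht]; nlinarith)
      (by linarith) (by linarith) hη0 hη hx hw hwi
    have hF := multilinearExt_nonneg hf0 (hP.1 hw)
    have e : ε / (2 * η) = ε / η / 2 := by rw [mul_comm, div_mul_eq_div_div]
    rw [ht] at h
    have h1 := mul_nonneg hη0.le hF
    rw [e]
    -- The bound obtained has (1 - t)/2 = (√5 - 1)/4 as its coefficient; the loss η/2 is given away
    -- using F(w) ≥ 0.
    nlinarith
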